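/- Let $n\ge 2$, let $q$ be a power $p^f$ ($f\ge 1$) of a prime $p$, let $\Bbbk$ be an algebraically closed field of characteristic $\ell\neq p$ ($\ell \ge 0$) in which $q\neq 1$, and write $q$ also for its image in $\Bbbk$. Let $e$ be the multiplicative order of $q\in\Bbbk^\times$, with $e=0$ and $\mathbb{Z}/e\mathbb{Z}=\mathbb{Z}$ if the order is infinite. Fix $\mathbf{i}\in(\mathbb{Z}/e\mathbb{Z})^n$, let $\mathfrak{S}\mathbf{i}$ be its orbit under the symmetric group $\mathfrak{S}=\mathfrak{S}_n$ permuting entries, and let $s_r\cdot\mathbf{u}$ denote $\mathbf{u}$ with the entries $u_r,u_{r+1}$ interchanged. *Hecke side.* Let $\mathcal{H}$ be the affine Hecke algebra: the unital $\Bbbk$-algebra generated by $T_1,\dots,T_{n-1},X_1^{\pm1},\dots,X_n^{\pm1}$ with relations $(T_r-q)(T_r+1)=0$; $T_rT_s=T_sT_r$ if $|r-s|>1$; $T_rT_{r+1}T_r=T_{r+1}T_rT_{r+1}$; $X_jX_j^{-1}=1=X_j^{-1}X_j$; $X_jX_l=X_lX_j$; $T_rX_j=X_jT_r$ if $j\ne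 r,r+1$; $T_rX_rT_r=qX_{r+1}$. Let $\mathfrak{m}\subset\mathcal{H}$ be the set of symmetric Laurent polynomials in $X_1,\dots,X_n$ vanishing at $(q^{i_1},\dots,q^{i_n})$, let $\mathcal{I}$ be the two-sided ideal of $\mathcal{H}$ generated by $\mathfrak{m}$, and let $\widehat{\mathcal{H}}_{\mathbf i}=\varprojlim_l\mathcal{H}/\mathcal{I}^l$, with the inverse limit topology of the discrete quotients. Let $\widehat{\mathcal P}_{\mathbf i}\subset\widehat{\mathcal H}_{\mathbf i}$ be the closure of the subalgebra generated by the $X_j^{\pm1}$. *KLR side.* Let $\mathbf{R}_{\mathbf i}$ be the unital $\Bbbk$-algebra generated by $e(\mathbf u)$ ($\mathbf u\in\mathfrak{S}\mathbf i$), $\psi_1,\dots,\psi_{n-1}$, $x_1,\dots,x_n$ with relations: $e(\mathbf u)e(\mathbf u')=\delta_{\mathbf u,\mathbf u'}e(\mathbf u)$; $\sum_{\mathbf u}e(\mathbf u)=1$; $x_re(\mathbf u)=e(\mathbf u)x_r$; $\psi_re(\mathbf u)=e(s_r\cdot\mathbf u)\psi_r$; $x_rx_s=x_sx_r$; $\psi_r\psi_s=\psi_s\psi_r$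 if $|r-s|>1$; $\psi_rx_s=x_s\psi_r$ if $s\neq r,r+1$; $\psi_rx_{r+1}e(\mathbf u)=(x_r\psi_r+\delta_{u_r,u_{r+1}})e(\mathbf u)$; $x_{r+1}\psi_re(\mathbf u)=(\psi_rx_r+\delta_{u_r,u_{r+1}})e(\mathbf u)$; $$\psi_r^2e(\mathbf u)=\begin{cases}0&u_r=u_{r+1},\\ e(\mathbf u)&u_{r+1}\ne u_r,u_r\pm1,\\ (x_{r+1}-x_r)e(\mathbf u)&u_{r+1}=u_r+1,\ e\ne2,\\ (x_r-x_{r+1})e(\mathbf u)&u_{r+1}=u_r-1,\ e\neq2,\\ (x_{r+1}-x_r)(x_r-x_{r+1})e(\mathbf u)&u_{r+1}\ne u_r,\ e=2;\end{cases}$$ $$\psi_r\psi_{r+1}\psi_re(\mathbf u)=\begin{cases}(\psi_{r+1}\psi_r\psi_{r+1}+1)e(\mathbf u)&u_{r+2}=u_r=u_{r+1}-1,\ e\ne2,\\ (\psi_{r+1}\psi_r\psi_{r+1}-1)e(\mathbf u)&u_{r+2}=u_r=u_{r+1}+1,\ e\ne2,\\ (\psi_{r+1}\psi_r\psi_{r+1}+x_r+x_{r+2}-2x_{r+1})e(\mathbf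 u)&u_{r+2}=u_r\neq u_{r+1},\ e=2,\\ \psi_{r+1}\psi_r\psi_{r+1}e(\mathbf u)&\text{otherwise.}\end{cases}$$ Let $\mathbf I=(x_1,\dots,x_n)\subset\Bbbk[x_1,\dots,x_n]$ and $\widehat{\mathbf R}_{\mathbf i}=\varprojlim_l\mathbf{R}_{\mathbf i}/\mathbf{R}_{\mathbf i}\mathbf I^l\mathbf{R}_{\mathbf i}$, with the inverse limit topology, and let $\widehat{\mathbf P}_{\mathbf i}$ be the closure of the subalgebra generated by the $e(\mathbf u)$ and the $x_j$. *Theorem.* There is a unique complete family of pairwise orthogonal idempotents $(e_{\mathbf u})_{\mathbf u\in\mathfrak{S}\mathbf i}$ in $\widehat{\mathcal H}_{\mathbf i}$ such that $\widehat{\mathcal H}_{\mathbf i}e_{\mathbf u}$ is the set of all $h$ with the following property: for every $l$ there is an $N$ such that $h(X_j-q^{u_j})^N$ maps to $0$ in $\mathcal H/\mathcal I^l$ for all $j$. For $u_{r+1}\ne u_r$ the element $(1-X_rX_{r+1}^{-1})e_{\mathbf u}$ is invertible in $e_{\mathbf u}\widehat{\mathcal H}_{\mathbf i}e_{\mathbf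 u}$, so that $$\Phi_r=T_r+\sum_{u_{r+1}\neq u_r}\frac{1-q}{1-X_rX_{r+1}^{-1}}e_{\mathbf u}+\sum_{u_{r+1}=u_r}e_{\mathbf u}\qquad(1\le r\le n-1)$$ is a well-defined element of $\widehat{\mathcal H}_{\mathbf i}$; likewise the denominators below are invertible in $\widehat{\mathbf R}_{\mathbf i}$. There is an isomorphism of $\Bbbk$-algebras $\gamma:\widehat{\mathcal H}_{\mathbf i}\to\widehat{\mathbf R}_{\mathbf i}$, which is also a homeomorphism, such that $\gamma$ restricts to an isomorphism $\widehat{\mathcal P}_{\mathbf i}\to\widehat{\mathbf P}_{\mathbf i}$ with $$\gamma(e_{\mathbf u})=e(\mathbf u),\qquad \gamma\big((X_j-q^{u_j})e_{\mathbf u}\big)=-q^{u_j}x_je(\mathbf u)\qquad(\mathbf u\in\mathfrak{S}\mathbf i,\ 1\le j\le n),$$ and $\gamma(e_{s_r\cdot\mathbf u}\Phi_r)=A_r^{\mathbf u}\psi_re(\mathbf u)$ for all $\mathbf u\in\mathfrak{S}\mathbf i$ and $1\le r\le n-1$, where $$A_r^{\mathbf u}=\begin{cases}1-q-x_r+qx_{r+1}&\text{if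 }u_{r+1}=u_r,\\[1mm] \dfrac{-q}{1-q-x_{r+1}+qx_r}&\text{if }u_{r+1}=u_r+1,\\[3mm] \dfrac{q^{u_{r+1}}(1-x_r)-q^{u_r+1}(1-x_{r+1})}{q^{u_r}(1-x_{r+1})-q^{u_{r+1}}(1-x_r)}&\text{if }u_{r+1}\neq u_r,u_r+1.\end{cases}$$ -/

import Mathlib

noncomputable section

/-! ### Completion of an algebra along a decreasing sequence of two-sided ideals -/

section Completion

variable {k : Type*} [CommRing k] {A : Type*} [Ring A] [Algebra k A]

/-- The inverse limit of the quotients `A ⧸ J l`, as the subalgebra of compatible families in the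
product of all `A ⧸ J l`. -/
def completionSubalgebra (k : Type*) [CommRing k] {A : Type*} [Ring A] [Algebra k A]
    (J : ℕ → Ideal A) [∀ l, (J l).IsTwoSided] (hJ : Antitone J) :
    Subalgebra k (∀ l, A ⧸ J l) where
  carrier := {z | ∀ (l l' : ℕ) (h : l ≤ l'), Ideal.Quotient.factor (hJ h) (z l') = z l}
  mul_mem' := fun ha hb l l' h => by
    rw [Pi.mul_apply, map_mul, ha l l' h, hb l l' h, Pi.mul_apply]
  add_mem' := fun ha hb l l' h => by
    rw [Pi.add_apply, map_add, ha l l' h, hb l l' h, Pi.add_apply]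
  algebraMap_mem' := fun _ _ _ _ => rfl

/-- The completion `lim_l A ⧸ J l`. -/
def IdealCompletion (k : Type*) [CommRing k] {A : Type*} [Ring A] [Algebra k A]
    (J : ℕ → Ideal A) [∀ l, (J l).IsTwoSided] (hJ : Antitone J) : Type _ :=
  completionSubalgebra k J hJ

namespace IdealCompletion

variable (J : ℕ → Ideal A) [∀ l, (J l).IsTwoSided] (hJ : Antitone J)

instance : Ring (IdealCompletion k J hJ) :=
  inferInstanceAs (Ring (completionSubalgebra k J hJ))

instance : Algebra k (IdealCompletion k J hJ) :=
  inferInstanceAs (Algebra k (completionSubalgebra k J hJ))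

/-- The projection `lim_l A ⧸ J l → A ⧸ J l`. -/
def proj (l : ℕ) : IdealCompletion k J hJ →ₐ[k] A ⧸ J l :=
  (Pi.evalAlgHom k (fun l => A ⧸ J l) l).comp (completionSubalgebra k J hJ).val

/-- The canonical map `A → lim_l A ⧸ J l`. -/
def of : A →ₐ[k] IdealCompletion k J hJ :=
  AlgHom.codRestrict (AlgHom.pi fun l => Ideal.Quotient.mkₐ k (J l))
    (completionSubalgebra k J hJ) (fun _ _ _ _ => rfl)

/-- The inverse limit topology, each `A ⧸ J l` being discrete. -/
instance : TopologicalSpace (IdealCompletion k J hJ) :=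
  ⨅ l, TopologicalSpace.induced (proj (k := k) J hJ l) ⊥

end IdealCompletion

end Completion

/-! ### The orbit of `i` under the symmetric group, and powers of `q` -/

/-- The orbit `𝔖 i` of a tuple under permutation of its entries. -/
def SymOrbit {N e : ℕ} (i : Fin N → ZMod e) : Type :=
  {u : Fin N → ZMod e // ∃ σ : Equiv.Perm (Fin N), u = i ∘ σ}

instance {N e : ℕ} (i : Fin N → ZMod e) : Finite (SymOrbit i) :=
  Finite.of_surjective
    (fun σ : Equiv.Perm (Fin N) => (⟨i ∘ σ, σ, rfl⟩ : SymOrbit i))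
    (fun u => by
      obtain ⟨v, σ, h⟩ := u
      exact ⟨σ, Subtype.ext h.symm⟩)

instance {N e : ℕ} (i : Fin N → ZMod e) : Fintype (SymOrbit i) := Fintype.ofFinite _

instance {N e : ℕ} (i : Fin N → ZMod e) : DecidableEq (SymOrbit i) := Classical.decEq _

/-- `s_r · u`: the entries of `u` at the (consecutive) positions `r`, `r + 1` are interchanged.
Positions and simple reflections are numbered from `0`. -/
def SymOrbit.s {m e : ℕ} {i : Fin (m + 1) → ZMod e} (r : Fin m) (u : SymOrbit i) : SymOrbit i :=
  ⟨u.1 ∘ Equiv.swap r.castSucc r.succ, by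
    obtain ⟨v, σ, h⟩ := u
    exact ⟨(Equiv.swap r.castSucc r.succ).trans σ, by subst h; rfl⟩⟩

/-- `q ^ a` for `a ∈ ℤ/eℤ`, where `e` is the multiplicative order of `q`
(`e = 0` and `ℤ/eℤ = ℤ` when `q` is not a root of unity). -/
def qpow {k : Type*} [Field k] (q : k) (a : ZMod (orderOf q)) : k := q ^ (a.cast : ℤ)

/-! ### The affine Hecke algebra of `GL_{m+1}` -/

/-- Generators `T_r`, `X_j`, `X_j⁻¹`. -/
inductive HeckeGen (m : ℕ) : Type
  | T (r : Fin m)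
  | X (j : Fin (m + 1))
  | Xinv (j : Fin (m + 1))

namespace Hecke

open HeckeGen

/-- The defining relations of the affine Hecke algebra (Bernstein presentation). -/
inductive Rel {k : Type*} [Field k] (q : k) (m : ℕ) :
    FreeAlgebra k (HeckeGen m) → FreeAlgebra k (HeckeGen m) → Prop
  | quadratic (r : Fin m) :
      Rel q m ((FreeAlgebra.ι k (T r) - algebraMap k _ q) * (FreeAlgebra.ι k (T r) + 1)) 0
  | T_comm (r s : Fin m) (h : r.val + 1 < s.val) :
      Rel q m (FreeAlgebra.ι k (T r) * FreeAlgebra.ι k (T s))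
        (FreeAlgebra.ι k (T s) * FreeAlgebra.ι k (T r))
  | braid (r s : Fin m) (h : s.val = r.val + 1) :
      Rel q m (FreeAlgebra.ι k (T r) * FreeAlgebra.ι k (T s) * FreeAlgebra.ι k (T r))
        (FreeAlgebra.ι k (T s) * FreeAlgebra.ι k (T r) * FreeAlgebra.ι k (T s))
  | X_mul_Xinv (j : Fin (m + 1)) :
      Rel q m (FreeAlgebra.ι k (X j) * FreeAlgebra.ι k (Xinv j)) 1
  | Xinv_mul_X (j : Fin (m + 1)) :
      Rel q m (FreeAlgebra.ι k (Xinv j) * FreeAlgebra.ι k (X j)) 1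
  | X_comm (j l : Fin (m + 1)) :
      Rel q m (FreeAlgebra.ι k (X j) * FreeAlgebra.ι k (X l))
        (FreeAlgebra.ι k (X l) * FreeAlgebra.ι k (X j))
  | T_X_comm (r : Fin m) (j : Fin (m + 1)) (h : j ≠ r.castSucc) (h' : j ≠ r.succ) :
      Rel q m (FreeAlgebra.ι k (T r) * FreeAlgebra.ι k (X j))
        (FreeAlgebra.ι k (X j) * FreeAlgebra.ι k (T r))
  | T_X_T (r : Fin m) :
      Rel q m (FreeAlgebra.ι k (T r) * FreeAlgebra.ι k (X r.castSucc) * FreeAlgebra.ι k (T r))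
        (algebraMap k _ q * FreeAlgebra.ι k (X r.succ))

end Hecke

/-- The affine Hecke algebra `ℋ` of `GL_{m+1}` with parameter `q`. -/
abbrev Hecke {k : Type*} [Field k] (q : k) (m : ℕ) : Type _ := RingQuot (Hecke.Rel q m)

namespace Hecke

variable {k : Type*} [Field k] (q : k) {m : ℕ}

/-- The generator `T_r` of `ℋ`. -/
def T (r : Fin m) : Hecke q m := RingQuot.mkAlgHom k (Rel q m) (FreeAlgebra.ι k (HeckeGen.T r))

/-- The invertible generator `X_j` of `ℋ`. -/
def X (j : Fin (m + 1)) : (Hecke q m)ˣ where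
  val := RingQuot.mkAlgHom k (Rel q m) (FreeAlgebra.ι k (HeckeGen.X j))
  inv := RingQuot.mkAlgHom k (Rel q m) (FreeAlgebra.ι k (HeckeGen.Xinv j))
  val_inv := by
    rw [← map_mul, RingQuot.mkAlgHom_rel k (Rel.X_mul_Xinv j), map_one]
  inv_val := by
    rw [← map_mul, RingQuot.mkAlgHom_rel k (Rel.Xinv_mul_X j), map_one]

/-- The element of `ℋ` given by the Laurent polynomial with coefficient function `f`:
`∑_a f(a) X_1^{a_1} ⋯ X_n^{a_n}`. -/
def laurent (f : (Fin (m + 1) → ℤ) →₀ k) : Hecke q m :=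
  f.sum fun a c => c • (((List.ofFn fun j => X q j ^ a j).prod : (Hecke q m)ˣ) : Hecke q m)

/-- The value of the Laurent polynomial with coefficient function `f` at `(q^{i_1}, …, q^{i_n})`. -/
def laurentEval (i : Fin (m + 1) → ZMod (orderOf q)) (f : (Fin (m + 1) → ℤ) →₀ k) : k :=
  f.sum fun a c => c * ∏ j, qpow q (i j) ^ a j

/-- The kernel of the central character `χ_i`, which is the restriction of `X_j ↦ q^{i_j}` to the
symmetric Laurent polynomials in the `X_j`, that is, to the centre of `ℋ`. -/
def kerChi (i : Fin (m + 1) → ZMod (orderOf q)) : Set (Hecke q m) :=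
  {z | ∃ f : (Fin (m + 1) → ℤ) →₀ k,
    (∀ (σ : Equiv.Perm (Fin (m + 1))) (a : Fin (m + 1) → ℤ), f (a ∘ σ) = f a) ∧
      laurentEval q i f = 0 ∧ z = laurent q f}

/-- The two-sided ideal of `ℋ` generated by the kernel of `χ_i`. -/
def idealM (i : Fin (m + 1) → ZMod (orderOf q)) : Ideal (Hecke q m) :=
  (TwoSidedIdeal.span (kerChi q i)).asIdeal

instance (i : Fin (m + 1) → ZMod (orderOf q)) : (idealM q i).IsTwoSided :=
  inferInstanceAs (TwoSidedIdeal.asIdeal _).IsTwoSided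

theorem idealM_pow_antitone (i : Fin (m + 1) → ZMod (orderOf q)) :
    Antitone fun l : ℕ => idealM q i ^ l :=
  fun _ _ h => Ideal.pow_le_pow_right h

end Hecke

/-- The completion `ℋ̂_i` of `ℋ` at the powers of the ideal generated by the kernel of `χ_i`. -/
abbrev HeckeHat {k : Type*} [Field k] (q : k) {m : ℕ} (i : Fin (m + 1) → ZMod (orderOf q)) :
    Type _ :=
  IdealCompletion k (fun l : ℕ => Hecke.idealM q i ^ l) (Hecke.idealM_pow_antitone q i)

namespace HeckeHat

variable {k : Type*} [Field k] (q : k) {m : ℕ} (i : Fin (m + 1) → ZMod (orderOf q))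

/-- The canonical map `ℋ → ℋ̂_i`. -/
def of : Hecke q m →ₐ[k] HeckeHat q i := IdealCompletion.of _ _

/-- The projection of `ℋ̂_i` to the quotient of `ℋ` by the `l`-th power of the ideal. -/
def proj (l : ℕ) : HeckeHat q i →ₐ[k] Hecke q m ⧸ Hecke.idealM q i ^ l :=
  IdealCompletion.proj (fun l : ℕ => Hecke.idealM q i ^ l) (Hecke.idealM_pow_antitone q i) l

/-- `T_r` in `ℋ̂_i`. -/
def T (r : Fin m) : HeckeHat q i := of q i (Hecke.T q r)

/-- `X_j` in `ℋ̂_i`. -/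
def X (j : Fin (m + 1)) : HeckeHat q i := of q i (Hecke.X q j : Hecke q m)

/-- `X_j⁻¹` in `ℋ̂_i`. -/
def Xinv (j : Fin (m + 1)) : HeckeHat q i :=
  of q i (((Hecke.X q j)⁻¹ : (Hecke q m)ˣ) : Hecke q m)

/-- The commutative subalgebra `𝒫̂_i`: the closure of the Laurent polynomials in the `X_j`. -/
def Phat : Set (HeckeHat q i) :=
  closure (Algebra.adjoin k (Set.range (X q i) ∪ Set.range (Xinv q i)) : Set (HeckeHat q i))

/-- The `h ∈ ℋ̂_i` on which right multiplication by each `X_j` has generalized eigenvalue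
`q^{u_j}`, in the topological sense. -/
def weightSpace (u : SymOrbit i) : Set (HeckeHat q i) :=
  {h | ∀ l : ℕ, ∃ N : ℕ, ∀ j : Fin (m + 1),
    proj q i l (h * (X q i j - algebraMap k _ (qpow q (u.1 j))) ^ N) = 0}

/-- `e` is the family of idempotents `e_u`: complete, pairwise orthogonal, with
`ℋ̂_i e_u` equal to the generalized eigenspace attached to `u`. -/
structure IsWeightIdempotents (e : SymOrbit i → HeckeHat q i) : Prop where
  mul : ∀ u v, e u * e v = if u = v then e u else 0
  sum : ∑ u, e u = 1
  range : ∀ u, Set.range (fun h : HeckeHat q i => h * e u) = weightSpace q i u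

variable {i}

/-- `(1 - X_r X_{r+1}⁻¹) e_u + (1 - e_u)`. This is a unit of `ℋ̂_i` precisely when
`(1 - X_r X_{r+1}⁻¹) e_u` is invertible in the algebra `e_u ℋ̂_i e_u`. -/
def cornerDenom (e : SymOrbit i → HeckeHat q i) (r : Fin m) (u : SymOrbit i) : HeckeHat q i :=
  (1 - X q i r.castSucc * Xinv q i r.succ) * e u + (1 - e u)

/-- The intertwining element
`Φ_r = T_r + ∑_{u_{r+1} ≠ u_r} (1 - q) / (1 - X_r X_{r+1}⁻¹) e_u + ∑_{u_{r+1} = u_r} e_u`. -/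
def Phi (e : SymOrbit i → HeckeHat q i) (r : Fin m) : HeckeHat q i :=
  T q i r + ∑ u : SymOrbit i,
    if u.1 r.succ = u.1 r.castSucc then e u
    else (1 - q) • (Ring.inverse (cornerDenom q e r u) * e u)

end HeckeHat

/-! ### The quiver Hecke (KLR) algebra of the cyclic quiver with `e` vertices -/

/-- Generators `e(u)`, `ψ_r`, `x_j`. -/
inductive KLRGen {m e : ℕ} (i : Fin (m + 1) → ZMod e) : Type
  | E (u : SymOrbit i)
  | psi (r : Fin m)
  | x (j : Fin (m + 1))

namespace KLR

/-- `e(u)` in the free algebra. -/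
abbrev fE (k : Type*) [Field k] {m e : ℕ} {i : Fin (m + 1) → ZMod e} (u : SymOrbit i) :
    FreeAlgebra k (KLRGen i) := FreeAlgebra.ι k (KLRGen.E u)

/-- `ψ_r` in the free algebra. -/
abbrev fpsi (k : Type*) [Field k] {m e : ℕ} (i : Fin (m + 1) → ZMod e) (r : Fin m) :
    FreeAlgebra k (KLRGen i) := FreeAlgebra.ι k (KLRGen.psi r)

/-- `x_j` in the free algebra. -/
abbrev fx (k : Type*) [Field k] {m e : ℕ} (i : Fin (m + 1) → ZMod e) (j : Fin (m + 1)) :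
    FreeAlgebra k (KLRGen i) := FreeAlgebra.ι k (KLRGen.x j)

/-- The defining relations of the quiver Hecke algebra. The positions `r`, `r + 1` are
`r.castSucc`, `r.succ`; in the braid relations `s = r + 1` and position `r + 2` is `s.succ`. -/
inductive Rel (k : Type*) [Field k] {m e : ℕ} (i : Fin (m + 1) → ZMod e) :
    FreeAlgebra k (KLRGen i) → FreeAlgebra k (KLRGen i) → Prop
  | E_mul (u v : SymOrbit i) : Rel k i (fE k u * fE k v) (if u = v then fE k u else 0)
  | E_sum : Rel k i (∑ u : SymOrbit i, fE k u) 1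
  | x_E (j : Fin (m + 1)) (u : SymOrbit i) : Rel k i (fx k i j * fE k u) (fE k u * fx k i j)
  | psi_E (r : Fin m) (u : SymOrbit i) :
      Rel k i (fpsi k i r * fE k u) (fE k (u.s r) * fpsi k i r)
  | x_comm (j l : Fin (m + 1)) : Rel k i (fx k i j * fx k i l) (fx k i l * fx k i j)
  | psi_comm (r s : Fin m) (h : r.val + 1 < s.val) :
      Rel k i (fpsi k i r * fpsi k i s) (fpsi k i s * fpsi k i r)
  | psi_x_comm (r : Fin m) (j : Fin (m + 1)) (h : j ≠ r.castSucc) (h' : j ≠ r.succ) :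
      Rel k i (fpsi k i r * fx k i j) (fx k i j * fpsi k i r)
  | psi_x (r : Fin m) (u : SymOrbit i) :
      Rel k i (fpsi k i r * fx k i r.succ * fE k u)
        ((fx k i r.castSucc * fpsi k i r + if u.1 r.castSucc = u.1 r.succ then 1 else 0) * fE k u)
  | x_psi (r : Fin m) (u : SymOrbit i) :
      Rel k i (fx k i r.succ * fpsi k i r * fE k u)
        ((fpsi k i r * fx k i r.castSucc + if u.1 r.castSucc = u.1 r.succ then 1 else 0) * fE k u)
  | psi_sq_eq (r : Fin m) (u : SymOrbit i) (h : u.1 r.castSucc = u.1 r.succ) :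
      Rel k i (fpsi k i r ^ 2 * fE k u) 0
  | psi_sq_far (r : Fin m) (u : SymOrbit i) (h : u.1 r.succ ≠ u.1 r.castSucc)
      (h₁ : u.1 r.succ ≠ u.1 r.castSucc + 1) (h₂ : u.1 r.succ ≠ u.1 r.castSucc - 1) :
      Rel k i (fpsi k i r ^ 2 * fE k u) (fE k u)
  | psi_sq_up (r : Fin m) (u : SymOrbit i) (he : e ≠ 2) (h : u.1 r.succ = u.1 r.castSucc + 1) :
      Rel k i (fpsi k i r ^ 2 * fE k u) ((fx k i r.succ - fx k i r.castSucc) * fE k u)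
  | psi_sq_down (r : Fin m) (u : SymOrbit i) (he : e ≠ 2) (h : u.1 r.succ = u.1 r.castSucc - 1) :
      Rel k i (fpsi k i r ^ 2 * fE k u) ((fx k i r.castSucc - fx k i r.succ) * fE k u)
  | psi_sq_two (r : Fin m) (u : SymOrbit i) (he : e = 2) (h : u.1 r.succ ≠ u.1 r.castSucc) :
      Rel k i (fpsi k i r ^ 2 * fE k u)
        ((fx k i r.succ - fx k i r.castSucc) * (fx k i r.castSucc - fx k i r.succ) * fE k u)
  | braid_up (r s : Fin m) (hs : s.val = r.val + 1) (u : SymOrbit i) (he : e ≠ 2)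
      (h : u.1 s.succ = u.1 r.castSucc) (h' : u.1 r.castSucc = u.1 r.succ - 1) :
      Rel k i (fpsi k i r * fpsi k i s * fpsi k i r * fE k u)
        ((fpsi k i s * fpsi k i r * fpsi k i s + 1) * fE k u)
  | braid_down (r s : Fin m) (hs : s.val = r.val + 1) (u : SymOrbit i) (he : e ≠ 2)
      (h : u.1 s.succ = u.1 r.castSucc) (h' : u.1 r.castSucc = u.1 r.succ + 1) :
      Rel k i (fpsi k i r * fpsi k i s * fpsi k i r * fE k u)
        ((fpsi k i s * fpsi k i r * fpsi k i s - 1) * fE k u)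
  | braid_two (r s : Fin m) (hs : s.val = r.val + 1) (u : SymOrbit i) (he : e = 2)
      (h : u.1 s.succ = u.1 r.castSucc) (h' : u.1 r.castSucc ≠ u.1 r.succ) :
      Rel k i (fpsi k i r * fpsi k i s * fpsi k i r * fE k u)
        ((fpsi k i s * fpsi k i r * fpsi k i s
          + fx k i r.castSucc + fx k i s.succ - 2 * fx k i r.succ) * fE k u)
  | braid (r s : Fin m) (hs : s.val = r.val + 1) (u : SymOrbit i)
      (h : ¬ (u.1 s.succ = u.1 r.castSucc ∧
        (u.1 r.castSucc = u.1 r.succ - 1 ∨ u.1 r.castSucc = u.1 r.succ + 1))) :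
      Rel k i (fpsi k i r * fpsi k i s * fpsi k i r * fE k u)
        (fpsi k i s * fpsi k i r * fpsi k i s * fE k u)

end KLR

/-- The quiver Hecke algebra `R_i` over `k` for the cyclic quiver with vertex set `ℤ/eℤ`. -/
abbrev KLR (k : Type*) [Field k] {m e : ℕ} (i : Fin (m + 1) → ZMod e) : Type _ :=
  RingQuot (KLR.Rel k i)

namespace KLR

variable (k : Type*) [Field k] {m e : ℕ} (i : Fin (m + 1) → ZMod e)

/-- The generator `e(u)` of `R_i`. -/
def E (u : SymOrbit i) : KLR k i := RingQuot.mkAlgHom k (Rel k i) (fE k u)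

/-- The generator `ψ_r` of `R_i`. -/
def psi (r : Fin m) : KLR k i := RingQuot.mkAlgHom k (Rel k i) (fpsi k i r)

/-- The generator `x_j` of `R_i`. -/
def x (j : Fin (m + 1)) : KLR k i := RingQuot.mkAlgHom k (Rel k i) (fx k i j)

/-- The element of `R_i` given by a polynomial in the (commuting) generators `x_j`. -/
def poly (p : MvPolynomial (Fin (m + 1)) k) : KLR k i :=
  ∑ a ∈ p.support, p.coeff a • (List.ofFn fun j => x k i j ^ a j).prod

/-- The two-sided ideal `R_i I^l R_i`, where `I = (x_1, …, x_n) ⊆ k[x_1, …, x_n]`. -/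
def idealJ (l : ℕ) : Ideal (KLR k i) :=
  (TwoSidedIdeal.span
    {z | ∃ p ∈ (Ideal.span (Set.range (MvPolynomial.X : Fin (m + 1) → MvPolynomial _ k))) ^ l,
      z = poly k i p}).asIdeal

instance (l : ℕ) : (idealJ k i l).IsTwoSided :=
  inferInstanceAs (TwoSidedIdeal.asIdeal _).IsTwoSided

theorem idealJ_antitone : Antitone (idealJ k i) := fun _ _ h =>
  TwoSidedIdeal.asIdeal.monotone
    (TwoSidedIdeal.span_mono fun _ ⟨p, hp, hz⟩ => ⟨p, Ideal.pow_le_pow_right h hp, hz⟩)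

end KLR

/-- The completion `R̂_i` of `R_i` at the sequence of ideals `R_i I^l R_i`. -/
abbrev KLRHat (k : Type*) [Field k] {m e : ℕ} (i : Fin (m + 1) → ZMod e) : Type _ :=
  IdealCompletion k (KLR.idealJ k i) (KLR.idealJ_antitone k i)

namespace KLRHat

variable (k : Type*) [Field k] {m e : ℕ} (i : Fin (m + 1) → ZMod e)

/-- The canonical map `R_i → R̂_i`. -/
def of : KLR k i →ₐ[k] KLRHat k i := IdealCompletion.of _ _

/-- `e(u)` in `R̂_i`. -/
def E (u : SymOrbit i) : KLRHat k i := of k i (KLR.E k i u)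

/-- `ψ_r` in `R̂_i`. -/
def psi (r : Fin m) : KLRHat k i := of k i (KLR.psi k i r)

/-- `x_j` in `R̂_i`. -/
def x (j : Fin (m + 1)) : KLRHat k i := of k i (KLR.x k i j)

/-- The commutative subalgebra `P̂_i`: the closure of the subalgebra generated by the `e(u)` and
the `x_j`. -/
def Phat : Set (KLRHat k i) :=
  closure (Algebra.adjoin k (Set.range (E k i) ∪ Set.range (x k i)) : Set (KLRHat k i))

variable {k} (q : k) {i : Fin (m + 1) → ZMod (orderOf q)}

/-- The denominator of the fraction `A_r^u`, as a power series in the `x_j`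
(it is `1` if `u_{r+1} = u_r`). -/
def Adenom (r : Fin m) (u : SymOrbit i) : KLRHat k i :=
  if u.1 r.succ = u.1 r.castSucc then 1
  else if u.1 r.succ = u.1 r.castSucc + 1 then
    1 - algebraMap k _ q - x k i r.succ + q • x k i r.castSucc
  else qpow q (u.1 r.castSucc) • (1 - x k i r.succ) - qpow q (u.1 r.succ) • (1 - x k i r.castSucc)

/-- The numerator of the fraction `A_r^u`. -/
def Anum (r : Fin m) (u : SymOrbit i) : KLRHat k i :=
  if u.1 r.succ = u.1 r.castSucc then
    1 - algebraMap k _ q - x k i r.castSucc + q • x k i r.succ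
  else if u.1 r.succ = u.1 r.castSucc + 1 then - algebraMap k _ q
  else qpow q (u.1 r.succ) • (1 - x k i r.castSucc)
    - qpow q (u.1 r.castSucc + 1) • (1 - x k i r.succ)

/-- The power series `A_r^u`. -/
def A (r : Fin m) (u : SymOrbit i) : KLRHat k i := Anum q r u * Ring.inverse (Adenom q r u)

end KLRHat

end

/-! The two completions contain the same coefficients, and their remaining generators are two forms
of one Demazure type operator. Let `OrbitCoef` be the ring of functions on the orbit with values in
the local ring of affine space at the origin. It contains the `x_j`, the indicator functions of the
`u`, and an element `X_j` whose value at `u` is `q^{u_j} (1 - x_j)`. In the skew group ring of the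
symmetric group over orbit functions with rational function values, `ψ` and `T` become operators `κ
s + β`, and `T + shift = ampl · ψ`. The factor `ampl` is regular and nonzero at the origin because
`q` is neither `0` nor `1` (`OrbitFun.heckeLead_eq`, `OrbitFun.heckeTail_eq`, `OrbitFun.reg_ampl`).

Relations are transported without a basis theorem for either algebra and without a faithful
representation. Suppose elements of an algebra `B` satisfy the commutation, quadratic and braid
relations of such operators, and pair each of them with its operator. In the subring of `B × skew
ring` generated by the pairs and the coefficients, every element is a combination of reduced words
in one or two reflections. Leading coefficients are non-zero-divisors, so the second projection is
injective there (`injOn_closure_one`, `injOn_closure_two`). Hence an identity of rank at most two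
which holds for rational operators holds in `B`. Used in both directions, this derives the Hecke
relations from a `PsiSystem` and a `PsiSystem` from a `HeckeSystem`.

It remains to let the coefficients act on both completions. On the quiver side the `x_j` are
topologically nilpotent, so power series denominators are invertible. On the Hecke side a polynomial
vanishing on the orbit has a power in the ideal (`Hecke.polyHom_pow_mem`); interpolation polynomials
can therefore be corrected to idempotents `e_u` in the limit. How `T_r` commutes with `e_u` is not a
defining relation: it follows from `HeckeHat.eq_zero_of_intertwine`, by which an element of a corner
that intertwines coefficients of different values is zero.

The resulting homomorphisms from each algebra to the completion of the other are continuous.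
Symmetric Laurent polynomials vanishing at `i` become invariant elements of the ideal `(x_1, …,
x_n)` of coefficients, and these commute with the image of the Hecke algebra; conversely the `x_j`
are nilpotent in every quotient. The extensions to the completions match the two copies of the
coefficients and are given by `T = ampl · ψ - shift` and `ψ = ampl⁻¹ (T + shift)`, so they are
mutually inverse. -/

noncomputable section

/-! ### Completions: units, closures and extension of homomorphisms by continuity -/

namespace IdealCompletion

variable {k : Type*} [CommRing k] {A : Type*} [Ring A] [Algebra k A]
  {J : ℕ → Ideal A} [∀ l, (J l).IsTwoSided] {hJ : Antitone J}

theorem ext_proj {z w : IdealCompletion k J hJ}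
    (h : ∀ l, proj (k := k) J hJ l z = proj J hJ l w) : z = w :=
  Subtype.ext (funext h)

theorem proj_of (l : ℕ) (a : A) :
    proj J hJ l (of (k := k) J hJ a) = Ideal.Quotient.mk (J l) a := rfl

theorem factor_proj {l l' : ℕ} (h : l ≤ l') (z : IdealCompletion k J hJ) :
    Ideal.Quotient.factor (hJ h) (proj J hJ l' z) = proj J hJ l z :=
  z.2 l l' h

theorem proj_eq_of_le {l l' : ℕ} (h : l ≤ l') {z w : IdealCompletion k J hJ}
    (hz : proj (k := k) J hJ l' z = proj J hJ l' w) : proj J hJ l z = proj J hJ l w := by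
  rw [← factor_proj h z, ← factor_proj h w, hz]

theorem exists_of_proj_eq (z : IdealCompletion k J hJ) (l : ℕ) :
    ∃ a : A, proj J hJ l (of (k := k) J hJ a) = proj J hJ l z :=
  Ideal.Quotient.mk_surjective (proj J hJ l z)

/-- A coherent sequence of elements of `A` defines an element of the completion. -/
theorem exists_proj_eq_mk (a : ℕ → A) (ha : ∀ l l', l ≤ l' → a l' - a l ∈ J l) :
    ∃ z : IdealCompletion k J hJ, ∀ l, proj J hJ l z = Ideal.Quotient.mk (J l) (a l) := by
  refine ⟨⟨fun l => Ideal.Quotient.mk (J l) (a l), fun l l' h => ?_⟩, fun l => rfl⟩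
  rw [Ideal.Quotient.factor_mk]
  exact Ideal.Quotient.eq.2 (ha l l' h)

/-- Ring homomorphisms preserve inverses, so the levelwise inverses form a compatible family. -/
theorem isUnit_of_proj (z : IdealCompletion k J hJ)
    (h : ∀ l, IsUnit (proj (k := k) J hJ l z)) : IsUnit z := by
  choose u hu using h
  let w : IdealCompletion k J hJ := ⟨fun l => ((u l)⁻¹ : (A ⧸ J l)ˣ), fun l l' hl => by
    have h1 : Units.map (Ideal.Quotient.factor (hJ hl) : A ⧸ J l' →* A ⧸ J l) (u l') = u l := by
      ext
      rw [Units.coe_map, hu l]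
      change Ideal.Quotient.factor (hJ hl) (u l' : A ⧸ J l') = _
      rw [hu l', factor_proj]
    change Ideal.Quotient.factor (hJ hl) ((u l')⁻¹ : (A ⧸ J l')ˣ) = ((u l)⁻¹ : (A ⧸ J l)ˣ)
    rw [← h1, ← map_inv]
    rfl⟩
  have hw : ∀ l, proj J hJ l w = ((u l)⁻¹ : (A ⧸ J l)ˣ) := fun l => rfl
  refine ⟨⟨z, w, ?_, ?_⟩, rfl⟩ <;> refine ext_proj fun l => ?_
  · rw [map_mul, map_one, hw, ← hu, Units.mul_inv]
  · rw [map_mul, map_one, hw, ← hu, Units.inv_mul]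

theorem continuous_proj (l : ℕ) : @Continuous _ _ _ ⊥ (proj (k := k) J hJ l) :=
  continuous_iff_le_induced.2 (iInf_le _ l)

/-- Agreement at one level implies agreement at all lower ones, so a choice of approximants, one for
each level, is a sequence converging to `z`. -/
theorem mem_closure_iff_proj (S : Set (IdealCompletion k J hJ)) (z : IdealCompletion k J hJ) :
    z ∈ closure S ↔ ∀ l, ∃ s ∈ S, proj (k := k) J hJ l s = proj J hJ l z := by
  constructor
  · intro h l
    let _ : TopologicalSpace (A ⧸ J l) := ⊥
    have _ : DiscreteTopology (A ⧸ J l) := ⟨rfl⟩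
    have ho : IsOpen (proj (k := k) J hJ l ⁻¹' {proj J hJ l z}) :=
      (isOpen_discrete _).preimage (continuous_proj l)
    obtain ⟨s, h1, h2⟩ := mem_closure_iff.1 h _ ho rfl
    exact ⟨s, h2, h1⟩
  · intro h
    choose s hs hsz using h
    refine mem_closure_of_tendsto (f := s) (b := Filter.atTop) ?_ (.of_forall hs)
    rw [nhds_iInf, Filter.tendsto_iInf]
    intro l
    let _ : TopologicalSpace (A ⧸ J l) := ⊥
    have _ : DiscreteTopology (A ⧸ J l) := ⟨rfl⟩
    rw [nhds_induced, Filter.tendsto_comap_iff]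
    rw [nhds_discrete, Filter.tendsto_pure]
    filter_upwards [Filter.eventually_ge_atTop l] with l' hl'
    exact proj_eq_of_le hl' (hsz l')

section Lift

variable {B : Type*} [Ring B] [Algebra k B]
  {J' : ℕ → Ideal B} [∀ l, (J' l).IsTwoSided] {hJ' : Antitone J'}

/-- Each component of `f` factors through a discrete quotient. The hypothesis is a uniform form of
continuity, which is easy to compose and is also what `exists_lift` produces. -/
theorem continuous_of_proj (f : IdealCompletion k J hJ → IdealCompletion k J' hJ')
    (h : ∀ l, ∃ N, ∀ x y, proj (k := k) J hJ N x = proj J hJ N y →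
      proj J' hJ' l (f x) = proj J' hJ' l (f y)) : Continuous f := by
  refine continuous_iInf_rng.2 fun l => continuous_induced_rng.2 ?_
  obtain ⟨N, hN⟩ := h l
  let _ : TopologicalSpace (A ⧸ J N) := ⊥
  have _ : DiscreteTopology (A ⧸ J N) := ⟨rfl⟩
  let _ : TopologicalSpace (B ⧸ J' l) := ⊥
  have hfac : ⇑(proj (k := k) J' hJ' l) ∘ f =
      (fun y : A ⧸ J N => proj J' hJ' l (f (of J hJ (Quotient.out y)))) ∘ proj J hJ N := by
    funext x
    refine hN _ _ ?_
    rw [proj_of]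
    exact (Ideal.Quotient.mk_out _).symm
  rw [hfac]
  exact (continuous_of_discreteTopology).comp (continuous_proj N)

/-- An algebra homomorphism to a completion which is continuous on the source extends to the
completion of the source. -/
theorem exists_lift (f : A →ₐ[k] IdealCompletion k J' hJ')
    (h : ∀ l, ∃ N, ∀ a ∈ J N, proj J' hJ' l (f a) = 0) :
    ∃ F : IdealCompletion k J hJ →ₐ[k] IdealCompletion k J' hJ',
      (∀ a, F (of J hJ a) = f a) ∧
      ∀ l, ∃ N, ∀ x y, proj (k := k) J hJ N x = proj J hJ N y →
        proj J' hJ' l (F x) = proj J' hJ' l (F y) := by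
  choose N hN using h
  let g : ∀ l, A ⧸ J (N l) →ₐ[k] B ⧸ J' l := fun l =>
    Ideal.Quotient.liftₐ (J (N l)) ((proj J' hJ' l).comp f) (hN l)
  have hg : ∀ l a, g l (Ideal.Quotient.mk _ a) = proj J' hJ' l (f a) := fun l a => rfl
  let F : IdealCompletion k J hJ →ₐ[k] IdealCompletion k J' hJ' :=
    AlgHom.codRestrict (AlgHom.pi fun l => (g l).comp (proj J hJ (N l)))
      (completionSubalgebra k J' hJ') (fun z l l' hl => by
        -- The levels `N l` need not be monotone in `l`, so a representative is taken at a level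
        -- above both.
        obtain ⟨a, ha⟩ := exists_of_proj_eq z (max (N l) (N l'))
        have h1 := proj_eq_of_le (le_max_left (N l) (N l')) ha
        have h2 := proj_eq_of_le (le_max_right (N l) (N l')) ha
        change Ideal.Quotient.factor (hJ' hl) (g l' (proj J hJ (N l') z)) =
          g l (proj J hJ (N l) z)
        rw [← h1, ← h2, proj_of, proj_of, hg, hg, factor_proj])
  have hF : ∀ l z, proj J' hJ' l (F z) = g l (proj J hJ (N l) z) := fun l z => rfl
  refine ⟨F, fun a => ext_proj fun l => ?_, fun l => ⟨N l, fun x y hxy => ?_⟩⟩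
  · rw [hF, proj_of, hg]
  · rw [hF, hF, hxy]

/-- A homomorphism of completions with a uniform continuity property which fixes the image of `A`
is the identity. -/
theorem eq_id_of_of (F : IdealCompletion k J hJ →ₐ[k] IdealCompletion k J hJ)
    (h : ∀ a, F (of J hJ a) = of J hJ a)
    (hF : ∀ l, ∃ N, ∀ x y, proj (k := k) J hJ N x = proj J hJ N y →
        proj J hJ l (F x) = proj J hJ l (F y)) (z : IdealCompletion k J hJ) : F z = z := by
  refine ext_proj fun l => ?_
  obtain ⟨N, hN⟩ := hF l
  obtain ⟨a, ha⟩ := exists_of_proj_eq z (max N l)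
  rw [← hN _ _ (proj_eq_of_le (le_max_left _ _) ha), h, proj_eq_of_le (le_max_right _ _) ha]

end Lift

end IdealCompletion
end

noncomputable section

/-! ### Transfer of identities from a skew group ring -/

section Transfer

open SkewMonoidAlgebra

variable {P Q C G : Type*} [CommRing P] [CommRing Q] [Ring C] [Group G] [MulSemiringAction G Q]
  {ι : P →+* C} {ρ : C →+* SkewMonoidAlgebra Q G} {j : P →+* Q}

theorem smul_mem_nonZeroDivisors' (g : G) {a : Q} (ha : a ∈ nonZeroDivisors Q) :
    g • a ∈ nonZeroDivisors Q := by
  rw [mem_nonZeroDivisors_iff_right] at ha ⊢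
  intro y hy
  have h1 := ha (g⁻¹ • y) (by rw [← smul_inv_smul g⁻¹ a, inv_inv, ← smul_mul', hy, smul_zero])
  rwa [smul_eq_zero_iff_eq] at h1

/-- The ring generated by coefficients and one Demazure type operator embeds in the skew group
ring. -/
theorem injOn_closure_one {θ : C} {s : G} {α β : Q} (hs : s ≠ 1)
    (hj : Function.Injective j) (hι : ∀ f, ρ (ι f) = single 1 (j f))
    (hα : α ∈ nonZeroDivisors Q) (hθ : ρ θ = single s α + single 1 β)
    (h1 : ∀ f, ∃ f₁ f₂, θ * ι f = ι f₁ * θ + ι f₂) (h2 : ∃ a b, θ * θ = ι a * θ + ι b) :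
    Set.InjOn ρ (Subring.closure (Set.range ι ∪ {θ}) : Subring C) := by
  classical
  obtain ⟨a, b, h2⟩ := h2
  -- The commutation rule `h1` and the quadratic relation `h2` make the left span of `θ` and `1` a
  -- ring, which therefore contains the closure.
  let M : Subring C :=
    { carrier := {y | ∃ f g, y = ι f * θ + ι g}
      mul_mem' := by
        rintro _ _ ⟨f, g, rfl⟩ ⟨f', g', rfl⟩
        obtain ⟨u, v, huv⟩ := h1 f'
        obtain ⟨u', v', huv'⟩ := h1 g'
        refine ⟨f * u * a + f * v + f * u' + g * f', f * u * b + f * v' + g * g', ?_⟩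
        have : (ι f * θ + ι g) * (ι f' * θ + ι g') = ι f * ((θ * ι f') * θ) + ι f * (θ * ι g')
            + ι g * ι f' * θ + ι g * ι g' := by noncomm_ring
        rw [this, huv, huv', add_mul, mul_assoc (ι u), h2]
        simp only [map_add, map_mul]
        noncomm_ring
      one_mem' := ⟨0, 1, by simp⟩
      zero_mem' := ⟨0, 0, by simp⟩
      add_mem' := by
        rintro _ _ ⟨f, g, rfl⟩ ⟨f', g', rfl⟩
        exact ⟨f + f', g + g', by simp only [map_add]; noncomm_ring⟩
      neg_mem' := by
        rintro _ ⟨f, g, rfl⟩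
        exact ⟨-f, -g, by simp only [map_neg]; noncomm_ring⟩ }
  have hM : Subring.closure (Set.range ι ∪ {θ}) ≤ M := by
    rw [Subring.closure_le]
    rintro y (⟨f, rfl⟩ | rfl)
    · exact ⟨0, f, by simp⟩
    · exact ⟨1, 0, by simp⟩
  intro y hy z hz hyz
  obtain ⟨f, g, hfg⟩ := hM (sub_mem hy hz)
  have h0 : ρ (ι f * θ + ι g) = 0 := by rw [← hfg, map_sub, hyz, sub_self]
  rw [map_add, map_mul, hι, hι, hθ, mul_add, single_mul_single, single_mul_single, one_smul,
    one_smul, one_mul, one_mul] at h0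
  -- The coefficient at `s` is `f α`, which forces `f = 0`; then the coefficient at `1` is `g`.
  have c1 := congrArg (fun z => z.coeff s) h0
  have c2 := congrArg (fun z => z.coeff 1) h0
  simp only [coeff_add, coeff_single, Finsupp.add_apply, Finsupp.single_apply, coeff_zero,
    Finsupp.coe_zero, Pi.zero_apply, if_true, if_neg hs, if_neg hs.symm, add_zero, zero_add]
    at c1 c2
  have hf : f = 0 := hj (by rw [map_zero]; exact (mul_right_mem_nonZeroDivisors_eq_zero_iff hα).1 c1)
  rw [hf, map_zero, zero_mul, zero_add] at c2
  have hg : g = 0 := hj (by rw [map_zero]; exact c2)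
  rw [← sub_eq_zero, hfg, hf, hg, map_zero, zero_mul, zero_add]

set_option linter.unusedSimpArgs false in
/-- The ring generated by coefficients and two braided Demazure type operators embeds in the skew
group ring. -/
theorem injOn_closure_two {θ₁ θ₂ : C} {s t : G} {α₁ β₁ α₂ β₂ : Q}
    (hs : s ≠ 1) (ht : t ≠ 1) (hst : s ≠ t) (hss : s * s = 1) (htt : t * t = 1)
    (hcomm : s * t ≠ t * s)
    (hj : Function.Injective j) (hι : ∀ f, ρ (ι f) = single 1 (j f))
    (hα₁ : α₁ ∈ nonZeroDivisors Q) (hα₂ : α₂ ∈ nonZeroDivisors Q)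
    (hθ₁ : ρ θ₁ = single s α₁ + single 1 β₁) (hθ₂ : ρ θ₂ = single t α₂ + single 1 β₂)
    (h1 : ∀ f, ∃ f₁ f₂, θ₁ * ι f = ι f₁ * θ₁ + ι f₂)
    (h1' : ∀ f, ∃ f₁ f₂, θ₂ * ι f = ι f₁ * θ₂ + ι f₂)
    (h2 : ∃ a b, θ₁ * θ₁ = ι a * θ₁ + ι b) (h2' : ∃ a b, θ₂ * θ₂ = ι a * θ₂ + ι b)
    (h3 : ∃ c, θ₁ * θ₂ * θ₁ = θ₂ * θ₁ * θ₂ + ι c) :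
    Set.InjOn ρ (Subring.closure (Set.range ι ∪ {θ₁, θ₂}) : Subring C) := by
  classical
  -- Combinations of one reduced word for each of six group elements; the word `θ₂ θ₁ θ₂` is
  -- eliminated by the braid relation.
  let F : P × P × P × P × P × P → C := fun f => ι f.1 * (θ₁ * θ₂ * θ₁) + ι f.2.1 * (θ₁ * θ₂) +
    ι f.2.2.1 * (θ₂ * θ₁) + ι f.2.2.2.1 * θ₁ + ι f.2.2.2.2.1 * θ₂ + ι f.2.2.2.2.2
  let M : AddSubgroup C :=
    { carrier := Set.range F
      zero_mem' := ⟨0, by simp [F]⟩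
      add_mem' := by
        rintro _ _ ⟨f, rfl⟩ ⟨g, rfl⟩
        exact ⟨f + g, by simp only [F, Prod.fst_add, Prod.snd_add, map_add]; noncomm_ring⟩
      neg_mem' := by
        rintro _ ⟨f, rfl⟩
        exact ⟨-f, by simp only [F, Prod.fst_neg, Prod.snd_neg, map_neg]; noncomm_ring⟩ }
  have m121 : θ₁ * θ₂ * θ₁ ∈ M := ⟨(1, 0, 0, 0, 0, 0), by simp [F]⟩
  have m12 : θ₁ * θ₂ ∈ M := ⟨(0, 1, 0, 0, 0, 0), by simp [F]⟩
  have m21 : θ₂ * θ₁ ∈ M := ⟨(0, 0, 1, 0, 0, 0), by simp [F]⟩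
  have m1 : θ₁ ∈ M := ⟨(0, 0, 0, 1, 0, 0), by simp [F]⟩
  have m2 : θ₂ ∈ M := ⟨(0, 0, 0, 0, 1, 0), by simp [F]⟩
  have m0 : ∀ f, ι f ∈ M := fun f => ⟨(0, 0, 0, 0, 0, f), by simp [F]⟩
  have mι : ∀ f y, y ∈ M → ι f * y ∈ M := by
    rintro f _ ⟨g, rfl⟩
    refine ⟨(f * g.1, f * g.2.1, f * g.2.2.1, f * g.2.2.2.1, f * g.2.2.2.2.1, f * g.2.2.2.2.2), ?_⟩
    simp only [F, map_mul]
    noncomm_ring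
  -- The commutation rule moves `θ` past coefficients, so stability under left multiplication only
  -- has to be tested on the words.
  have key : ∀ θ, (∀ f, ∃ f₁ f₂, θ * ι f = ι f₁ * θ + ι f₂) → θ ∈ M → θ * (θ₁ * θ₂ * θ₁) ∈ M →
      θ * (θ₁ * θ₂) ∈ M → θ * (θ₂ * θ₁) ∈ M → θ * θ₁ ∈ M → θ * θ₂ ∈ M → ∀ y ∈ M, θ * y ∈ M := by
    intro θ h a0 a1 a2 a3 a4 a5
    have aux : ∀ f z, z ∈ M → θ * z ∈ M → θ * (ι f * z) ∈ M := by
      intro f z hz hθz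
      obtain ⟨u, v, huv⟩ := h f
      rw [← mul_assoc, huv, add_mul, mul_assoc]
      exact add_mem (mι _ _ hθz) (mι _ _ hz)
    rintro _ ⟨f, rfl⟩
    simp only [F, mul_add]
    refine add_mem (add_mem (add_mem (add_mem (add_mem (aux _ _ m121 a1) (aux _ _ m12 a2))
      (aux _ _ m21 a3)) (aux _ _ m1 a4)) (aux _ _ m2 a5)) ?_
    obtain ⟨u, v, huv⟩ := h f.2.2.2.2.2
    rw [huv]
    exact add_mem (mι _ _ a0) (m0 _)
  obtain ⟨a, b, h2⟩ := h2
  obtain ⟨a', b', h2'⟩ := h2'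
  obtain ⟨c, h3⟩ := h3
  have m11 : θ₁ * θ₁ ∈ M := by rw [h2]; exact add_mem (mι _ _ m1) (m0 _)
  have m22 : θ₂ * θ₂ ∈ M := by rw [h2']; exact add_mem (mι _ _ m2) (m0 _)
  have k1 : ∀ y ∈ M, θ₁ * y ∈ M := by
    refine key θ₁ h1 m1 ?_ ?_ (by rw [← mul_assoc]; exact m121) m11 m12
    · have : θ₁ * (θ₁ * θ₂ * θ₁) = ι a * (θ₁ * θ₂ * θ₁) + ι b * (θ₂ * θ₁) := by
        rw [← mul_assoc, ← mul_assoc, h2]; noncomm_ring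
      rw [this]
      exact add_mem (mι _ _ m121) (mι _ _ m21)
    · have : θ₁ * (θ₁ * θ₂) = ι a * (θ₁ * θ₂) + ι b * θ₂ := by
        rw [← mul_assoc, h2]; noncomm_ring
      rw [this]
      exact add_mem (mι _ _ m12) (mι _ _ m2)
  have m212 : θ₂ * (θ₁ * θ₂) ∈ M := by
    have : θ₂ * (θ₁ * θ₂) = θ₁ * θ₂ * θ₁ - ι c := by rw [h3]; noncomm_ring
    rw [this]
    exact sub_mem m121 (m0 _)
  have k2 : ∀ y ∈ M, θ₂ * y ∈ M := by
    refine key θ₂ h1' m2 ?_ m212 ?_ m21 m22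
    -- The braid relation turns `θ₂ θ₁ θ₂ θ₁` into `θ₁ θ₂ θ₁²` up to a shorter term, and the
    -- quadratic relation applies to the square.
    · have : θ₂ * (θ₁ * θ₂ * θ₁) = θ₁ * (θ₂ * (ι a * θ₁ + ι b)) - ι c * θ₁ := by
        have e : θ₂ * (θ₁ * θ₂ * θ₁) = (θ₂ * θ₁ * θ₂) * θ₁ := by noncomm_ring
        rw [e, eq_sub_of_add_eq h3.symm, sub_mul, mul_assoc (θ₁ * θ₂), h2, mul_assoc]
      rw [this]
      refine sub_mem (k1 _ ?_) (mι _ _ m1)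
      rw [mul_add]
      obtain ⟨u, v, huv⟩ := h1' a
      obtain ⟨u', v', huv'⟩ := h1' b
      rw [← mul_assoc, huv, huv', add_mul, mul_assoc]
      exact add_mem (add_mem (mι _ _ m21) (mι _ _ m1)) (add_mem (mι _ _ m2) (m0 _))
    · have : θ₂ * (θ₂ * θ₁) = ι a' * (θ₂ * θ₁) + ι b' * θ₁ := by
        rw [← mul_assoc, h2']; noncomm_ring
      rw [this]
      exact add_mem (mι _ _ m21) (mι _ _ m1)
  let S : Subring C :=
    { M with
      one_mem' := by simpa using m0 1
      mul_mem' := by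
        rintro _ y ⟨f, rfl⟩ hy
        change F f * y ∈ M
        simp only [F, add_mul, mul_assoc]
        exact add_mem (add_mem (add_mem (add_mem (add_mem
          (mι _ _ (k1 _ (k2 _ (k1 _ hy)))) (mι _ _ (k1 _ (k2 _ hy))))
          (mι _ _ (k2 _ (k1 _ hy)))) (mι _ _ (k1 _ hy))) (mι _ _ (k2 _ hy))) (mι _ _ hy) }
  have hM : Subring.closure (Set.range ι ∪ {θ₁, θ₂}) ≤ S := by
    rw [Subring.closure_le]
    rintro y (⟨f, rfl⟩ | rfl | rfl)
    · exact m0 f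
    · exact m1
    · exact m2
  intro y hy z hz hyz
  obtain ⟨⟨f₁, f₂, f₃, f₄, f₅, f₆⟩, hf⟩ : y - z ∈ M := hM (sub_mem hy hz)
  have h0 : ρ (F (f₁, f₂, f₃, f₄, f₅, f₆)) = 0 := by rw [hf, map_sub, hyz, sub_self]
  -- The elements `1, s, t, st, ts, sts` are pairwise distinct; no braid relation in the group is
  -- needed.
  have n1 : s * t ≠ 1 := fun h => hst (by rw [← mul_one s, ← htt, ← mul_assoc, h, one_mul])
  have n2 : t * s ≠ 1 := fun h => hst (by rw [← mul_one t, ← hss, ← mul_assoc, h, one_mul])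
  have n3 : s * t ≠ s := fun h => ht (mul_eq_left.1 h)
  have n4 : s * t ≠ t := fun h => hs (mul_eq_right.1 h)
  have n5 : t * s ≠ s := fun h => ht (mul_eq_right.1 h)
  have n6 : t * s ≠ t := fun h => hs (mul_eq_left.1 h)
  have n7 : s * (t * s) ≠ 1 := fun h => n5 (mul_left_cancel (h.trans hss.symm))
  have n8 : s * (t * s) ≠ s := fun h => n2 (mul_eq_left.1 h)
  have n9 : s * (t * s) ≠ t := fun h => hcomm (by
    rw [← mul_one (s * t), ← hss, ← mul_assoc, mul_assoc s t s, h])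
  have n10 : s * (t * s) ≠ s * t := fun h => hs (mul_eq_left.1 (mul_left_cancel h))
  have n11 : s * (t * s) ≠ t * s := fun h => hs (mul_eq_right.1 h)
  simp only [F, map_add, map_mul, hι, hθ₁, hθ₂, mul_add, add_mul, single_mul_single, one_smul,
    one_mul, mul_one, mul_assoc, hss] at h0
  have c1 := congrArg (fun z => z.coeff (s * (t * s))) h0
  have c2 := congrArg (fun z => z.coeff (s * t)) h0
  have c3 := congrArg (fun z => z.coeff (t * s)) h0
  have c4 := congrArg (fun z => z.coeff s) h0
  have c5 := congrArg (fun z => z.coeff t) h0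
  have c6 := congrArg (fun z => z.coeff 1) h0
  have hz := fun {f α : _} (hα : α ∈ nonZeroDivisors Q) =>
    (mul_right_mem_nonZeroDivisors_eq_zero_iff (x := f) hα).1
  simp only [coeff_add, coeff_single, Finsupp.add_apply, Finsupp.single_apply, coeff_zero,
    Finsupp.coe_zero, Pi.zero_apply, if_true, if_false, n1, n2, n3, n4, n5, n6, n7, n8, n9, n10,
    n11, n1.symm, n2.symm, n3.symm, n4.symm, n5.symm, n6.symm, n7.symm, n8.symm, n9.symm,
    n10.symm, n11.symm, hs, ht, hst, hs.symm, ht.symm, hst.symm, hcomm, hcomm.symm,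
    add_zero, zero_add] at c1
  -- Only the longest word reaches `sts`, with coefficient `f₁` times a non-zero-divisor. Once `f₁`
  -- is known to vanish, the same holds for the words of length two, and so on downwards.
  have z1 : j f₁ = 0 := by
    refine hz (mul_mem hα₁ (smul_mem_nonZeroDivisors' s (mul_mem hα₂
      (smul_mem_nonZeroDivisors' t hα₁)))) ?_
    exact c1
  simp only [z1, zero_mul, single_zero, coeff_add, coeff_single, Finsupp.add_apply,
    Finsupp.single_apply, coeff_zero,
    Finsupp.coe_zero, Pi.zero_apply, if_true, if_false, n1, n2, n3, n4, n5, n6, n7, n8, n9, n10,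
    n11, n1.symm, n2.symm, n3.symm, n4.symm, n5.symm, n6.symm, n7.symm, n8.symm, n9.symm,
    n10.symm, n11.symm, hs, ht, hst, hs.symm, ht.symm, hst.symm, hcomm, hcomm.symm,
    add_zero, zero_add] at c2 c3
  have z2 : j f₂ = 0 := hz (mul_mem hα₁ (smul_mem_nonZeroDivisors' s hα₂)) c2
  have z3 : j f₃ = 0 := hz (mul_mem hα₂ (smul_mem_nonZeroDivisors' t hα₁)) c3
  simp only [z1, z2, z3, zero_mul, single_zero, coeff_add, coeff_single, Finsupp.add_apply,
    Finsupp.single_apply, coeff_zero,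
    Finsupp.coe_zero, Pi.zero_apply, if_true, if_false, hs, ht, hst, hs.symm, ht.symm, hst.symm,
    add_zero, zero_add] at c4 c5 c6
  have z4 : j f₄ = 0 := hz hα₁ c4
  have z5 : j f₅ = 0 := hz hα₂ c5
  rw [z4, z5, zero_mul, zero_mul, zero_add, zero_add] at c6
  have hz' : ∀ {f}, j f = 0 → f = 0 := fun {f} h => hj (by rw [map_zero]; exact h)
  rw [← sub_eq_zero, ← hf]
  simp [F, hz' z1, hz' z2, hz' z3, hz' z4, hz' z5, hz' c6]

end Transfer
end

noncomputable section

/-! ### Rational functions, and functions on the orbit with rational function values -/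

/-- The field of rational functions in `n` variables. -/
abbrev RatField (k : Type*) [Field k] (n : ℕ) : Type _ := FractionRing (MvPolynomial (Fin n) k)

namespace RatField

variable {k : Type*} [Field k] {n : ℕ}

/-- The variable `x_j` as a rational function. -/
def x (j : Fin n) : RatField k n := algebraMap (MvPolynomial (Fin n) k) _ (MvPolynomial.X j)

variable (k n) in
/-- The action of permutations on rational functions. -/
def perm : Equiv.Perm (Fin n) →* (RatField k n ≃+* RatField k n) where
  toFun σ := IsFractionRing.ringEquivOfRingEquiv (MvPolynomial.renameEquiv k σ).toRingEquiv
  map_one' := by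
    refine RingEquiv.toRingHom_injective (IsLocalization.ringHom_ext
      (nonZeroDivisors (MvPolynomial (Fin n) k)) (RingHom.ext fun p => ?_))
    simp
  map_mul' σ τ := by
    refine RingEquiv.toRingHom_injective (IsLocalization.ringHom_ext
      (nonZeroDivisors (MvPolynomial (Fin n) k)) (RingHom.ext fun p => ?_))
    simp [MvPolynomial.rename_rename]

theorem perm_algebraMap (σ : Equiv.Perm (Fin n)) (p : MvPolynomial (Fin n) k) :
    perm k n σ (algebraMap _ _ p) = algebraMap _ _ (MvPolynomial.rename σ p) := by
  simp [perm]

@[simp]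
theorem perm_x (σ : Equiv.Perm (Fin n)) (j : Fin n) :
    perm k n σ (x j) = x (σ j) := by
  rw [x, perm_algebraMap, MvPolynomial.rename_X, x]

theorem algebraMap_eq (c : k) : algebraMap k (RatField k n) c =
    algebraMap (MvPolynomial (Fin n) k) _ (MvPolynomial.C c) :=
  IsScalarTower.algebraMap_apply k (MvPolynomial (Fin n) k) _ c

@[simp]
theorem perm_const (σ : Equiv.Perm (Fin n)) (c : k) :
    perm k n σ (algebraMap k _ c) = algebraMap k _ c := by
  rw [algebraMap_eq, perm_algebraMap, MvPolynomial.rename_C]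

theorem algebraMap_inj : Function.Injective
    (algebraMap (MvPolynomial (Fin n) k) (RatField k n)) :=
  IsFractionRing.injective _ _

/-- The rational function `f` is regular at the origin, with value `c`. -/
def Reg (f : RatField k n) (c : k) : Prop :=
  ∃ a b : MvPolynomial (Fin n) k, MvPolynomial.constantCoeff b ≠ 0 ∧
    f * algebraMap _ _ b = algebraMap _ _ a ∧
    MvPolynomial.constantCoeff a = c * MvPolynomial.constantCoeff b

namespace Reg

variable {f g : RatField k n} {c d : k}

theorem poly (p : MvPolynomial (Fin n) k) :
    Reg (algebraMap _ (RatField k n) p) (MvPolynomial.constantCoeff p) :=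
  ⟨p, 1, by simp, by simp, by simp⟩

theorem const (c : k) : Reg (algebraMap k (RatField k n) c) c := by
  simpa [algebraMap_eq] using poly (n := n) (MvPolynomial.C c)

theorem one : Reg (1 : RatField k n) (1 : k) := by simpa using const (n := n) (1 : k)

theorem zero : Reg (0 : RatField k n) (0 : k) := by simpa using const (n := n) (0 : k)

theorem x (j : Fin n) : Reg (RatField.x j : RatField k n) 0 := by
  simpa [RatField.x] using poly (k := k) (MvPolynomial.X j)

theorem add (hf : Reg f c) (hg : Reg g d) : Reg (f + g) (c + d) := by
  obtain ⟨a, b, h1, h2, h3⟩ := hf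
  obtain ⟨a', b', h1', h2', h3'⟩ := hg
  refine ⟨a * b' + a' * b, b * b', by simpa using ⟨h1, h1'⟩, ?_, ?_⟩
  · simp only [map_mul, map_add, ← h2, ← h2']; ring
  · simp only [map_mul, map_add, h3, h3']; ring

theorem mul (hf : Reg f c) (hg : Reg g d) : Reg (f * g) (c * d) := by
  obtain ⟨a, b, h1, h2, h3⟩ := hf
  obtain ⟨a', b', h1', h2', h3'⟩ := hg
  refine ⟨a * a', b * b', by simpa using ⟨h1, h1'⟩, ?_, ?_⟩
  · simp only [map_mul, ← h2, ← h2']; ring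
  · simp only [map_mul, h3, h3']; ring

theorem neg (hf : Reg f c) : Reg (-f) (-c) := by
  have := (const (n := n) (-1 : k)).mul hf
  simpa using this

theorem sub (hf : Reg f c) (hg : Reg g d) : Reg (f - g) (c - d) := by
  rw [sub_eq_add_neg, sub_eq_add_neg]; exact hf.add hg.neg

theorem inv (hf : Reg f c) (hc : c ≠ 0) : Reg f⁻¹ c⁻¹ := by
  obtain ⟨a, b, h1, h2, h3⟩ := hf
  have ha : MvPolynomial.constantCoeff a ≠ 0 := h3 ▸ mul_ne_zero hc h1
  have hb : b ≠ 0 := fun h => h1 (by rw [h, map_zero])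
  have hf0 : f ≠ 0 := by
    rintro rfl
    rw [zero_mul] at h2
    exact ha (by rw [algebraMap_inj (n := n) (k := k) (h2.symm.trans (map_zero _).symm), map_zero])
  refine ⟨b, a, ha, ?_, ?_⟩
  · rw [← h2, inv_mul_cancel_left₀ hf0]
  · rw [h3, inv_mul_cancel_left₀ hc]

theorem ne_zero (hf : Reg f c) (hc : c ≠ 0) : f ≠ 0 := by
  rintro rfl
  obtain ⟨a, b, h1, h2, h3⟩ := hf
  rw [zero_mul] at h2
  rw [algebraMap_inj (n := n) (k := k) (h2.symm.trans (map_zero _).symm), map_zero] at h3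
  exact mul_ne_zero hc h1 h3.symm

theorem perm (σ : Equiv.Perm (Fin n)) (hf : Reg f c) : Reg (RatField.perm k n σ f) c := by
  obtain ⟨a, b, h1, h2, h3⟩ := hf
  refine ⟨MvPolynomial.rename σ a, MvPolynomial.rename σ b, ?_, ?_, ?_⟩
  · simpa using h1
  · rw [← perm_algebraMap, ← perm_algebraMap, ← map_mul, h2]
  · simpa using h3

end Reg

variable (k n) in
/-- The polynomials with non-zero constant term. -/
def unitsAtZero : Submonoid (MvPolynomial (Fin n) k) :=
  (nonZeroDivisors k).comap (MvPolynomial.constantCoeff (R := k) (σ := Fin n))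

theorem mem_unitsAtZero {p : MvPolynomial (Fin n) k} :
    p ∈ unitsAtZero k n ↔ MvPolynomial.constantCoeff p ≠ 0 := by
  simp [unitsAtZero]

theorem unitsAtZero_le : unitsAtZero k n ≤ nonZeroDivisors (MvPolynomial (Fin n) k) := fun p hp =>
  mem_nonZeroDivisors_of_ne_zero fun h => mem_unitsAtZero.1 hp (by rw [h, map_zero])

variable (k n) in
/-- The local ring at the origin. -/
def localRing : Subalgebra (MvPolynomial (Fin n) k) (RatField k n) :=
  Localization.subalgebra.ofField (RatField k n) (unitsAtZero k n) unitsAtZero_le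

instance : IsLocalization (unitsAtZero k n) (localRing k n) :=
  Localization.subalgebra.isLocalization_ofField _ _ _

theorem Reg.mem {f : RatField k n} {c : k} (h : Reg f c) : f ∈ localRing k n := by
  obtain ⟨a, b, h1, h2, h3⟩ := h
  refine ⟨a, b, mem_unitsAtZero.2 h1, ?_⟩
  rw [← h2, mul_inv_cancel_right₀]
  intro h
  exact h1 (by rw [algebraMap_inj (n := n) (k := k) (h.trans (map_zero _).symm), map_zero])

theorem exists_reg {f : RatField k n} (h : f ∈ localRing k n) : ∃ c, Reg f c := by
  obtain ⟨a, b, hb, rfl⟩ := h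
  have hb := mem_unitsAtZero.1 hb
  exact ⟨_, (Reg.poly a).mul ((Reg.poly b).inv hb)⟩

theorem Reg.isUnit {f : localRing k n} {c : k} (h : Reg (f : RatField k n) c) (hc : c ≠ 0) :
    IsUnit f :=
  IsUnit.of_mul_eq_one ⟨_, (h.inv hc).mem⟩ (Subtype.ext (mul_inv_cancel₀ (h.ne_zero hc)))

end RatField

open RatField

/-- Functions on the orbit of `i` with values in the rational functions. -/
def OrbitFun (k : Type*) [Field k] {m e : ℕ} (i : Fin (m + 1) → ZMod e) : Type _ :=
  SymOrbit i → RatField k (m + 1)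

namespace SymOrbit

variable {m e : ℕ} {i : Fin (m + 1) → ZMod e}

/-- Permutation of the entries of an element of the orbit. -/
def permute (σ : Equiv.Perm (Fin (m + 1))) (u : SymOrbit i) : SymOrbit i :=
  ⟨u.1 ∘ σ, by
    obtain ⟨v, τ, h⟩ := u
    exact ⟨σ.trans τ, by subst h; rfl⟩⟩

end SymOrbit

namespace OrbitFun

variable {k : Type*} [Field k] {m e : ℕ} {i : Fin (m + 1) → ZMod e}

instance : CommRing (OrbitFun k i) := inferInstanceAs (CommRing (SymOrbit i → RatField k (m + 1)))

@[ext]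
theorem ext {F F' : OrbitFun k i} (h : ∀ u, F u = F' u) : F = F' := funext h

@[simp] theorem add_apply (F F' : OrbitFun k i) (u) : (F + F') u = F u + F' u := rfl
@[simp] theorem sub_apply (F F' : OrbitFun k i) (u) : (F - F') u = F u - F' u := rfl
@[simp] theorem neg_apply (F : OrbitFun k i) (u) : (-F) u = -F u := rfl
@[simp] theorem mul_apply (F F' : OrbitFun k i) (u) : (F * F') u = F u * F' u := rfl
@[simp] theorem one_apply (u) : (1 : OrbitFun k i) u = 1 := rfl
@[simp] theorem zero_apply (u) : (0 : OrbitFun k i) u = 0 := rfl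

/-- A permutation moves the variables and the point of the orbit simultaneously. Since `permute` is
a right action on the orbit, the outcome is a left action. -/
instance : MulSemiringAction (Equiv.Perm (Fin (m + 1))) (OrbitFun k i) where
  smul σ F := fun u => perm k (m + 1) σ (F (u.permute σ))
  one_smul F := by
    ext u
    change perm k (m + 1) 1 (F (u.permute 1)) = F u
    rw [map_one]
    rfl
  mul_smul σ τ F := by
    ext u
    change perm k (m + 1) (σ * τ) (F (u.permute (σ * τ))) =
      perm k (m + 1) σ (perm k (m + 1) τ (F ((u.permute σ).permute τ)))
    rw [map_mul]
    rfl
  smul_zero σ := OrbitFun.ext fun u => map_zero _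
  smul_add σ F F' := OrbitFun.ext fun u => map_add _ _ _
  smul_one σ := OrbitFun.ext fun u => map_one _
  smul_mul σ F F' := OrbitFun.ext fun u => map_mul _ _ _

theorem smul_apply (σ : Equiv.Perm (Fin (m + 1))) (F : OrbitFun k i) (u : SymOrbit i) :
    (σ • F) u = perm k (m + 1) σ (F (u.permute σ)) := rfl

theorem mem_nonZeroDivisors {F : OrbitFun k i} (h : ∀ u, F u ≠ 0) :
    F ∈ nonZeroDivisors (OrbitFun k i) := by
  rw [mem_nonZeroDivisors_iff_right]
  intro G hG
  ext u
  exact (mul_eq_zero.1 (congrFun hG u)).resolve_right (h u)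

/-- A function of two entries and the corresponding two variables. -/
def two (φ : ZMod e → ZMod e → RatField k (m + 1) → RatField k (m + 1) → RatField k (m + 1))
    (a b : Fin (m + 1)) : OrbitFun k i :=
  fun u => φ (u.1 a) (u.1 b) (x a) (x b)

theorem two_apply
    (φ : ZMod e → ZMod e → RatField k (m + 1) → RatField k (m + 1) → RatField k (m + 1))
    (a b : Fin (m + 1)) (u : SymOrbit i) : two φ a b u = φ (u.1 a) (u.1 b) (x a) (x b) := rfl

/-- Compatibility of a function with the permutation of the variables. -/
def Equivariant (φ : ZMod e → ZMod e → RatField k (m + 1) → RatField k (m + 1) →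
    RatField k (m + 1)) : Prop :=
  ∀ σ p q y z, perm k (m + 1) σ (φ p q y z) = φ p q (perm k (m + 1) σ y) (perm k (m + 1) σ z)

/-- The action becomes a relabelling of the two indices, so that computing with the operators is
bookkeeping with index pairs. -/
theorem smul_two
    {φ : ZMod e → ZMod e → RatField k (m + 1) → RatField k (m + 1) → RatField k (m + 1)}
    (hφ : Equivariant φ) (σ : Equiv.Perm (Fin (m + 1))) (a b : Fin (m + 1)) :
    σ • two (i := i) φ a b = two φ (σ a) (σ b) := by
  ext u
  rw [smul_apply, two_apply, hφ, perm_x, perm_x]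
  rfl

section Operators

open SkewMonoidAlgebra

variable {κ β : ZMod e → ZMod e → RatField k (m + 1) → RatField k (m + 1) → RatField k (m + 1)}

variable (i κ β) in
/-- The operator `κ s + β`, where `s` interchanges `a` and `b`. -/
def op (a b : Fin (m + 1)) : SkewMonoidAlgebra (OrbitFun k i) (Equiv.Perm (Fin (m + 1))) :=
  single (Equiv.swap a b) (two κ a b) + single 1 (two β a b)

theorem op_mul_self (hκ : Equivariant κ) (hβ : Equivariant β) (a b : Fin (m + 1)) :
    op i κ β a b * op i κ β a b =
      single (Equiv.swap a b) (two κ a b * (two β b a + two β a b)) +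
      single 1 (two κ a b * two κ b a + two β a b * two β a b) := by
  simp only [op, mul_add, add_mul, single_mul_single, one_mul, mul_one,
    smul_two hκ, smul_two hβ, Equiv.Perm.one_apply, Equiv.swap_apply_left, Equiv.swap_apply_right, Equiv.swap_mul_self,
    single_add]
  rw [mul_comm (two β a b) (two κ a b)]
  abel

/-- Compare coefficients of group elements. Those of length two and three agree by commutativity of
the coefficients; the hypotheses `h1` and `h2`, multiplied by a factor `κ`, are the agreement at the
two reflections. Only a difference at the identity is left. -/
theorem op_braid (hκ : Equivariant κ) (hβ : Equivariant β) {a b c : Fin (m + 1)}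
    (hab : a ≠ b) (hbc : b ≠ c) (hac : a ≠ c)
    (h1 : two (i := i) β a c * two β b a + two β a b * two β b c = two β b c * two β a c)
    (h2 : two (i := i) β a c * two β c b + two β b c * two β a b = two β a b * two β a c) :
    op i κ β a b * op i κ β b c * op i κ β a b = op i κ β b c * op i κ β a b * op i κ β b c +
      single 1 (two κ a b * two κ b a * two β a c + two β a b * two β a b * two β b c
        - two κ b c * two κ c b * two β a c - two β b c * two β b c * two β a b) := by
  have hbr : Equiv.swap a b * (Equiv.swap b c * Equiv.swap a b) =
      Equiv.swap b c * (Equiv.swap a b * Equiv.swap b c) := by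
    have e1 := Equiv.swap_mul_swap_mul_swap hbc.symm hac.symm
    have e2 := Equiv.swap_mul_swap_mul_swap hab hac
    rw [← mul_assoc, ← mul_assoc, e2, Equiv.swap_comm c a, ← e1, Equiv.swap_comm c b,
      Equiv.swap_comm b a]
  simp only [op, mul_add, add_mul, single_mul_single, one_mul, mul_one, mul_assoc,
    smul_two hκ, smul_two hβ, Equiv.Perm.one_apply, Equiv.Perm.mul_apply, Equiv.swap_apply_left, Equiv.swap_apply_right,
    Equiv.swap_apply_of_ne_of_ne hab hac, Equiv.swap_apply_of_ne_of_ne hac.symm hbc.symm,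
    Equiv.swap_mul_self, hbr]
  have e1 : single (Equiv.swap a b) (two (i := i) κ a b * (two β a c * two β b a)) +
      single (Equiv.swap a b) (two β a b * (two β b c * two κ a b)) =
      single (Equiv.swap a b) (two β b c * (two κ a b * two β a c)) := by
    rw [← single_add]; congr 1; linear_combination two κ a b * h1
  have e2 : single (Equiv.swap b c) (two (i := i) κ b c * (two β a c * two β c b)) +
      single (Equiv.swap b c) (two β b c * (two β a b * two κ b c)) =
      single (Equiv.swap b c) (two β a b * (two κ b c * two β a c)) := by
    rw [← single_add]; congr 1; linear_combination two κ b c * h2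
  have e3 : single (Equiv.swap b c * (Equiv.swap a b * Equiv.swap b c))
      (two (i := i) κ a b * (two κ a c * two κ b c)) =
      single (Equiv.swap b c * (Equiv.swap a b * Equiv.swap b c))
        (two κ b c * (two κ a c * two κ a b)) := by
    congr 1; ring
  have e4 : single (Equiv.swap a b * Equiv.swap b c)
      (two (i := i) κ a b * (two κ a c * two β b c)) =
      single (Equiv.swap a b * Equiv.swap b c) (two β b c * (two κ a b * two κ a c)) := by
    congr 1; ring
  have e5 : single (Equiv.swap b c * Equiv.swap a b)
      (two (i := i) κ b c * (two κ a c * two β a b)) =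
      single (Equiv.swap b c * Equiv.swap a b) (two β a b * (two κ b c * two κ a c)) := by
    congr 1; ring
  have e0 : single (1 : Equiv.Perm (Fin (m + 1))) (two (i := i) κ a b * (two β a c * two κ b a)) +
      single 1 (two β a b * (two β b c * two β a b)) =
      single 1 (two κ b c * (two β a c * two κ c b)) +
      single 1 (two β b c * (two β a b * two β b c)) +
      single 1 (two κ a b * (two κ b a * two β a c) + two β a b * (two β a b * two β b c) -
            two κ b c * (two κ c b * two β a c) -
          two β b c * (two β b c * two β a b)) := by
    rw [← single_add, ← single_add, ← single_add]; congr 1; ring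
  linear_combination (norm := abel) e1 - e2 + e3 + e4 - e5 + e0

end Operators

end OrbitFun
end

noncomputable section

open RatField

theorem RatField.x_sub_x_ne_zero {k : Type*} [Field k] {n : ℕ} {a b : Fin n} (h : a ≠ b) :
    (x a : RatField k n) - x b ≠ 0 := fun h' => h (by
  have := algebraMap_inj (sub_eq_zero.1 h')
  exact MvPolynomial.X_injective this)

/-! ### The operators of the quiver Hecke algebra -/

namespace OrbitFun

open SkewMonoidAlgebra

section Psi

variable {k : Type*} [Field k] {m e : ℕ} {i : Fin (m + 1) → ZMod e}

/-- The coefficient of the transposition in `ψ`. -/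
def psiLead (p s : ZMod e) (y z : RatField k (m + 1)) : RatField k (m + 1) :=
  if p = s then -(z - y)⁻¹ else if p = s + 1 then y - z else 1

/-- The coefficient of the identity in `ψ`. -/
def psiTail (p s : ZMod e) (y z : RatField k (m + 1)) : RatField k (m + 1) :=
  if p = s then (z - y)⁻¹ else 0

/-- The polynomials `ψ² e(u)`. -/
def psiSq (p s : ZMod e) (y z : RatField k (m + 1)) : RatField k (m + 1) :=
  if p = s then 0 else (if p = s + 1 then y - z else 1) * (if s = p + 1 then z - y else 1)

/-- The error terms in the braid relations of the quiver Hecke algebra. -/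
def psiErr (p s t : ZMod e) (y z w : RatField k (m + 1)) : RatField k (m + 1) :=
  if p = t ∧ p ≠ s then
    if s = p + 1 then if p = s + 1 then y + w - 2 * z else 1
    else if p = s + 1 then -1 else 0
  else 0

/-- The function on the orbit given by the error terms in the braid relations. -/
def err (a b c : Fin (m + 1)) : OrbitFun k i :=
  fun u => psiErr (u.1 a) (u.1 b) (u.1 c) (x a) (x b) (x c)

theorem equivariant_psiLead : Equivariant (k := k) (m := m) (e := e) psiLead := by
  intro σ p s y z
  unfold psiLead
  split_ifs <;> simp [map_inv₀]

theorem equivariant_psiTail : Equivariant (k := k) (m := m) (e := e) psiTail := by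
  intro σ p s y z
  unfold psiTail
  split_ifs <;> simp [map_inv₀]

theorem two_psiLead_mem {a b : Fin (m + 1)} (h : a ≠ b) :
    two (i := i) psiLead a b ∈ nonZeroDivisors (OrbitFun k i) := by
  refine mem_nonZeroDivisors fun u => ?_
  rw [two_apply, psiLead]
  split_ifs
  · exact neg_ne_zero.2 (inv_ne_zero (x_sub_x_ne_zero h.symm))
  · exact x_sub_x_ne_zero h
  · exact one_ne_zero

variable (k i) in
/-- The operator `ψ`. -/
abbrev psiOp (a b : Fin (m + 1)) :
    SkewMonoidAlgebra (OrbitFun k i) (Equiv.Perm (Fin (m + 1))) := op i psiLead psiTail a b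

/-- The coefficient at the transposition contains `β_ba + β_ab`, which is zero because `(z - y)⁻¹`
is antisymmetric. -/
theorem psiOp_mul_self (a b : Fin (m + 1)) :
    psiOp k i a b * psiOp k i a b = single 1 (two psiSq a b) := by
  rw [psiOp, op_mul_self equivariant_psiLead equivariant_psiTail]
  have h1 : two psiTail b a + two psiTail a b = (0 : OrbitFun k i) := by
    ext u
    simp only [add_apply, two_apply, psiTail, zero_apply, eq_comm (a := u.1 b)]
    split_ifs
    · rw [← neg_sub (x b), inv_neg]; ring
    · ring
  rw [h1, mul_zero, single_zero, zero_add]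
  congr 1
  ext u
  simp only [add_apply, mul_apply, two_apply, psiTail, psiLead, psiSq, eq_comm (a := u.1 b)
    (b := u.1 a)]
  split_ifs
  · rw [← neg_sub (x b), inv_neg]; ring
  all_goals ring

/-- The two conditions of `op_braid` are the partial fraction identity for three variables when all
three entries agree, and are trivial otherwise. The term at the identity survives only if the outer
entries agree and differ from the middle one; it is then the divided difference of `ψ²` in the outer
variables. -/
theorem psiOp_braid {a b c : Fin (m + 1)} (hab : a ≠ b) (hbc : b ≠ c) (hac : a ≠ c) :
    psiOp k i a b * psiOp k i b c * psiOp k i a b =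
      psiOp k i b c * psiOp k i a b * psiOp k i b c + single 1 (err a b c) := by
  have hba := x_sub_x_ne_zero (k := k) hab.symm
  have hcb := x_sub_x_ne_zero (k := k) hbc.symm
  have hca := x_sub_x_ne_zero (k := k) hac.symm
  have hab' := x_sub_x_ne_zero (k := k) hab
  have hbc' := x_sub_x_ne_zero (k := k) hbc
  have hac' := x_sub_x_ne_zero (k := k) hac
  rw [op_braid equivariant_psiLead equivariant_psiTail hab hbc hac]
  · congr 2
    ext u
    simp only [add_apply, sub_apply, mul_apply, two_apply, psiTail, psiLead, err, psiErr]
    generalize u.1 a = p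
    generalize u.1 b = s
    generalize u.1 c = t
    by_cases h1 : p = s
    · subst h1
      by_cases h2 : p = t
      · subst h2
        simp only [if_true, ne_eq, not_true_eq_false, and_false, if_false]
        field_simp
        ring
      · simp [h2]
    · by_cases h2 : p = t
      · subst h2
        simp only [if_true, ne_eq, h1, not_false_eq_true, and_self, if_false, Ne.symm h1]
        split_ifs <;> field_simp <;> ring
      · simp [h1, h2]
  · ext u
    simp only [add_apply, mul_apply, two_apply, psiTail]
    generalize u.1 a = p
    generalize u.1 b = s
    generalize u.1 c = t
    by_cases h1 : p = s
    · subst h1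
      by_cases h2 : p = t
      · subst h2
        simp only [if_true]
        field_simp
        ring
      · simp [h2]
    · simp only [h1, Ne.symm h1, if_false]
      by_cases h2 : p = t
      · subst h2; simp [Ne.symm h1]
      · simp [h2]
  · ext u
    simp only [add_apply, mul_apply, two_apply, psiTail]
    generalize u.1 a = p
    generalize u.1 b = s
    generalize u.1 c = t
    by_cases h1 : s = t
    · subst h1
      by_cases h2 : p = s
      · subst h2
        simp only [if_true]
        field_simp
        ring
      · simp [h2]
    · simp only [h1, Ne.symm h1, if_false]
      by_cases h2 : p = t
      · subst h2; simp [Ne.symm h1]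
      · simp [h2]

end Psi

/-! ### The operators of the Hecke algebra -/

section Hecke

variable {k : Type*} [Field k] {q : k} {m : ℕ} {i : Fin (m + 1) → ZMod (orderOf q)}

/-- This includes infinite order, where `orderOf q = 0` and `ZMod 0` is `ℤ`. -/
theorem _root_.zpow_eq_zpow_iff_orderOf (hq : q ≠ 0) (a b : ℤ) :
    q ^ a = q ^ b ↔ (a : ZMod (orderOf q)) = b := by
  have h : ∀ c : ℤ, q ^ c = ((Units.mk0 q hq ^ c : kˣ) : k) := fun c => by simp
  have h' : orderOf (Units.mk0 q hq) = orderOf q := by rw [← orderOf_units, Units.val_mk0]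
  rw [h, h, Units.val_inj, zpow_eq_zpow_iff_modEq, h', ZMod.intCast_eq_intCast_iff]

/-- The integer lifts of `a + 1` and `a` need not differ by one, but they do up to a multiple of the
order of `q`. -/
theorem _root_.qpow_add_one (hq : q ≠ 0) (a : ZMod (orderOf q)) :
    qpow q (a + 1) = q * qpow q a := by
  have : q * qpow q a = q ^ ((a.cast : ℤ) + 1) := by
    rw [zpow_add_one₀ hq, mul_comm]; rfl
  rw [this, qpow, zpow_eq_zpow_iff_orderOf hq]
  simp

theorem _root_.qpow_injective (hq : q ≠ 0) : Function.Injective (qpow q) := by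
  intro a b hab
  rw [qpow, qpow, zpow_eq_zpow_iff_orderOf hq] at hab
  simpa using hab

theorem _root_.qpow_ne_zero (hq : q ≠ 0) (a : ZMod (orderOf q)) : qpow q a ≠ 0 :=
  zpow_ne_zero _ hq

/-- The variable `X` at an entry `p`, in terms of the variable `y` of the quiver Hecke algebra. -/
def toX (p : ZMod (orderOf q)) (y : RatField k (m + 1)) : RatField k (m + 1) :=
  algebraMap k _ (qpow q p) * (1 - y)

/-- The coefficient of the transposition in `T`. -/
def heckeLead (p s : ZMod (orderOf q)) (y z : RatField k (m + 1)) : RatField k (m + 1) :=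
  -(algebraMap k _ q * toX s z - toX p y) * (toX s z - toX p y)⁻¹

/-- The coefficient of the identity in `T`. -/
def heckeTail (p s : ZMod (orderOf q)) (y z : RatField k (m + 1)) : RatField k (m + 1) :=
  (algebraMap k _ q - 1) * toX s z * (toX s z - toX p y)⁻¹

/-- The left coefficient of `ψ` in the intertwiner `T + shift`. -/
def ampl (p s : ZMod (orderOf q)) (y z : RatField k (m + 1)) : RatField k (m + 1) :=
  if p = s then 1 - algebraMap k _ q - y + algebraMap k _ q * z
  else if p = s + 1 then
    -algebraMap k _ q * (1 - algebraMap k _ q - z + algebraMap k _ q * y)⁻¹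
  else (toX p y - algebraMap k _ q * toX s z) * (toX s z - toX p y)⁻¹

/-- The difference of the intertwiner and `T`. -/
def shift (p s : ZMod (orderOf q)) (y z : RatField k (m + 1)) : RatField k (m + 1) :=
  if p = s then 1 else (1 - algebraMap k _ q) * (1 - toX p y * (toX s z)⁻¹)⁻¹

theorem perm_toX (σ : Equiv.Perm (Fin (m + 1))) (p : ZMod (orderOf q)) (y : RatField k (m + 1)) :
    perm k (m + 1) σ (toX p y) = toX p (perm k (m + 1) σ y) := by
  simp [toX]

theorem equivariant_heckeLead : Equivariant (k := k) (m := m) (heckeLead (q := q)) := by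
  intro σ p s y z
  simp [heckeLead, perm_toX, map_inv₀]

theorem equivariant_heckeTail : Equivariant (k := k) (m := m) (heckeTail (q := q)) := by
  intro σ p s y z
  simp [heckeTail, perm_toX, map_inv₀]

theorem equivariant_ampl : Equivariant (k := k) (m := m) (ampl (q := q)) := by
  intro σ p s y z
  unfold ampl
  split_ifs <;> simp [perm_toX, map_inv₀]

theorem equivariant_shift : Equivariant (k := k) (m := m) (shift (q := q)) := by
  intro σ p s y z
  unfold shift
  split_ifs <;> simp [perm_toX, map_inv₀]

theorem reg_toX (p : ZMod (orderOf q)) (a : Fin (m + 1)) :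
    Reg (toX p (x a) : RatField k (m + 1)) (qpow q p) := by
  simpa [toX] using (Reg.const (n := m + 1) (qpow q p)).mul (Reg.one.sub (Reg.x a))

theorem toX_ne_zero (hq : q ≠ 0) (p : ZMod (orderOf q)) (a : Fin (m + 1)) :
    (toX p (x a) : RatField k (m + 1)) ≠ 0 :=
  (reg_toX p a).ne_zero (qpow_ne_zero hq p)

/-- For equal entries the difference is a nonzero multiple of `x_b - x_a`; for different entries its
value at the origin is `q^p - q^s`, which is nonzero. -/
theorem toX_sub_toX_ne_zero (hq : q ≠ 0) (p s : ZMod (orderOf q)) {a b : Fin (m + 1)}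
    (h : a ≠ b) : (toX p (x a) - toX s (x b) : RatField k (m + 1)) ≠ 0 := by
  by_cases hps : p = s
  · subst hps
    have : (toX p (x a) - toX p (x b) : RatField k (m + 1)) =
        algebraMap k _ (qpow q p) * (x b - x a) := by rw [toX, toX]; ring
    rw [this]
    exact mul_ne_zero ((map_ne_zero _).2 (qpow_ne_zero hq p)) (x_sub_x_ne_zero h.symm)
  · exact ((reg_toX p a).sub (reg_toX s b)).ne_zero
      (sub_ne_zero.2 fun h => hps (qpow_injective hq h))

variable (q i) in
/-- The operator `T`. -/
abbrev heckeOp (a b : Fin (m + 1)) :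
    SkewMonoidAlgebra (OrbitFun k i) (Equiv.Perm (Fin (m + 1))) := op i heckeLead heckeTail a b

/-- The values at the origin are `1 - q`, `-q / (1 - q)` and `(q^p - q^{s+1}) / (q^s - q^p)` in the
three cases. So the factor is a unit of the local ring, and `ψ` can be recovered from `T`. -/
theorem reg_ampl (hq : q ≠ 0) (hq1 : q ≠ 1) (p s : ZMod (orderOf q)) (a b : Fin (m + 1)) :
    ∃ c, c ≠ 0 ∧ Reg (ampl p s (x a) (x b) : RatField k (m + 1)) c := by
  unfold ampl
  have hq1' : 1 - q ≠ 0 := sub_ne_zero.2 hq1.symm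
  split_ifs with h1 h2
  · have := ((Reg.one.sub (Reg.const q)).sub (Reg.x (k := k) a)).add
      ((Reg.const (n := m + 1) q).mul (Reg.x b))
    exact ⟨_, by simpa using hq1', this⟩
  · have h3 := ((Reg.one.sub (Reg.const q)).sub (Reg.x (k := k) b)).add
      ((Reg.const (n := m + 1) q).mul (Reg.x a))
    exact ⟨_, by simpa [hq] using hq1', (Reg.const q).neg.mul (h3.inv (by simpa using hq1'))⟩
  · have h3 : qpow q s - qpow q p ≠ 0 := sub_ne_zero.2 fun h => h1 (qpow_injective hq h.symm)
    have h4 : qpow q p - q * qpow q s ≠ 0 := sub_ne_zero.2 fun h => h2 (qpow_injective hq (by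
      rw [h, qpow_add_one hq]))
    exact ⟨_, mul_ne_zero h4 (inv_ne_zero h3), ((reg_toX p a).sub ((Reg.const q).mul
      (reg_toX s b))).mul (((reg_toX s b).sub (reg_toX p a)).inv h3)⟩

theorem reg_denom (hq : q ≠ 0) {p s : ZMod (orderOf q)} (h : p ≠ s) (a b : Fin (m + 1)) :
    ∃ c, c ≠ 0 ∧ Reg (1 - toX p (x a) * (toX s (x b))⁻¹ : RatField k (m + 1)) c := by
  refine ⟨_, ?_, Reg.one.sub ((reg_toX p a).mul ((reg_toX s b).inv (qpow_ne_zero hq s)))⟩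
  rw [sub_ne_zero, ne_comm]
  intro h'
  refine h (qpow_injective hq ?_)
  rwa [mul_inv_eq_one₀ (qpow_ne_zero hq s)] at h'

theorem reg_shift (hq : q ≠ 0) (p s : ZMod (orderOf q)) (a b : Fin (m + 1)) :
    ∃ c, Reg (shift p s (x a) (x b) : RatField k (m + 1)) c := by
  unfold shift
  split_ifs with h1
  · exact ⟨1, Reg.one⟩
  · obtain ⟨c, hc, h⟩ := reg_denom (m := m) hq h1 a b
    exact ⟨_, (Reg.one.sub (Reg.const q)).mul (h.inv hc)⟩

theorem reg_heckeTail (hq : q ≠ 0) {p s : ZMod (orderOf q)} (h : p ≠ s) (a b : Fin (m + 1)) :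
    ∃ c, Reg (heckeTail p s (x a) (x b) : RatField k (m + 1)) c :=
  ⟨_, (((Reg.const q).sub Reg.one).mul (reg_toX s b)).mul (((reg_toX s b).sub (reg_toX p a)).inv
    (sub_ne_zero.2 fun h' => h (qpow_injective hq h'.symm)))⟩

/-- The part of `T + shift = ampl · ψ` at the transposition. For `p = s` the denominator vanishes at
the origin, for `p = s + 1` the numerator does; in both cases the offending factor is a multiple of
`y - z`, and `psiLead` absorbs it. -/
theorem heckeLead_eq (hq : q ≠ 0) (p s : ZMod (orderOf q)) {a b : Fin (m + 1)}
    (hab : a ≠ b) :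
    (heckeLead p s (x a) (x b) : RatField k (m + 1)) =
      ampl p s (x a) (x b) * psiLead p s (x a) (x b) := by
  have h0 := x_sub_x_ne_zero (k := k) hab.symm
  have h1 := toX_sub_toX_ne_zero (k := k) hq s p hab.symm
  unfold ampl psiLead heckeLead
  split_ifs with h2 h3
  · subst h2
    have hp : algebraMap k (RatField k (m + 1)) (qpow q p) ≠ 0 :=
      (map_ne_zero _).2 (qpow_ne_zero hq p)
    rw [toX, toX] at *
    field_simp
    have : (1 - x b - (1 - x a) : RatField k (m + 1)) = -(x b - x a) := by ring
    rw [this]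
    field_simp
    ring
  · subst h3
    have hp : algebraMap k (RatField k (m + 1)) (qpow q s) ≠ 0 :=
      (map_ne_zero _).2 (qpow_ne_zero hq s)
    rw [toX, toX, qpow_add_one hq, map_mul] at *
    have h4 : (1 - algebraMap k (RatField k (m + 1)) q - x b + algebraMap k _ q * x a) ≠ 0 := by
      intro h
      apply h1
      linear_combination algebraMap k (RatField k (m + 1)) (qpow q s) * h
    have h5 : algebraMap k (RatField k (m + 1)) (qpow q s) * (1 - x b) -
      algebraMap k _ q * algebraMap k _ (qpow q s) * (1 - x a) =
      algebraMap k (RatField k (m + 1)) (qpow q s) *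
        (1 - algebraMap k (RatField k (m + 1)) q - x b + algebraMap k _ q * x a) := by ring
    rw [h5]
    field_simp
    ring
  · ring

/-- The part of `T + shift = ampl · ψ` at the identity: for equal entries `shift = 1` removes the
regular part of `ampl · ψ`, and for different entries `psiTail` is zero and `shift` is the whole of
`-T` there. -/
theorem heckeTail_eq (hq : q ≠ 0) (p s : ZMod (orderOf q)) {a b : Fin (m + 1)}
    (hab : a ≠ b) :
    (heckeTail p s (x a) (x b) : RatField k (m + 1)) =
      ampl p s (x a) (x b) * psiTail p s (x a) (x b) - shift p s (x a) (x b) := by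
  have h0 := x_sub_x_ne_zero (k := k) hab.symm
  have h1 := toX_sub_toX_ne_zero (k := k) hq s p hab.symm
  have h2 := toX_ne_zero (k := k) hq s b
  unfold ampl psiTail heckeTail shift
  split_ifs with h3
  · subst h3
    have hp : algebraMap k (RatField k (m + 1)) (qpow q p) ≠ 0 :=
      (map_ne_zero _).2 (qpow_ne_zero hq p)
    rw [toX, toX] at *
    field_simp
    have : (1 - x b - (1 - x a) : RatField k (m + 1)) = -(x b - x a) := by ring
    rw [this]
    field_simp
    ring
  all_goals
    have h4 : (1 - toX p (x a) * (toX s (x b))⁻¹ : RatField k (m + 1)) =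
      (toX s (x b) - toX p (x a)) * (toX s (x b))⁻¹ := by field_simp
    rw [h4, mul_inv, inv_inv]
    ring

variable (i) in
/-- Constant functions. -/
def const (c : k) : OrbitFun k i := fun _ => algebraMap k _ c

theorem const_apply (c : k) (u : SymOrbit i) : const i c u = algebraMap k _ c := rfl

theorem heckeOp_mul_self (hq : q ≠ 0) {a b : Fin (m + 1)} (hab : a ≠ b) :
    heckeOp q i a b * heckeOp q i a b =
      single 1 (const i (q - 1)) * heckeOp q i a b + single 1 (const i q) := by
  rw [heckeOp, op_mul_self equivariant_heckeLead equivariant_heckeTail, op,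
    mul_add (single 1 (const i (q - 1))), single_mul_single, single_mul_single, one_smul, one_smul, one_mul, one_mul, add_assoc,
    ← single_add]
  have h1 := fun p s => toX_sub_toX_ne_zero (k := k) (q := q) hq p s hab
  have h2 := fun p s => toX_sub_toX_ne_zero (k := k) (q := q) hq p s hab.symm
  congr 2 <;> ext u <;> simp only [add_apply, mul_apply, two_apply, heckeLead, heckeTail, const_apply, map_sub, map_one] <;>
    have h1 := h1 (u.1 a) (u.1 b) <;> have h2 := h2 (u.1 b) (u.1 a) <;> field_simp <;> ring

/-- The coefficients depend only on three quantities `X, Y, Z` with nonzero differences, so a case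
distinction on the entries of `u` is not needed, and the term at the identity cancels. -/
theorem heckeOp_braid (hq : q ≠ 0) {a b c : Fin (m + 1)} (hab : a ≠ b) (hbc : b ≠ c)
    (hac : a ≠ c) :
    heckeOp q i a b * heckeOp q i b c * heckeOp q i a b =
      heckeOp q i b c * heckeOp q i a b * heckeOp q i b c := by
  have h {a b} (h : a ≠ b) := fun p s => toX_sub_toX_ne_zero (k := k) (m := m) (q := q) hq p s h
  rw [op_braid equivariant_heckeLead equivariant_heckeTail hab hbc hac, add_eq_left,
    single_eq_zero]
  all_goals
    ext u
    have h1 := h hab (u.1 a) (u.1 b)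
    have h2 := h hbc (u.1 b) (u.1 c)
    have h3 := h hac (u.1 a) (u.1 c)
    have h4 := h hab.symm (u.1 b) (u.1 a)
    have h5 := h hbc.symm (u.1 c) (u.1 b)
    have h6 := h hac.symm (u.1 c) (u.1 a)
    simp only [add_apply, sub_apply, mul_apply, two_apply, heckeLead, heckeTail, zero_apply]
    generalize (toX (u.1 a) (x a) : RatField k (m + 1)) = X at *
    generalize (toX (u.1 b) (x b) : RatField k (m + 1)) = Y at *
    generalize (toX (u.1 c) (x c) : RatField k (m + 1)) = Z at *
    field_simp
    ring

end Hecke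

end OrbitFun
end

noncomputable section

open RatField

/-! ### The coefficient ring -/

/-- The local ring of the affine space at the origin. -/
def LocalRing (k : Type*) [Field k] (n : ℕ) : Type _ := localRing k n

namespace LocalRing

variable {k : Type*} [Field k] {n : ℕ}

instance : CommRing (LocalRing k n) := inferInstanceAs (CommRing (localRing k n))

instance : Algebra (MvPolynomial (Fin n) k) (LocalRing k n) :=
  inferInstanceAs (Algebra (MvPolynomial (Fin n) k) (localRing k n))

instance : Algebra k (LocalRing k n) :=
  ((algebraMap (MvPolynomial (Fin n) k) (LocalRing k n)).comp MvPolynomial.C).toAlgebra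

instance : IsLocalization (unitsAtZero k n) (LocalRing k n) :=
  inferInstanceAs (IsLocalization (unitsAtZero k n) (localRing k n))

variable (k n) in
/-- Elements of the local ring as rational functions. -/
def val : LocalRing k n →+* RatField k n := (localRing k n).val.toRingHom

theorem val_injective : Function.Injective (val k n) := Subtype.val_injective

variable (k n) in
/-- Polynomials as elements of the local ring. -/
def poly : MvPolynomial (Fin n) k →ₐ[k] LocalRing k n where
  toRingHom := algebraMap (MvPolynomial (Fin n) k) (LocalRing k n)
  commutes' _ := rfl

theorem val_poly (p : MvPolynomial (Fin n) k) : val k n (poly k n p) = algebraMap _ _ p := rfl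

@[simp]
theorem val_algebraMap (c : k) : val k n (algebraMap k _ c) = algebraMap k _ c := by
  rw [algebraMap_eq]; rfl

theorem isUnit_poly {p : MvPolynomial (Fin n) k} (h : MvPolynomial.constantCoeff p ≠ 0) :
    IsUnit (poly k n p) :=
  IsLocalization.map_units (LocalRing k n) (⟨p, mem_unitsAtZero.2 h⟩ : unitsAtZero k n)

theorem exists_mul_eq_poly (f : LocalRing k n) : ∃ a s : MvPolynomial (Fin n) k,
    MvPolynomial.constantCoeff s ≠ 0 ∧ f * poly k n s = poly k n a := by
  obtain ⟨⟨a, s⟩, h⟩ := IsLocalization.surj (unitsAtZero k n) f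
  exact ⟨a, s, mem_unitsAtZero.1 s.2, h⟩

theorem exists_reg (f : LocalRing k n) : ∃ c, Reg (val k n f) c := RatField.exists_reg f.2

/-- The element of the local ring given by a regular function. -/
def mk (f : RatField k n) (h : ∃ c, Reg f c) : LocalRing k n := ⟨f, h.choose_spec.mem⟩

theorem isUnit_of_reg {f : LocalRing k n} {c : k} (h : Reg (val k n f) c) (hc : c ≠ 0) :
    IsUnit f := h.isUnit hc

/-- Algebra homomorphisms from polynomials extend to the local ring. -/
theorem exists_lift {D : Type*} [CommRing D] [Algebra k D] (μ : MvPolynomial (Fin n) k →ₐ[k] D)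
    (h : ∀ p, MvPolynomial.constantCoeff p ≠ 0 → IsUnit (μ p)) :
    ∃ F : LocalRing k n →ₐ[k] D, ∀ p, F (poly k n p) = μ p := by
  have h' : ∀ s : unitsAtZero k n, IsUnit (μ.toRingHom s) := fun s => h s (mem_unitsAtZero.1 s.2)
  refine ⟨{ IsLocalization.lift h' with commutes' := fun c => ?_ }, fun p => ?_⟩
  · change IsLocalization.lift h' (algebraMap (MvPolynomial (Fin n) k) _ (MvPolynomial.C c)) = _
    rw [IsLocalization.lift_eq]
    exact μ.commutes c
  · change IsLocalization.lift h' (algebraMap (MvPolynomial (Fin n) k) _ p) = _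
    rw [IsLocalization.lift_eq]
    rfl

end LocalRing

/-- Functions on the orbit of `i` with values in the local ring. -/
def OrbitCoef (k : Type*) [Field k] {m e : ℕ} (i : Fin (m + 1) → ZMod e) : Type _ :=
  SymOrbit i → LocalRing k (m + 1)

namespace OrbitCoef

variable {k : Type*} [Field k] {m e : ℕ} {i : Fin (m + 1) → ZMod e}

instance : CommRing (OrbitCoef k i) := inferInstanceAs (CommRing (SymOrbit i → LocalRing k (m + 1)))

instance : Algebra k (OrbitCoef k i) :=
  inferInstanceAs (Algebra k (SymOrbit i → LocalRing k (m + 1)))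

variable (k i) in
/-- Evaluation at an element of the orbit. -/
def eval (u : SymOrbit i) : OrbitCoef k i →ₐ[k] LocalRing k (m + 1) :=
  Pi.evalAlgHom k (fun _ : SymOrbit i => LocalRing k (m + 1)) u

theorem ext_eval {F F' : OrbitCoef k i} (h : ∀ u, eval k i u F = eval k i u F') : F = F' :=
  funext h

variable (k i) in
/-- Constant functions. -/
def const : LocalRing k (m + 1) →ₐ[k] OrbitCoef k i :=
  Pi.constAlgHom k (SymOrbit i) (LocalRing k (m + 1))

@[simp] theorem eval_const (u : SymOrbit i) (f : LocalRing k (m + 1)) :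
    eval k i u (const k i f) = f := rfl

variable (k) in
/-- The idempotent of an element of the orbit. -/
def idem (u : SymOrbit i) : OrbitCoef k i := Pi.single u (1 : LocalRing k (m + 1))

theorem eval_idem (u v : SymOrbit i) : eval k i v (idem k u) = if v = u then 1 else 0 :=
  Pi.single_apply _ _ _

variable (k i) in
/-- The variable `x_j`. -/
def x (j : Fin (m + 1)) : OrbitCoef k i := const k i (LocalRing.poly k _ (MvPolynomial.X j))

variable (k i) in
/-- The inclusion in the functions with values in the rational functions. -/
def toFun : OrbitCoef k i →+* OrbitFun k i :=
  RingHom.pi fun u => (LocalRing.val k (m + 1)).comp (eval k i u).toRingHom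

theorem toFun_apply (F : OrbitCoef k i) (u : SymOrbit i) :
    toFun k i F u = LocalRing.val k _ (eval k i u F) := rfl

theorem toFun_injective : Function.Injective (toFun k i) := fun _ _ h =>
  ext_eval fun u => LocalRing.val_injective (congrFun h u)

theorem toFun_x (j : Fin (m + 1)) (u : SymOrbit i) : toFun k i (x k i j) u = RatField.x j := rfl

theorem toFun_idem (u v : SymOrbit i) : toFun k i (idem k u) v = if v = u then 1 else 0 := by
  rw [toFun_apply, eval_idem]
  split_ifs <;> simp

/-- The coefficient function given by regular functions. -/
def mk (F : OrbitFun k i) (h : ∀ u, ∃ c, Reg (F u) c) : OrbitCoef k i :=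
  fun u => LocalRing.mk (F u) (h u)

@[simp]
theorem toFun_mk (F : OrbitFun k i) (h : ∀ u, ∃ c, Reg (F u) c) : toFun k i (mk F h) = F := rfl

theorem exists_reg (F : OrbitCoef k i) (u : SymOrbit i) : ∃ c, Reg (toFun k i F u) c :=
  LocalRing.exists_reg _

theorem isUnit_of_reg {F : OrbitCoef k i} (h : ∀ u, ∃ c, c ≠ 0 ∧ Reg (toFun k i F u) c) :
    IsUnit F :=
  Pi.isUnit_iff.2 fun u => by
    obtain ⟨c, hc, h⟩ := h u
    exact LocalRing.isUnit_of_reg h hc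

theorem idem_mul_idem (u v : SymOrbit i) :
    idem k u * idem k v = if u = v then idem k u else 0 := by
  refine ext_eval fun w => ?_
  rw [map_mul, eval_idem, eval_idem]
  split_ifs <;> simp_all [eval_idem]

theorem sum_idem : ∑ u : SymOrbit i, idem k u = 1 := by
  refine ext_eval fun w => ?_
  simp [map_sum, eval_idem]

theorem mul_idem (F : OrbitCoef k i) (u : SymOrbit i) :
    F * idem k u = const k i (eval k i u F) * idem k u := by
  refine ext_eval fun w => ?_
  rw [map_mul, map_mul, eval_const, eval_idem]
  split_ifs with h
  · rw [h]
  · simp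

theorem eq_sum (F : OrbitCoef k i) : F = ∑ u, const k i (eval k i u F) * idem k u := by
  simp_rw [← mul_idem]
  rw [← Finset.mul_sum, sum_idem, mul_one]

/-- Algebra homomorphisms from the coefficient ring to a commutative ring. -/
theorem exists_hom_of_comm {D : Type*} [CommRing D] [Algebra k D] (y : Fin (m + 1) → D)
    (ε : SymOrbit i → D) (hε : ∀ u v, ε u * ε v = if u = v then ε u else 0) (hs : ∑ u, ε u = 1)
    (hu : ∀ p : MvPolynomial (Fin (m + 1)) k, MvPolynomial.constantCoeff p ≠ 0 →
      IsUnit (MvPolynomial.aeval y p)) :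
    ∃ ι : OrbitCoef k i →ₐ[k] D, (∀ j, ι (x k i j) = y j) ∧ ∀ u, ι (idem k u) = ε u := by
  obtain ⟨F, hF⟩ := LocalRing.exists_lift (MvPolynomial.aeval y) hu
  let ι : OrbitCoef k i → D := fun f => ∑ u, F (eval k i u f) * ε u
  have hι : ∀ f, ι f = ∑ u, F (eval k i u f) * ε u := fun f => rfl
  have hmul : ∀ f g, ι (f * g) = ι f * ι g := by
    intro f g
    simp only [hι, Finset.sum_mul_sum, map_mul]
    refine Finset.sum_congr rfl fun u _ => ?_
    rw [Finset.sum_eq_single u]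
    · have := hε u u
      rw [if_pos rfl] at this
      linear_combination -F (eval k i u f) * F (eval k i u g) * this
    · intro v _ hv
      have := hε u v
      rw [if_neg hv.symm] at this
      linear_combination F (eval k i u f) * F (eval k i v g) * this
    · simp
  let ι' : OrbitCoef k i →ₐ[k] D :=
    { toFun := ι
      map_one' := by simp [hι, hs]
      map_mul' := hmul
      map_zero' := by simp [hι]
      map_add' := fun f g => by simp [hι, add_mul, Finset.sum_add_distrib]
      commutes' := fun c => by simp [hι, ← Finset.mul_sum, hs] }
  refine ⟨ι', fun j => ?_, fun u => ?_⟩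
  · change ι _ = _
    simp [hι, x, hF, ← Finset.mul_sum, hs]
  · change ι _ = _
    simp [hι, eval_idem]

/-- Algebra homomorphisms from the coefficient ring. -/
theorem exists_hom {B : Type*} [Ring B] [Algebra k B] (y : Fin (m + 1) → B)
    (ε : SymOrbit i → B) (hy : ∀ a b, y a * y b = y b * y a) (hyε : ∀ a u, y a * ε u = ε u * y a)
    (hε : ∀ u v, ε u * ε v = if u = v then ε u else 0) (hs : ∑ u, ε u = 1)
    (hu : ∀ μ : MvPolynomial (Fin (m + 1)) k →ₐ[k] B, (∀ j, μ (MvPolynomial.X j) = y j) →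
      ∀ p, MvPolynomial.constantCoeff p ≠ 0 → IsUnit (μ p)) :
    ∃ ι : OrbitCoef k i →ₐ[k] B, (∀ j, ι (x k i j) = y j) ∧ ∀ u, ι (idem k u) = ε u := by
  let S : Set B := Set.range y ∪ Set.range ε
  have hS : S ⊆ Set.centralizer S := by
    have hεc : ∀ u v, ε u * ε v = ε v * ε u := fun u v => by
      rw [hε, hε]
      split_ifs with h1 h2 h2
      · rw [h1]
      · exact absurd h1.symm h2
      · exact absurd h2.symm h1
      · rfl
    rintro _ (⟨a, rfl⟩ | ⟨u, rfl⟩) _ (⟨b, rfl⟩ | ⟨v, rfl⟩)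
    · exact hy _ _
    · exact (hyε _ _).symm
    · exact hyε _ _
    · exact hεc _ _
  -- The double centralizer of a commuting set is commutative. Unlike the algebra generated by `S`,
  -- it contains the inverse in `B` of each of its elements that is a unit of `B`, so the map
  -- extends to the local ring.
  let D : Subalgebra k B := Subalgebra.centralizer k (Set.centralizer S)
  have hSD : S ⊆ D := fun s hs t ht => (ht s hs).symm
  have hDc : ∀ a b : D, a * b = b * a := fun a b =>
    Subtype.ext (b.2 a fun s hs => a.2 s (hS hs))
  let _ : CommRing D := { (inferInstance : Ring D) with mul_comm := hDc }
  let y' : Fin (m + 1) → D := fun j => ⟨y j, hSD (Or.inl ⟨j, rfl⟩)⟩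
  let ε' : SymOrbit i → D := fun u => ⟨ε u, hSD (Or.inr ⟨u, rfl⟩)⟩
  obtain ⟨ι, h1, h2⟩ := exists_hom_of_comm (k := k) y' ε'
    (fun u v => Subtype.ext (by
      have := hε u v
      split_ifs at this ⊢ <;> exact this))
    (Subtype.ext (by rw [← Subalgebra.coe_val, map_sum]; simpa [ε'] using hs)) (fun p hp => by
      obtain ⟨w, hw⟩ := hu (D.val.comp (MvPolynomial.aeval y'))
        (fun j => by simp [y']) p hp
      have hw' : (w : B) = (MvPolynomial.aeval y' p : D) := hw
      have hmem : ((w⁻¹ : Bˣ) : B) ∈ D := fun s hs => by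
        have hc : Commute s (w : B) := by
          rw [hw']
          exact (MvPolynomial.aeval y' p : D).2 s hs
        exact hc.units_inv_right
      exact IsUnit.of_mul_eq_one ⟨_, hmem⟩ (Subtype.ext (by
        change ((MvPolynomial.aeval y' p : D) : B) * _ = 1
        rw [← hw', Units.mul_inv])))
  exact ⟨D.val.comp ι, fun j => by simp [h1, y'], fun u => by simp [h2, ε']⟩

/-- A homomorphism from the coefficient ring is determined by the images of the variables and
idempotents. -/
theorem hom_ext {B : Type*} [Ring B] [Algebra k B] {ι ι' : OrbitCoef k i →ₐ[k] B}
    (hx : ∀ j, ι (x k i j) = ι' (x k i j)) (he : ∀ u, ι (idem k u) = ι' (idem k u)) : ι = ι' := by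
  have hp : ∀ p, ι (const k i (LocalRing.poly k _ p)) = ι' (const k i (LocalRing.poly k _ p)) :=
    fun p => DFunLike.congr_fun (MvPolynomial.algHom_ext (f := (ι.comp (const k i)).comp
      (LocalRing.poly k _)) (g := (ι'.comp (const k i)).comp (LocalRing.poly k _)) hx) p
  have hc : ∀ f, ι (const k i f) = ι' (const k i f) := by
    intro f
    obtain ⟨a, s, hs, h⟩ := LocalRing.exists_mul_eq_poly f
    have hu : IsUnit (ι (const k i (LocalRing.poly k _ s))) :=
      (LocalRing.isUnit_poly hs).map (ι.comp (const k i))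
    refine hu.mul_right_cancel ?_
    rw [← map_mul, ← map_mul, h, hp, hp, ← map_mul, ← map_mul, h]
  refine AlgHom.ext fun F => ?_
  rw [eq_sum F]
  simp only [map_sum, map_mul, hc, he]

end OrbitCoef

end

noncomputable section

open SkewMonoidAlgebra

namespace OrbitCoef

variable {k : Type*} [Field k] {m e : ℕ} {i : Fin (m + 1) → ZMod e}

/-- The action of permutations on the coefficient ring. -/
def act (σ : Equiv.Perm (Fin (m + 1))) (F : OrbitCoef k i) : OrbitCoef k i :=
  mk (σ • toFun k i F) fun u => by
    obtain ⟨c, hc⟩ := exists_reg F (u.permute σ)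
    exact ⟨c, hc.perm σ⟩

@[simp]
theorem toFun_act (σ : Equiv.Perm (Fin (m + 1))) (F : OrbitCoef k i) :
    toFun k i (act σ F) = σ • toFun k i F := rfl

theorem act_eq {σ : Equiv.Perm (Fin (m + 1))} {F G : OrbitCoef k i}
    (h : σ • toFun k i F = toFun k i G) : act σ F = G := toFun_injective h

theorem act_mul (σ : Equiv.Perm (Fin (m + 1))) (F G : OrbitCoef k i) :
    act σ (F * G) = act σ F * act σ G := act_eq (by simp [smul_mul'])

theorem act_add (σ : Equiv.Perm (Fin (m + 1))) (F G : OrbitCoef k i) :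
    act σ (F + G) = act σ F + act σ G := act_eq (by simp)

theorem act_one (σ : Equiv.Perm (Fin (m + 1))) : act σ (1 : OrbitCoef k i) = 1 :=
  act_eq (by simp)

theorem toFun_algebraMap (c : k) (u : SymOrbit i) :
    toFun k i (algebraMap k _ c) u = algebraMap k _ c := by
  rw [toFun_apply, AlgHom.commutes, LocalRing.val_algebraMap]

theorem act_algebraMap (σ : Equiv.Perm (Fin (m + 1))) (c : k) :
    act σ (algebraMap k (OrbitCoef k i) c) = algebraMap k _ c :=
  act_eq (OrbitFun.ext fun u => by
    rw [OrbitFun.smul_apply, toFun_algebraMap, toFun_algebraMap, RatField.perm_const])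

theorem act_x (σ : Equiv.Perm (Fin (m + 1))) (j : Fin (m + 1)) :
    act σ (x k i j) = x k i (σ j) :=
  act_eq (OrbitFun.ext fun u => by
    rw [OrbitFun.smul_apply, toFun_x, toFun_x, RatField.perm_x])

/-- In general the indicator function moves by the inverse permutation; for an involution the
distinction disappears. -/
theorem act_idem {σ : Equiv.Perm (Fin (m + 1))} (hσ : σ * σ = 1) (u : SymOrbit i) :
    act σ (idem k u) = idem k (u.permute σ) := by
  have h : ∀ v : SymOrbit i, (v.permute σ).permute σ = v := fun v =>
    Subtype.ext (by
      change v.1 ∘ ⇑(σ * σ) = v.1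
      rw [hσ]; rfl)
  refine act_eq (OrbitFun.ext fun v => ?_)
  rw [OrbitFun.smul_apply, toFun_idem, toFun_idem]
  by_cases hv : v = u.permute σ
  · subst hv; simp [h]
  · rw [if_neg hv, if_neg (fun h' => hv (by rw [← h', h])), map_zero]

end OrbitCoef

open OrbitCoef

/-! ### Demazure elements of an algebra and checking identities on rational functions -/

section Demazure

variable {k : Type*} [Field k] {m e : ℕ} {i : Fin (m + 1) → ZMod e}
  {B : Type*} [Ring B] [Algebra k B] {ι : OrbitCoef k i →ₐ[k] B}
  {κ β : ZMod e → ZMod e → RatField k (m + 1) → RatField k (m + 1) → RatField k (m + 1)}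
  {a b c : Fin (m + 1)} {θ : B}

theorem OrbitFun.op_mul_single (F : OrbitFun k i) :
    OrbitFun.op i κ β a b * single 1 F = single 1 (Equiv.swap a b • F) * OrbitFun.op i κ β a b +
      single 1 (OrbitFun.two β a b * (F - Equiv.swap a b • F)) := by
  simp only [OrbitFun.op, mul_add, add_mul, single_mul_single, one_smul, one_mul, mul_one,
    sub_eq_add_neg, mul_neg, single_add, single_neg]
  rw [mul_comm (OrbitFun.two κ a b), mul_comm (OrbitFun.two β a b) (Equiv.swap a b • F)]
  abel

variable (ι β a b θ) in
/-- The commutation rule of a Demazure operator with a coefficient. -/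
def CommRule (F : OrbitCoef k i) : Prop :=
  ∃ F₂, toFun k i F₂ =
      OrbitFun.two β a b * (toFun k i F - Equiv.swap a b • toFun k i F) ∧
    θ * ι F = ι (act (Equiv.swap a b) F) * θ + ι F₂

theorem CommRule.add {F G : OrbitCoef k i} (hF : CommRule ι β a b θ F)
    (hG : CommRule ι β a b θ G) : CommRule ι β a b θ (F + G) := by
  obtain ⟨F₂, h1, h2⟩ := hF
  obtain ⟨G₂, h3, h4⟩ := hG
  refine ⟨F₂ + G₂, ?_, ?_⟩
  · rw [map_add, map_add, h1, h3, smul_add]; ring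
  · rw [map_add, mul_add, h2, h4, act_add, map_add, map_add]; noncomm_ring

/-- The twisted Leibniz rule `Δ(FG) = s(F) Δ(G) + Δ(F) G` for `Δ = β (1 - s)`. -/
theorem CommRule.mul {F G : OrbitCoef k i} (hF : CommRule ι β a b θ F)
    (hG : CommRule ι β a b θ G) : CommRule ι β a b θ (F * G) := by
  obtain ⟨F₂, h1, h2⟩ := hF
  obtain ⟨G₂, h3, h4⟩ := hG
  refine ⟨act (Equiv.swap a b) F * G₂ + F₂ * G, ?_, ?_⟩
  · rw [map_add, map_mul, map_mul, map_mul, toFun_act, h1, h3, smul_mul']; ring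
  · rw [map_mul, ← mul_assoc, h2, add_mul, mul_assoc, h4, act_mul, map_mul, map_add, map_mul,
      map_mul]
    noncomm_ring

/-- The twisted quotient rule `Δ(F⁻¹) = -s(F)⁻¹ Δ(F) F⁻¹`. -/
theorem CommRule.of_mul_eq_one {F G : OrbitCoef k i} (hF : CommRule ι β a b θ F)
    (hFG : F * G = 1) : CommRule ι β a b θ G := by
  obtain ⟨F₂, h1, h2⟩ := hF
  have hs : act (Equiv.swap a b) G * act (Equiv.swap a b) F = 1 := by
    rw [← act_mul, mul_comm, hFG, act_one]
  refine ⟨-(act (Equiv.swap a b) G * F₂ * G), ?_, ?_⟩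
  · have h3 := congrArg (toFun k i) hFG
    have h4 := congrArg (toFun k i) hs
    rw [map_mul, map_one] at h3 h4
    rw [toFun_act, toFun_act] at h4
    rw [map_neg, map_mul, map_mul, toFun_act, h1]
    linear_combination (-(OrbitFun.two β a b) * Equiv.swap a b • toFun k i G) * h3 +
      OrbitFun.two β a b * toFun k i G * h4
  · have h5 : ι (act (Equiv.swap a b) G) * (θ * ι F) * ι G =
        ι (act (Equiv.swap a b) G) * θ := by
      rw [← mul_assoc, mul_assoc _ (ι F), ← map_mul, hFG, map_one, mul_one]
    rw [← h5, h2, mul_add, add_mul, ← mul_assoc, ← map_mul, hs, map_one, one_mul, map_neg, map_mul,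
      map_mul]
    noncomm_ring

theorem CommRule.scalar (c : k) : CommRule ι β a b θ (algebraMap k _ c) := by
  refine ⟨0, ?_, ?_⟩
  · rw [← toFun_act, act_algebraMap, sub_self, mul_zero, map_zero]
  · rw [act_algebraMap, map_zero, add_zero, AlgHom.commutes, Algebra.commutes]

/-- Since `β` may have a pole, it is not clear a priori that `β (F - s F)` is regular. The closure
properties of the rule produce this coefficient along with the relation, and every element of the
local ring is a polynomial times the inverse of a polynomial. -/
theorem CommRule.of_generators (hx : ∀ j, CommRule ι β a b θ (x k i j))
    (he : ∀ u, CommRule ι β a b θ (idem k u)) (F : OrbitCoef k i) : CommRule ι β a b θ F := by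
  have hp : ∀ p, CommRule ι β a b θ (const k i (LocalRing.poly k _ p)) := by
    intro p
    induction p using MvPolynomial.induction_on with
    | C c =>
      have : const k i (LocalRing.poly k _ (MvPolynomial.C c)) = algebraMap k _ c := by
        rw [← MvPolynomial.algebraMap_eq, AlgHom.commutes, AlgHom.commutes]
      rw [this]
      exact .scalar c
    | add p q hp hq => rw [map_add, map_add]; exact hp.add hq
    | mul_X p j hp => rw [map_mul, map_mul]; exact hp.mul (hx j)
  have hc : ∀ f, CommRule ι β a b θ (const k i f) := by
    intro f
    obtain ⟨p, s, hs, h⟩ := LocalRing.exists_mul_eq_poly f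
    obtain ⟨w, hw⟩ := (LocalRing.isUnit_poly hs).exists_right_inv
    have : f = LocalRing.poly k _ p * w := by rw [← h, mul_assoc, hw, mul_one]
    rw [this, map_mul]
    exact (hp p).mul ((hp s).of_mul_eq_one (by rw [← map_mul, hw, map_one]))
  rw [eq_sum F]
  have : ∀ s : Finset (SymOrbit i),
      CommRule ι β a b θ (∑ u ∈ s, const k i (eval k i u F) * idem k u) := by
    intro s
    induction s using Finset.cons_induction with
    | empty => simpa using CommRule.scalar (0 : k)
    | cons u s hu ih => rw [Finset.sum_cons]; exact ((hc _).mul (he u)).add ih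
  exact this _

theorem CommRule.commute {F : OrbitCoef k i} (h : CommRule ι β a b θ F)
    (hF : act (Equiv.swap a b) F = F) : θ * ι F = ι F * θ := by
  obtain ⟨F₂, h1, h2⟩ := h
  rw [← toFun_act, hF, sub_self, mul_zero] at h1
  rw [h2, hF, toFun_injective (h1.trans (map_zero _).symm), map_zero, add_zero]

variable (ι κ β a b θ) in
/-- An element of `B` which satisfies the same quadratic and commutation relations as the
operator `κ s + β`. -/
structure IsDemazure : Prop where
  comm : ∀ F, CommRule ι β a b θ F
  sq : ∃ F G : OrbitCoef k i, θ * θ = ι F * θ + ι G ∧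
    OrbitFun.op i κ β a b * OrbitFun.op i κ β a b =
      single 1 (toFun k i F) * OrbitFun.op i κ β a b + single 1 (toFun k i G)

variable (k i) in
/-- Coefficients in the skew group ring. -/
def skewCoef : OrbitCoef k i →+* SkewMonoidAlgebra (OrbitFun k i) (Equiv.Perm (Fin (m + 1))) :=
  RingHom.comp
    { toFun := single 1
      map_one' := rfl
      map_mul' := fun F G => by rw [single_mul_single, one_smul, one_mul]
      map_zero' := single_zero 1
      map_add' := single_add 1 } (toFun k i)

variable (ι) in
/-- Coefficients in the product of `B` and the skew group ring. -/
def pairCoef : OrbitCoef k i →+*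
    B × SkewMonoidAlgebra (OrbitFun k i) (Equiv.Perm (Fin (m + 1))) :=
  ι.toRingHom.prod (skewCoef k i)

variable (κ β a b θ) in
/-- A Demazure element together with the operator on rational functions. -/
def pairOp : B × SkewMonoidAlgebra (OrbitFun k i) (Equiv.Perm (Fin (m + 1))) :=
  (θ, OrbitFun.op i κ β a b)

variable (ι κ β a b θ) in
/-- The ring generated by coefficients and one Demazure operator. -/
def rankOne : Subring (B × SkewMonoidAlgebra (OrbitFun k i) (Equiv.Perm (Fin (m + 1)))) :=
  Subring.closure (Set.range (pairCoef ι) ∪ {pairOp κ β a b θ})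

variable (ι κ β a b c θ) in
/-- The ring generated by coefficients and two Demazure operators. -/
def rankTwo (θ' : B) :
    Subring (B × SkewMonoidAlgebra (OrbitFun k i) (Equiv.Perm (Fin (m + 1)))) :=
  Subring.closure (Set.range (pairCoef ι) ∪ {pairOp κ β a b θ, pairOp κ β b c θ'})

theorem pairCoef_mem_rankOne (F : OrbitCoef k i) : pairCoef ι F ∈ rankOne ι κ β a b θ :=
  Subring.subset_closure (Or.inl ⟨F, rfl⟩)

theorem pairOp_mem_rankOne : pairOp κ β a b θ ∈ rankOne ι κ β a b θ :=
  Subring.subset_closure (Or.inr rfl)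

theorem pairCoef_mem_rankTwo {θ' : B} (F : OrbitCoef k i) :
    pairCoef ι F ∈ rankTwo ι κ β a b c θ θ' :=
  Subring.subset_closure (Or.inl ⟨F, rfl⟩)

theorem pairOp_mem_rankTwo_left {θ' : B} : pairOp κ β a b θ ∈ rankTwo ι κ β a b c θ θ' :=
  Subring.subset_closure (Or.inr (Or.inl rfl))

theorem pairOp_mem_rankTwo_right {θ' : B} : pairOp κ β b c θ' ∈ rankTwo ι κ β a b c θ θ' :=
  Subring.subset_closure (Or.inr (Or.inr rfl))

theorem IsDemazure.pair_comm (h : IsDemazure ι κ β a b θ) (F : OrbitCoef k i) :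
    ∃ F₁ F₂, pairOp κ β a b θ * pairCoef ι F =
      pairCoef ι F₁ * pairOp κ β a b θ + pairCoef ι F₂ := by
  obtain ⟨F₂, h1, h2⟩ := h.comm F
  refine ⟨act (Equiv.swap a b) F, F₂, Prod.ext h2 ?_⟩
  change OrbitFun.op i κ β a b * single 1 (toFun k i F) = single 1 (toFun k i _) * _ +
    single 1 (toFun k i F₂)
  rw [h1, OrbitFun.op_mul_single, toFun_act]
  rfl

theorem IsDemazure.pair_sq (h : IsDemazure ι κ β a b θ) :
    ∃ F G, pairOp κ β a b θ * pairOp κ β a b θ =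
      pairCoef ι F * pairOp κ β a b θ + pairCoef ι G := by
  obtain ⟨F, G, h1, h2⟩ := h.sq
  exact ⟨F, G, Prod.ext h1 h2⟩

/-- Identities in rank one may be checked on rational functions. -/
theorem IsDemazure.eq_of_rankOne (h : IsDemazure ι κ β a b θ) (hab : a ≠ b)
    (hκ : OrbitFun.two κ a b ∈ nonZeroDivisors (OrbitFun k i))
    {y z : B × SkewMonoidAlgebra (OrbitFun k i) (Equiv.Perm (Fin (m + 1)))}
    (hy : y ∈ rankOne ι κ β a b θ) (hz : z ∈ rankOne ι κ β a b θ) (hyz : y.2 = z.2) :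
    y.1 = z.1 :=
  -- The injective map is the second projection of the ring of pairs, so no homomorphism between `B`
  -- and the skew group ring is required.
  congrArg Prod.fst (injOn_closure_one (ι := pairCoef ι) (ρ := RingHom.snd _ _) (j := toFun k i)
    (fun h => hab (Equiv.swap_eq_one_iff.1 h)) toFun_injective
    (fun _ => rfl) hκ rfl h.pair_comm h.pair_sq hy hz hyz)

/-- Identities in rank two may be checked on rational functions. -/
theorem IsDemazure.eq_of_rankTwo {θ' : B} (h : IsDemazure ι κ β a b θ)
    (h' : IsDemazure ι κ β b c θ') (hab : a ≠ b) (hbc : b ≠ c) (hac : a ≠ c)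
    (hκ : OrbitFun.two κ a b ∈ nonZeroDivisors (OrbitFun k i))
    (hκ' : OrbitFun.two κ b c ∈ nonZeroDivisors (OrbitFun k i))
    (hbr : ∃ F : OrbitCoef k i, θ * θ' * θ = θ' * θ * θ' + ι F ∧
      OrbitFun.op i κ β a b * OrbitFun.op i κ β b c * OrbitFun.op i κ β a b =
        OrbitFun.op i κ β b c * OrbitFun.op i κ β a b * OrbitFun.op i κ β b c +
          single 1 (toFun k i F))
    {y z : B × SkewMonoidAlgebra (OrbitFun k i) (Equiv.Perm (Fin (m + 1)))}
    (hy : y ∈ rankTwo ι κ β a b c θ θ') (hz : z ∈ rankTwo ι κ β a b c θ θ') (hyz : y.2 = z.2) :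
    y.1 = z.1 := by
  refine congrArg Prod.fst (injOn_closure_two (ι := pairCoef ι) (ρ := RingHom.snd _ _)
    (j := toFun k i) (s := Equiv.swap a b) (t := Equiv.swap b c)
    (fun h => hab (Equiv.swap_eq_one_iff.1 h)) (fun h => hbc (Equiv.swap_eq_one_iff.1 h))
    (fun h => ?_) (Equiv.swap_mul_self _ _) (Equiv.swap_mul_self _ _) (fun h => ?_)
    toFun_injective (fun _ => rfl) hκ hκ' rfl rfl h.pair_comm h'.pair_comm h.pair_sq
    h'.pair_sq ?_ hy hz hyz)
  · have := congrArg (fun σ => σ a) h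
    simp [Equiv.swap_apply_of_ne_of_ne hab hac, hab.symm] at this
  · have := congrArg (fun σ => σ a) h
    simp [Equiv.swap_apply_of_ne_of_ne hab hac, hbc] at this
  · obtain ⟨F, h1, h2⟩ := hbr
    exact ⟨F, Prod.ext h1 h2⟩

end Demazure

end

noncomputable section

open SkewMonoidAlgebra OrbitCoef RatField

/-! ### From the quiver Hecke algebra to the Hecke algebra and back -/

namespace OrbitCoef

section

variable {k : Type*} [Field k] {m e : ℕ} {i : Fin (m + 1) → ZMod e}

variable (k i) in
/-- The coefficient `ψ²`. -/
def psiSq (a b : Fin (m + 1)) : OrbitCoef k i := mk (OrbitFun.two OrbitFun.psiSq a b) fun u => by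
  rw [OrbitFun.two_apply, OrbitFun.psiSq]
  split_ifs
  · exact ⟨_, Reg.zero⟩
  · exact ⟨_, ((Reg.x a).sub (Reg.x b)).mul ((Reg.x b).sub (Reg.x a))⟩
  · exact ⟨_, ((Reg.x a).sub (Reg.x b)).mul Reg.one⟩
  · exact ⟨_, Reg.one.mul ((Reg.x b).sub (Reg.x a))⟩
  · exact ⟨_, Reg.one.mul Reg.one⟩

variable (k i) in
/-- The error term in the braid relation. -/
def err (a b c : Fin (m + 1)) : OrbitCoef k i := mk (OrbitFun.err a b c) fun u => by
  rw [OrbitFun.err, OrbitFun.psiErr]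
  split_ifs
  · have h2 : (2 : RatField k (m + 1)) = algebraMap k _ 2 := (map_ofNat _ 2).symm
    rw [h2]
    exact ⟨_, ((Reg.x a).add (Reg.x c)).sub ((Reg.const 2).mul (Reg.x b))⟩
  · exact ⟨_, Reg.one⟩
  · exact ⟨_, Reg.one.neg⟩
  · exact ⟨_, Reg.zero⟩
  · exact ⟨_, Reg.zero⟩

theorem toFun_psiSq (a b : Fin (m + 1)) :
    toFun k i (psiSq k i a b) = OrbitFun.two OrbitFun.psiSq a b := rfl

theorem toFun_err (a b c : Fin (m + 1)) : toFun k i (err k i a b c) = OrbitFun.err a b c := rfl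

end

section

variable {k : Type*} [Field k] {q : k} {m : ℕ} {i : Fin (m + 1) → ZMod (orderOf q)}

theorem _root_.OrbitFun.equivariant_ampl_inv : OrbitFun.Equivariant (k := k) (m := m)
    (fun p s y z => (OrbitFun.ampl (q := q) p s y z)⁻¹) := by
  intro σ p s y z
  rw [map_inv₀, OrbitFun.equivariant_ampl]

/-- The left coefficient of `ψ` in the intertwiner. -/
def ampl (hq : q ≠ 0) (hq1 : q ≠ 1) (a b : Fin (m + 1)) : OrbitCoef k i :=
  mk (OrbitFun.two OrbitFun.ampl a b) fun u => by
    obtain ⟨c, -, h⟩ := OrbitFun.reg_ampl hq hq1 (u.1 a) (u.1 b) a b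
    exact ⟨c, h⟩

/-- The inverse of the left coefficient of `ψ` in the intertwiner. -/
def amplInv (hq : q ≠ 0) (hq1 : q ≠ 1) (a b : Fin (m + 1)) : OrbitCoef k i :=
  mk (OrbitFun.two (fun p s y z => (OrbitFun.ampl p s y z)⁻¹) a b) fun u => by
    obtain ⟨c, hc, h⟩ := OrbitFun.reg_ampl hq hq1 (u.1 a) (u.1 b) a b
    exact ⟨_, h.inv hc⟩

/-- The difference between the intertwiner and `T`. -/
def shift (hq : q ≠ 0) (a b : Fin (m + 1)) : OrbitCoef k i :=
  mk (OrbitFun.two OrbitFun.shift a b) fun _ => OrbitFun.reg_shift hq _ _ _ _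

theorem ampl_mul_amplInv (hq : q ≠ 0) (hq1 : q ≠ 1) (a b : Fin (m + 1)) :
    ampl hq hq1 a b * amplInv hq hq1 a b = (1 : OrbitCoef k i) :=
  toFun_injective (OrbitFun.ext fun u => by
    obtain ⟨c, hc, h⟩ := OrbitFun.reg_ampl hq hq1 (u.1 a) (u.1 b) a b
    rw [map_mul, map_one]
    exact mul_inv_cancel₀ (h.ne_zero hc))

theorem amplInv_mul_ampl (hq : q ≠ 0) (hq1 : q ≠ 1) (a b : Fin (m + 1)) :
    amplInv hq hq1 a b * ampl hq hq1 a b = (1 : OrbitCoef k i) := by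
  rw [mul_comm, ampl_mul_amplInv]

variable (i) in
/-- The variable `X_j`. -/
def X (j : Fin (m + 1)) : OrbitCoef k i :=
  mk (fun u => OrbitFun.toX (u.1 j) (RatField.x j)) fun _ => ⟨_, OrbitFun.reg_toX _ _⟩

theorem toFun_X (j : Fin (m + 1)) (u : SymOrbit i) :
    toFun k i (X i j) u = OrbitFun.toX (u.1 j) (RatField.x j) := rfl

theorem act_X (σ : Equiv.Perm (Fin (m + 1))) (j : Fin (m + 1)) :
    act σ (X i j) = X i (σ j) :=
  act_eq (OrbitFun.ext fun u => by
    rw [OrbitFun.smul_apply, toFun_X, toFun_X, OrbitFun.perm_toX, RatField.perm_x]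
    rfl)

end

theorem act_of_two {k : Type*} [Field k] {m e : ℕ} {i : Fin (m + 1) → ZMod e}
    {φ : ZMod e → ZMod e → RatField k (m + 1) → RatField k (m + 1) → RatField k (m + 1)}
    (hφ : OrbitFun.Equivariant φ) {a b c d : Fin (m + 1)} (h : ∀ u, ∃ c, Reg (OrbitFun.two (i := i)
      φ a b u) c) (hac : a ≠ c) (had : a ≠ d) (hbc : b ≠ c) (hbd : b ≠ d) :
    act (Equiv.swap c d) (mk _ h) = mk _ h :=
  act_eq (by
    rw [toFun_mk, OrbitFun.smul_two hφ, Equiv.swap_apply_of_ne_of_ne hac had,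
      Equiv.swap_apply_of_ne_of_ne hbc hbd])

end OrbitCoef

section Systems

/-- Elements of `B` which satisfy the relations of the generators `ψ_r` of the quiver Hecke
algebra. -/
structure PsiSystem {k : Type*} [Field k] {m e : ℕ} {i : Fin (m + 1) → ZMod e} {B : Type*} [Ring B]
    [Algebra k B] (ι : OrbitCoef k i →ₐ[k] B) (ψ : Fin m → B) : Prop where
  comm : ∀ r F, CommRule ι OrbitFun.psiTail r.castSucc r.succ (ψ r) F
  sq : ∀ r, ψ r * ψ r = ι (OrbitCoef.psiSq k i r.castSucc r.succ)
  braid : ∀ r s : Fin m, s.val = r.val + 1 → ψ r * ψ s * ψ r =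
    ψ s * ψ r * ψ s + ι (OrbitCoef.err k i r.castSucc r.succ s.succ)
  far : ∀ r s : Fin m, r.val + 1 < s.val → ψ r * ψ s = ψ s * ψ r

/-- Elements of `B` which satisfy the relations of the generators `T_r` of the Hecke algebra. -/
structure HeckeSystem {k : Type*} [Field k] {q : k} {m : ℕ} {i : Fin (m + 1) → ZMod (orderOf q)}
    {B : Type*} [Ring B] [Algebra k B] (ι : OrbitCoef k i →ₐ[k] B) (T : Fin m → B) : Prop where
  comm : ∀ r F, CommRule ι OrbitFun.heckeTail r.castSucc r.succ (T r) F
  sq : ∀ r, T r * T r = algebraMap k B (q - 1) * T r + algebraMap k B q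
  braid : ∀ r s : Fin m, s.val = r.val + 1 → T r * T s * T r = T s * T r * T s
  far : ∀ r s : Fin m, r.val + 1 < s.val → T r * T s = T s * T r

section

variable {k : Type*} [Field k] {m e : ℕ} {i : Fin (m + 1) → ZMod e} {B : Type*} [Ring B]
    [Algebra k B] {ι : OrbitCoef k i →ₐ[k] B}
  {κ β κ' β' : ZMod e → ZMod e → RatField k (m + 1) → RatField k (m + 1) → RatField k (m + 1)}
  {a b : Fin (m + 1)} {θ θ' : B}

/-- The rule for `β'` holds for the operator `κ' s + β'`, hence for any `θ'` paired with it inside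
the rank one ring. This passes the commutation rule from `ψ` to `T` and back. -/
theorem IsDemazure.comm_of_mem (h : IsDemazure ι κ β a b θ) (hab : a ≠ b)
    (hκ : OrbitFun.two κ a b ∈ nonZeroDivisors (OrbitFun k i))
    (hθ' : (θ', OrbitFun.op i κ' β' a b) ∈ rankOne ι κ β a b θ) {F F₂ : OrbitCoef k i}
    (hF : toFun k i F₂ = OrbitFun.two β' a b * (toFun k i F - Equiv.swap a b • toFun k i F)) :
    θ' * ι F = ι (act (Equiv.swap a b) F) * θ' + ι F₂ := by
  refine h.eq_of_rankOne hab hκ (y := (θ', OrbitFun.op i κ' β' a b) * pairCoef ι F)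
    (z := pairCoef ι (act (Equiv.swap a b) F) * (θ', OrbitFun.op i κ' β' a b) + pairCoef ι F₂)
    (mul_mem hθ' (pairCoef_mem_rankOne _))
    (add_mem (mul_mem (pairCoef_mem_rankOne _) hθ') (pairCoef_mem_rankOne _)) ?_
  change OrbitFun.op i κ' β' a b * single 1 (toFun k i F) = single 1 (toFun k i _) * _ +
    single 1 (toFun k i F₂)
  rw [hF, OrbitFun.op_mul_single, toFun_act]

theorem PsiSystem.isDemazure {ψ : Fin m → B} (h : PsiSystem ι ψ) (r : Fin m) :
    IsDemazure ι OrbitFun.psiLead OrbitFun.psiTail r.castSucc r.succ (ψ r) where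
  comm := h.comm r
  sq := ⟨0, OrbitCoef.psiSq k i _ _, by rw [map_zero, zero_mul, zero_add]; exact h.sq r, by
    rw [map_zero (toFun k i), single_zero, zero_mul, zero_add]; exact OrbitFun.psiOp_mul_self _ _⟩

end

theorem Fin.castSucc_ne_succ' {m : ℕ} (r : Fin m) : r.castSucc ≠ r.succ := by
  simp [Fin.ext_iff]

variable {k : Type*} [Field k] {q : k} {m : ℕ} {i : Fin (m + 1) → ZMod (orderOf q)}
    {B : Type*} [Ring B] [Algebra k B] {ι : OrbitCoef k i →ₐ[k] B}

theorem OrbitFun.two_heckeLead_mem (hq : q ≠ 0) (hq1 : q ≠ 1) {a b : Fin (m + 1)} (h : a ≠ b) :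
    two (i := i) heckeLead a b ∈ nonZeroDivisors (OrbitFun k i) := by
  refine mem_nonZeroDivisors fun u => ?_
  rw [two_apply, heckeLead_eq hq _ _ h]
  obtain ⟨c, hc, hr⟩ := reg_ampl hq hq1 (u.1 a) (u.1 b) a b
  refine mul_ne_zero (hr.ne_zero hc) ?_
  rw [psiLead]
  split_ifs
  · exact neg_ne_zero.2 (inv_ne_zero (x_sub_x_ne_zero h.symm))
  · exact x_sub_x_ne_zero h
  · exact one_ne_zero

theorem OrbitFun.heckeOp_eq (hq : q ≠ 0) {a b : Fin (m + 1)} (hab : a ≠ b) :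
    single 1 (two (i := i) (k := k) ampl a b) * psiOp k i a b - single 1 (two shift a b) =
      heckeOp q i a b := by
  rw [psiOp, op, mul_add, single_mul_single, single_mul_single, one_smul, one_smul, one_mul, one_mul,
    add_sub_assoc, sub_eq_add_neg (single _ _), ← single_neg, ← single_add, heckeOp, op]
  congr 2 <;> ext u
  · exact (heckeLead_eq hq _ _ hab).symm
  · exact ((heckeTail_eq hq _ _ hab).trans (sub_eq_add_neg _ _)).symm

theorem OrbitFun.psiOp_eq (hq : q ≠ 0) (hq1 : q ≠ 1) {a b : Fin (m + 1)} (hab : a ≠ b) :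
    single 1 (two (i := i) (k := k) (fun p s y z => (ampl p s y z)⁻¹) a b) *
      (heckeOp q i a b + single 1 (two shift a b)) = psiOp k i a b := by
  rw [← heckeOp_eq hq hab, sub_add_cancel, ← mul_assoc, single_mul_single, one_smul, one_mul]
  have : two (i := i) (k := k) (fun p s y z => (ampl p s y z)⁻¹) a b * two ampl a b = 1 := by
    ext u
    obtain ⟨c, hc, hr⟩ := reg_ampl hq hq1 (u.1 a) (u.1 b) a b
    exact inv_mul_cancel₀ (hr.ne_zero hc)
  rw [this, single_one_one, one_mul]

theorem toFun_algebraMap_eq (c : k) :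
    toFun k i (algebraMap k _ c) = OrbitFun.const i c :=
  OrbitFun.ext fun u => toFun_algebraMap c u

theorem HeckeSystem.isDemazure {T : Fin m → B} (hq : q ≠ 0) (h : HeckeSystem ι T) (r : Fin m) :
    IsDemazure ι OrbitFun.heckeLead OrbitFun.heckeTail r.castSucc r.succ (T r) where
  comm := h.comm r
  sq := ⟨algebraMap k _ (q - 1), algebraMap k _ q, by
    rw [AlgHom.commutes, AlgHom.commutes]; exact h.sq r, by
    rw [toFun_algebraMap_eq, toFun_algebraMap_eq]
    exact OrbitFun.heckeOp_mul_self hq r.castSucc_ne_succ'⟩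

variable (ι) in
/-- The elements `T_r` constructed from `ψ_r`. -/
def heckeOfPsi (hq : q ≠ 0) (hq1 : q ≠ 1) (ψ : Fin m → B) (r : Fin m) : B :=
  ι (OrbitCoef.ampl hq hq1 r.castSucc r.succ) * ψ r - ι (OrbitCoef.shift hq r.castSucc r.succ)

variable (ι) in
/-- The elements `ψ_r` constructed from `T_r`. -/
def psiOfHecke (hq : q ≠ 0) (hq1 : q ≠ 1) (T : Fin m → B) (r : Fin m) : B :=
  ι (OrbitCoef.amplInv hq hq1 r.castSucc r.succ) *
    (T r + ι (OrbitCoef.shift hq r.castSucc r.succ))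

theorem pair_heckeOfPsi (hq : q ≠ 0) (hq1 : q ≠ 1) (ψ : Fin m → B) (r : Fin m) :
    (heckeOfPsi ι hq hq1 ψ r, OrbitFun.heckeOp q i r.castSucc r.succ) =
      pairCoef ι (OrbitCoef.ampl hq hq1 r.castSucc r.succ) *
        pairOp OrbitFun.psiLead OrbitFun.psiTail r.castSucc r.succ (ψ r) -
        pairCoef ι (OrbitCoef.shift hq r.castSucc r.succ) :=
  Prod.ext rfl (OrbitFun.heckeOp_eq hq r.castSucc_ne_succ').symm

theorem pair_psiOfHecke (hq : q ≠ 0) (hq1 : q ≠ 1) (T : Fin m → B) (r : Fin m) :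
    (psiOfHecke ι hq hq1 T r, OrbitFun.psiOp k i r.castSucc r.succ) =
      pairCoef ι (OrbitCoef.amplInv hq hq1 r.castSucc r.succ) *
        (pairOp OrbitFun.heckeLead OrbitFun.heckeTail r.castSucc r.succ (T r) +
        pairCoef ι (OrbitCoef.shift hq r.castSucc r.succ)) :=
  Prod.ext rfl (OrbitFun.psiOp_eq hq hq1 r.castSucc_ne_succ').symm

section FromPsi

variable {ψ : Fin m → B}

theorem pair_heckeOfPsi_mem (hq : q ≠ 0) (hq1 : q ≠ 1) (r : Fin m) :
    (heckeOfPsi ι hq hq1 ψ r, OrbitFun.heckeOp q i r.castSucc r.succ) ∈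
      rankOne ι OrbitFun.psiLead OrbitFun.psiTail r.castSucc r.succ (ψ r) := by
  rw [pair_heckeOfPsi]
  exact sub_mem (mul_mem (pairCoef_mem_rankOne _) pairOp_mem_rankOne) (pairCoef_mem_rankOne _)

theorem PsiSystem.hecke_comm (hq : q ≠ 0) (hq1 : q ≠ 1) (h : PsiSystem ι ψ) (r : Fin m)
    {F F₂ : OrbitCoef k i} (hF : toFun k i F₂ = OrbitFun.two OrbitFun.heckeTail r.castSucc r.succ *
      (toFun k i F - Equiv.swap r.castSucc r.succ • toFun k i F)) :
    heckeOfPsi ι hq hq1 ψ r * ι F =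
      ι (act (Equiv.swap r.castSucc r.succ) F) * heckeOfPsi ι hq hq1 ψ r + ι F₂ :=
  (h.isDemazure r).comm_of_mem r.castSucc_ne_succ'
    (OrbitFun.two_psiLead_mem r.castSucc_ne_succ') (pair_heckeOfPsi_mem hq hq1 r) hF

theorem PsiSystem.hecke_sq (hq : q ≠ 0) (hq1 : q ≠ 1) (h : PsiSystem ι ψ) (r : Fin m) :
    heckeOfPsi ι hq hq1 ψ r * heckeOfPsi ι hq hq1 ψ r =
      algebraMap k B (q - 1) * heckeOfPsi ι hq hq1 ψ r + algebraMap k B q := by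
  have hmem := pair_heckeOfPsi_mem (ι := ι) (ψ := ψ) hq hq1 r
  have := (h.isDemazure r).eq_of_rankOne r.castSucc_ne_succ'
    (OrbitFun.two_psiLead_mem r.castSucc_ne_succ') (mul_mem hmem hmem)
    (add_mem (mul_mem (pairCoef_mem_rankOne (algebraMap k _ (q - 1))) hmem)
      (pairCoef_mem_rankOne (algebraMap k _ q))) (by
      change _ = single 1 (toFun k i _) * _ + single 1 (toFun k i _)
      rw [toFun_algebraMap_eq, toFun_algebraMap_eq]
      exact OrbitFun.heckeOp_mul_self hq r.castSucc_ne_succ')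
  change _ = ι _ * _ + ι _ at this
  rwa [AlgHom.commutes, AlgHom.commutes] at this

/-- Both sides, paired with operators, lie in the ring generated by two neighbouring `ψ`, and the
operators satisfy the relation by `OrbitFun.heckeOp_braid`. -/
theorem PsiSystem.hecke_braid (hq : q ≠ 0) (hq1 : q ≠ 1) (h : PsiSystem ι ψ) (r s : Fin m)
    (hs : s.val = r.val + 1) :
    heckeOfPsi ι hq hq1 ψ r * heckeOfPsi ι hq hq1 ψ s * heckeOfPsi ι hq hq1 ψ r =
      heckeOfPsi ι hq hq1 ψ s * heckeOfPsi ι hq hq1 ψ r * heckeOfPsi ι hq hq1 ψ s := by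
  have hrs : s.castSucc = r.succ := Fin.ext (by simpa using hs)
  have h1 := h.isDemazure r
  have h2 := h.isDemazure s
  have p1 := pair_heckeOfPsi (ι := ι) hq hq1 ψ r
  have p2 := pair_heckeOfPsi (ι := ι) hq hq1 ψ s
  have hb := h.braid r s hs
  have n1 := r.castSucc_ne_succ'
  have n2 := s.castSucc_ne_succ'
  have n3 : r.castSucc ≠ s.succ := by simp [Fin.ext_iff, hs]; omega
  rw [hrs] at h2 p2 n2
  have m1 : (heckeOfPsi ι hq hq1 ψ r, OrbitFun.heckeOp q i r.castSucc r.succ) ∈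
      rankTwo ι OrbitFun.psiLead OrbitFun.psiTail r.castSucc r.succ s.succ (ψ r) (ψ s) := by
    rw [p1]
    exact sub_mem (mul_mem (pairCoef_mem_rankTwo _) pairOp_mem_rankTwo_left)
      (pairCoef_mem_rankTwo _)
  have m2 : (heckeOfPsi ι hq hq1 ψ s, OrbitFun.heckeOp q i r.succ s.succ) ∈
      rankTwo ι OrbitFun.psiLead OrbitFun.psiTail r.castSucc r.succ s.succ (ψ r) (ψ s) := by
    rw [p2]
    exact sub_mem (mul_mem (pairCoef_mem_rankTwo _) pairOp_mem_rankTwo_right)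
      (pairCoef_mem_rankTwo _)
  exact h1.eq_of_rankTwo h2 n1 n2 n3 (OrbitFun.two_psiLead_mem n1) (OrbitFun.two_psiLead_mem n2)
    ⟨_, hb, OrbitFun.psiOp_braid n1 n2 n3⟩ (mul_mem (mul_mem m1 m2) m1)
    (mul_mem (mul_mem m2 m1) m2) (OrbitFun.heckeOp_braid hq n1 n2 n3)

/-- The coefficients attached to one pair of positions are fixed by the transposition of a disjoint
pair, so all factors commute and no transfer is needed. -/
theorem PsiSystem.hecke_far (hq : q ≠ 0) (hq1 : q ≠ 1) (h : PsiSystem ι ψ) (r s : Fin m)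
    (hs : r.val + 1 < s.val) :
    heckeOfPsi ι hq hq1 ψ r * heckeOfPsi ι hq hq1 ψ s =
      heckeOfPsi ι hq hq1 ψ s * heckeOfPsi ι hq hq1 ψ r := by
  have n1 : r.castSucc ≠ s.castSucc := by simp [Fin.ext_iff]; omega
  have n2 : r.castSucc ≠ s.succ := by simp [Fin.ext_iff]; omega
  have n3 : r.succ ≠ s.castSucc := by simp [Fin.ext_iff]; omega
  have n4 : r.succ ≠ s.succ := by simp [Fin.ext_iff]; omega
  have c1 : Commute (ψ s) (ι (OrbitCoef.ampl hq hq1 r.castSucc r.succ)) :=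
    (h.comm s _).commute (act_of_two OrbitFun.equivariant_ampl _ n1 n2 n3 n4)
  have c2 : Commute (ψ s) (ι (OrbitCoef.shift hq r.castSucc r.succ)) :=
    (h.comm s _).commute (act_of_two OrbitFun.equivariant_shift _ n1 n2 n3 n4)
  have c3 : Commute (ψ r) (ι (OrbitCoef.ampl hq hq1 s.castSucc s.succ)) :=
    (h.comm r _).commute (act_of_two OrbitFun.equivariant_ampl _ n1.symm n3.symm n2.symm n4.symm)
  have c4 : Commute (ψ r) (ι (OrbitCoef.shift hq s.castSucc s.succ)) :=
    (h.comm r _).commute (act_of_two OrbitFun.equivariant_shift _ n1.symm n3.symm n2.symm n4.symm)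
  have c5 : Commute (ψ r) (ψ s) := h.far r s hs
  have c6 : ∀ F G, Commute (ι F) (ι G) := fun F G => (Commute.all F G).map ι
  exact Commute.sub_left
    (Commute.mul_left (((c6 _ _).mul_right c1.symm).sub_right (c6 _ _))
      ((c3.mul_right c5).sub_right c4))
    (((c6 _ _).mul_right c2.symm).sub_right (c6 _ _))

end FromPsi

section FromHecke

variable {T : Fin m → B}

theorem pair_psiOfHecke_mem (hq : q ≠ 0) (hq1 : q ≠ 1) (r : Fin m) :
    (psiOfHecke ι hq hq1 T r, OrbitFun.psiOp k i r.castSucc r.succ) ∈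
      rankOne ι OrbitFun.heckeLead OrbitFun.heckeTail r.castSucc r.succ (T r) := by
  rw [pair_psiOfHecke]
  exact mul_mem (pairCoef_mem_rankOne _) (add_mem pairOp_mem_rankOne (pairCoef_mem_rankOne _))

theorem HeckeSystem.psi_comm (hq : q ≠ 0) (hq1 : q ≠ 1) (h : HeckeSystem ι T) (r : Fin m)
    {F F₂ : OrbitCoef k i} (hF : toFun k i F₂ = OrbitFun.two OrbitFun.psiTail r.castSucc r.succ *
      (toFun k i F - Equiv.swap r.castSucc r.succ • toFun k i F)) :
    psiOfHecke ι hq hq1 T r * ι F =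
      ι (act (Equiv.swap r.castSucc r.succ) F) * psiOfHecke ι hq hq1 T r + ι F₂ :=
  (h.isDemazure hq r).comm_of_mem r.castSucc_ne_succ'
    (OrbitFun.two_heckeLead_mem hq hq1 r.castSucc_ne_succ') (pair_psiOfHecke_mem hq hq1 r) hF

theorem HeckeSystem.psi_sq (hq : q ≠ 0) (hq1 : q ≠ 1) (h : HeckeSystem ι T) (r : Fin m) :
    psiOfHecke ι hq hq1 T r * psiOfHecke ι hq hq1 T r =
      ι (OrbitCoef.psiSq k i r.castSucc r.succ) := by
  have hmem := pair_psiOfHecke_mem (ι := ι) (T := T) hq hq1 r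
  exact (h.isDemazure hq r).eq_of_rankOne r.castSucc_ne_succ'
    (OrbitFun.two_heckeLead_mem hq hq1 r.castSucc_ne_succ') (mul_mem hmem hmem)
    (pairCoef_mem_rankOne _) (OrbitFun.psiOp_mul_self _ _)

/-- The same transfer with roles exchanged: the ring is generated by two neighbouring `T`, whose
braid relation has error `0`, and the error for `ψ` is supplied by `OrbitFun.psiOp_braid`. -/
theorem HeckeSystem.psi_braid (hq : q ≠ 0) (hq1 : q ≠ 1) (h : HeckeSystem ι T) (r s : Fin m)
    (hs : s.val = r.val + 1) :
    psiOfHecke ι hq hq1 T r * psiOfHecke ι hq hq1 T s * psiOfHecke ι hq hq1 T r =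
      psiOfHecke ι hq hq1 T s * psiOfHecke ι hq hq1 T r * psiOfHecke ι hq hq1 T s +
        ι (OrbitCoef.err k i r.castSucc r.succ s.succ) := by
  have hrs : s.castSucc = r.succ := Fin.ext (by simpa using hs)
  have h1 := h.isDemazure hq r
  have h2 := h.isDemazure hq s
  have p1 := pair_psiOfHecke (ι := ι) hq hq1 T r
  have p2 := pair_psiOfHecke (ι := ι) hq hq1 T s
  have hb := h.braid r s hs
  have n1 := r.castSucc_ne_succ'
  have n2 := s.castSucc_ne_succ'
  have n3 : r.castSucc ≠ s.succ := by simp [Fin.ext_iff, hs]; omega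
  rw [hrs] at h2 p2 n2
  have m1 : (psiOfHecke ι hq hq1 T r, OrbitFun.psiOp k i r.castSucc r.succ) ∈
      rankTwo ι OrbitFun.heckeLead OrbitFun.heckeTail r.castSucc r.succ s.succ (T r) (T s) := by
    rw [p1]
    exact mul_mem (pairCoef_mem_rankTwo _) (add_mem pairOp_mem_rankTwo_left
      (pairCoef_mem_rankTwo _))
  have m2 : (psiOfHecke ι hq hq1 T s, OrbitFun.psiOp k i r.succ s.succ) ∈
      rankTwo ι OrbitFun.heckeLead OrbitFun.heckeTail r.castSucc r.succ s.succ (T r) (T s) := by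
    rw [p2]
    exact mul_mem (pairCoef_mem_rankTwo _) (add_mem pairOp_mem_rankTwo_right
      (pairCoef_mem_rankTwo _))
  exact h1.eq_of_rankTwo h2 n1 n2 n3 (OrbitFun.two_heckeLead_mem hq hq1 n1)
    (OrbitFun.two_heckeLead_mem hq hq1 n2)
    ⟨0, by rw [map_zero, add_zero]; exact hb, by
      rw [map_zero, single_zero, add_zero]; exact OrbitFun.heckeOp_braid hq n1 n2 n3⟩
    (mul_mem (mul_mem m1 m2) m1)
    (add_mem (mul_mem (mul_mem m2 m1) m2) (pairCoef_mem_rankTwo _)) (OrbitFun.psiOp_braid n1 n2 n3)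

theorem HeckeSystem.psi_far (hq : q ≠ 0) (hq1 : q ≠ 1) (h : HeckeSystem ι T) (r s : Fin m)
    (hs : r.val + 1 < s.val) :
    psiOfHecke ι hq hq1 T r * psiOfHecke ι hq hq1 T s =
      psiOfHecke ι hq hq1 T s * psiOfHecke ι hq hq1 T r := by
  have n1 : r.castSucc ≠ s.castSucc := by simp [Fin.ext_iff]; omega
  have n2 : r.castSucc ≠ s.succ := by simp [Fin.ext_iff]; omega
  have n3 : r.succ ≠ s.castSucc := by simp [Fin.ext_iff]; omega
  have n4 : r.succ ≠ s.succ := by simp [Fin.ext_iff]; omega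
  have c1 : Commute (T s) (ι (OrbitCoef.amplInv hq hq1 r.castSucc r.succ)) :=
    (h.comm s _).commute (act_of_two OrbitFun.equivariant_ampl_inv _ n1 n2 n3 n4)
  have c2 : Commute (T s) (ι (OrbitCoef.shift hq r.castSucc r.succ)) :=
    (h.comm s _).commute (act_of_two OrbitFun.equivariant_shift _ n1 n2 n3 n4)
  have c3 : Commute (T r) (ι (OrbitCoef.amplInv hq hq1 s.castSucc s.succ)) :=
    (h.comm r _).commute (act_of_two OrbitFun.equivariant_ampl_inv _ n1.symm n3.symm n2.symm
      n4.symm)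
  have c4 : Commute (T r) (ι (OrbitCoef.shift hq s.castSucc s.succ)) :=
    (h.comm r _).commute (act_of_two OrbitFun.equivariant_shift _ n1.symm n3.symm n2.symm n4.symm)
  have c5 : Commute (T r) (T s) := h.far r s hs
  have c6 : ∀ F G, Commute (ι F) (ι G) := fun F G => (Commute.all F G).map ι
  exact Commute.mul_left
    ((c6 _ _).mul_right (c1.symm.add_right (c6 _ _)))
    (Commute.add_left (c3.mul_right (c5.add_right c4))
      ((c6 _ _).mul_right (c2.symm.add_right (c6 _ _))))

theorem heckeOfPsi_psiOfHecke (hq : q ≠ 0) (hq1 : q ≠ 1) (r : Fin m) :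
    heckeOfPsi ι hq hq1 (psiOfHecke ι hq hq1 T) r = T r := by
  rw [heckeOfPsi, psiOfHecke, ← mul_assoc, ← map_mul, ampl_mul_amplInv, map_one, one_mul,
    add_sub_cancel_right]

theorem psiOfHecke_heckeOfPsi (hq : q ≠ 0) (hq1 : q ≠ 1) (ψ : Fin m → B) (r : Fin m) :
    psiOfHecke ι hq hq1 (heckeOfPsi ι hq hq1 ψ) r = ψ r := by
  rw [psiOfHecke, heckeOfPsi, sub_add_cancel, ← mul_assoc, ← map_mul, amplInv_mul_ampl, map_one,
    one_mul]

end FromHecke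

end Systems

end

noncomputable section

open OrbitCoef RatField

/-! ### Polynomials in commuting elements -/

section Commuting

variable {k : Type*} [Field k] {n : ℕ} {B : Type*} [Ring B] [Algebra k B]

theorem MvPolynomial.exists_algHom_of_commute (y : Fin n → B) (hy : ∀ a b, y a * y b = y b * y a) :
    ∃ μ : MvPolynomial (Fin n) k →ₐ[k] B, ∀ j, μ (MvPolynomial.X j) = y j := by
  have h : IsMulCommutative (Algebra.adjoin k (Set.range y)) :=
    Algebra.isMulCommutative_adjoin k (by rintro _ ⟨a, rfl⟩ _ ⟨b, rfl⟩; exact hy a b)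
  let _ : CommRing (Algebra.adjoin k (Set.range y)) :=
    { (inferInstance : Ring (Algebra.adjoin k (Set.range y))) with mul_comm := h.is_comm.comm }
  exact ⟨(Algebra.adjoin k (Set.range y)).val.comp
    (MvPolynomial.aeval fun j => ⟨y j, Algebra.subset_adjoin ⟨j, rfl⟩⟩), fun j => by simp⟩

/-- The ordered product matches the way `KLR.poly` and `Hecke.laurent` are written. -/
theorem MvPolynomial.algHom_eq_sum (μ : MvPolynomial (Fin n) k →ₐ[k] B)
    (p : MvPolynomial (Fin n) k) :
    μ p = ∑ a ∈ p.support, p.coeff a • (List.ofFn fun j => μ (MvPolynomial.X j) ^ a j).prod := by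
  conv_lhs => rw [p.as_sum]
  rw [map_sum]
  refine Finset.sum_congr rfl fun a _ => ?_
  rw [MvPolynomial.monomial_eq, ← MvPolynomial.smul_eq_C_mul, map_smul,
    Finsupp.prod_fintype _ _ (by simp), ← List.prod_ofFn, map_list_prod, List.map_ofFn]
  congr 3
  ext j
  simp

theorem MvPolynomial.mem_span_X_of_constantCoeff {p : MvPolynomial (Fin n) k}
    (hp : MvPolynomial.constantCoeff p = 0) :
    p ∈ Ideal.span (Set.range (MvPolynomial.X : Fin n → MvPolynomial (Fin n) k)) := by
  rw [← Set.image_univ, MvPolynomial.mem_ideal_span_X_image]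
  intro a ha
  by_contra! h
  rw [MvPolynomial.mem_support_iff] at ha
  apply ha
  have : a = 0 := Finsupp.ext fun j => h j trivial
  rw [this]
  exact hp

theorem MvPolynomial.span_X_le_radical_ker (μ : MvPolynomial (Fin n) k →ₐ[k] B)
    (h : ∀ j, IsNilpotent (μ (MvPolynomial.X j))) :
    Ideal.span (Set.range (MvPolynomial.X : Fin n → MvPolynomial (Fin n) k)) ≤
      (RingHom.ker μ).radical := by
  rw [Ideal.span_le]
  rintro _ ⟨j, rfl⟩
  obtain ⟨N, hN⟩ := h j
  exact ⟨N, by rw [RingHom.mem_ker, map_pow, hN]⟩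

theorem MvPolynomial.isNilpotent_of_constantCoeff (μ : MvPolynomial (Fin n) k →ₐ[k] B)
    (h : ∀ j, IsNilpotent (μ (MvPolynomial.X j))) {p : MvPolynomial (Fin n) k}
    (hp : MvPolynomial.constantCoeff p = 0) : IsNilpotent (μ p) := by
  obtain ⟨N, hN⟩ := MvPolynomial.span_X_le_radical_ker μ h
    (MvPolynomial.mem_span_X_of_constantCoeff hp)
  exact ⟨N, by rwa [RingHom.mem_ker, map_pow] at hN⟩

/-- The image is a nonzero constant plus a commuting nilpotent element. -/
theorem MvPolynomial.isUnit_of_constantCoeff (μ : MvPolynomial (Fin n) k →ₐ[k] B)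
    (h : ∀ j, IsNilpotent (μ (MvPolynomial.X j))) {p : MvPolynomial (Fin n) k}
    (hp : MvPolynomial.constantCoeff p ≠ 0) : IsUnit (μ p) := by
  have h1 : IsNilpotent (μ (p - MvPolynomial.C (MvPolynomial.constantCoeff p))) :=
    MvPolynomial.isNilpotent_of_constantCoeff μ h (by simp)
  have h2 : IsUnit (μ (MvPolynomial.C (MvPolynomial.constantCoeff p))) :=
    ((isUnit_iff_ne_zero.2 hp).map MvPolynomial.C).map μ
  have := h1.isUnit_add_left_of_commute h2 ((Commute.all _ _).map μ)
  rwa [← map_add, add_sub_cancel] at this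

end Commuting

/-! ### The relations of the quiver Hecke algebra -/

namespace OrbitCoef

variable {k : Type*} [Field k] {m e : ℕ} {i : Fin (m + 1) → ZMod e} {B : Type*} [Ring B]
    [Algebra k B] {ι : OrbitCoef k i →ₐ[k] B}

/-- This turns an identity of coefficients at one `e(u)` into a single identity of rational
functions. -/
theorem mul_idem_congr {F F' : OrbitCoef k i} {u : SymOrbit i}
    (h : toFun k i F u = toFun k i F' u) : F * idem k u = F' * idem k u := by
  have h' : eval k i u F = eval k i u F' := LocalRing.val_injective h
  rw [mul_idem, mul_idem F', h']

/-- Most of the quiver relations are given after right multiplication by `e(u)`; since the `e(u)`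
sum to one, they assemble to relations without it. -/
theorem eq_of_mul_idem {y z : B} (h : ∀ u, y * ι (idem k u) = z * ι (idem k u)) : y = z := by
  rw [← mul_one y, ← mul_one z, ← map_one ι, ← sum_idem, map_sum, Finset.mul_sum, Finset.mul_sum]
  exact Finset.sum_congr rfl fun u _ => h u

variable (k i) in
/-- The indicator function of the set of all `u` with `u_a = u_b`. -/
def same (a b : Fin (m + 1)) : OrbitCoef k i :=
  mk (OrbitFun.two (fun p s _ _ => if p = s then 1 else 0) a b) fun u => by
    rw [OrbitFun.two_apply]
    split_ifs
    · exact ⟨_, Reg.one⟩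
    · exact ⟨_, Reg.zero⟩

theorem toFun_same (a b : Fin (m + 1)) (u : SymOrbit i) :
    toFun k i (same k i a b) u = if u.1 a = u.1 b then 1 else 0 := rfl

theorem same_mul_idem (a b : Fin (m + 1)) (u : SymOrbit i) :
    same k i a b * idem k u = (if u.1 a = u.1 b then 1 else 0) * idem k u := by
  refine mul_idem_congr ?_
  rw [toFun_same]
  split_ifs <;> simp

theorem act_swap_idem (r : Fin m) (u : SymOrbit i) :
    act (Equiv.swap r.castSucc r.succ) (idem k u) = idem k (u.s r) :=
  act_idem (Equiv.swap_mul_self _ _) u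

/-- Where `psiTail` is nonzero the two entries of `v` agree, so `s_r` fixes `v` and the two
indicator functions coincide there. -/
theorem psiTail_mul_idem (r : Fin m) (u : SymOrbit i) :
    OrbitFun.two OrbitFun.psiTail r.castSucc r.succ * (toFun k i (idem k u) -
      Equiv.swap r.castSucc r.succ • toFun k i (idem k u)) = 0 := by
  rw [← toFun_act, act_swap_idem]
  refine OrbitFun.ext fun v => ?_
  rw [OrbitFun.mul_apply, OrbitFun.sub_apply, toFun_idem, toFun_idem, OrbitFun.two_apply,
    OrbitFun.psiTail, OrbitFun.zero_apply]
  split_ifs with h1 h2 h3 h3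
  · simp
  · exfalso
    subst h2
    refine h3 (Subtype.ext (funext fun j => ?_))
    change v.1 j = v.1 (Equiv.swap r.castSucc r.succ j)
    rw [Equiv.swap_apply_def]
    split_ifs with h4 h5
    · rw [h4, h1]
    · rw [h5, h1]
    · rfl
  · exfalso
    subst h3
    refine h2 (Subtype.ext (funext fun j => ?_))
    change u.1 (Equiv.swap r.castSucc r.succ j) = u.1 j
    have h1 : u.1 (Equiv.swap r.castSucc r.succ r.castSucc) =
      u.1 (Equiv.swap r.castSucc r.succ r.succ) := h1
    rw [Equiv.swap_apply_left, Equiv.swap_apply_right] at h1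
    rw [Equiv.swap_apply_def]
    split_ifs with h4 h5
    · rw [h4, h1]
    · rw [h5, h1]
    · rfl
  · simp
  all_goals simp

/-- The factor `x_{r+1} - x_r` cancels the pole of `psiTail`, leaving the Kronecker delta of the
relations between `ψ_r` and `x_{r+1}`. -/
theorem psiTail_mul_x_succ (r : Fin m) :
    OrbitFun.two OrbitFun.psiTail r.castSucc r.succ * (toFun k i (x k i r.succ) -
      Equiv.swap r.castSucc r.succ • toFun k i (x k i r.succ)) =
      toFun k i (same k i r.castSucc r.succ) := by
  rw [← toFun_act, act_x, Equiv.swap_apply_right]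
  refine OrbitFun.ext fun v => ?_
  rw [OrbitFun.mul_apply, OrbitFun.sub_apply, toFun_x, toFun_x, OrbitFun.two_apply,
    OrbitFun.psiTail, toFun_same]
  split_ifs
  · exact inv_mul_cancel₀ (x_sub_x_ne_zero r.castSucc_ne_succ'.symm)
  · rw [zero_mul]

theorem psiTail_mul_x_castSucc (r : Fin m) :
    OrbitFun.two OrbitFun.psiTail r.castSucc r.succ * (toFun k i (x k i r.castSucc) -
      Equiv.swap r.castSucc r.succ • toFun k i (x k i r.castSucc)) =
      toFun k i (-same k i r.castSucc r.succ) := by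
  rw [map_neg, ← psiTail_mul_x_succ, ← toFun_act, ← toFun_act, act_x, act_x,
    Equiv.swap_apply_right, Equiv.swap_apply_left]
  ring

theorem commRule_idem {ψ : B} {r : Fin m}
    (h : ∀ u, ψ * ι (idem k u) = ι (idem k (u.s r)) * ψ) (u : SymOrbit i) :
    CommRule ι OrbitFun.psiTail r.castSucc r.succ ψ (idem k u) :=
  ⟨0, by rw [map_zero, psiTail_mul_idem], by rw [h, act_swap_idem, map_zero, add_zero]⟩

/-- The two quiver relations with a Kronecker delta are the commutation rules for `x_{r+1}` and
`x_r`; the latter appears with its terms on opposite sides. -/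
theorem commRule_x {ψ : B} {r : Fin m}
    (h1 : ψ * ι (x k i r.succ) = ι (x k i r.castSucc) * ψ + ι (same k i r.castSucc r.succ))
    (h2 : ι (x k i r.succ) * ψ = ψ * ι (x k i r.castSucc) + ι (same k i r.castSucc r.succ))
    (h3 : ∀ j, j ≠ r.castSucc → j ≠ r.succ → ψ * ι (x k i j) = ι (x k i j) * ψ)
    (j : Fin (m + 1)) : CommRule ι OrbitFun.psiTail r.castSucc r.succ ψ (x k i j) := by
  by_cases hj : j = r.castSucc
  · subst hj
    refine ⟨_, (psiTail_mul_x_castSucc r).symm, ?_⟩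
    rw [act_x, Equiv.swap_apply_left, h2, map_neg, add_neg_cancel_right]
  · by_cases hj' : j = r.succ
    · subst hj'
      refine ⟨_, (psiTail_mul_x_succ r).symm, ?_⟩
      rw [act_x, Equiv.swap_apply_right, h1]
    · refine ⟨0, ?_, ?_⟩
      · rw [← toFun_act, act_x, Equiv.swap_apply_of_ne_of_ne hj hj', sub_self, mul_zero, map_zero]
      · rw [act_x, Equiv.swap_apply_of_ne_of_ne hj hj', map_zero, add_zero, h3 j hj hj']

end OrbitCoef

theorem HeckeSystem.psiSystem {k : Type*} [Field k] {q : k} {m : ℕ}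
    {i : Fin (m + 1) → ZMod (orderOf q)} {B : Type*} [Ring B] [Algebra k B]
    {ι : OrbitCoef k i →ₐ[k] B} {T : Fin m → B} (hq : q ≠ 0) (hq1 : q ≠ 1)
    (h : HeckeSystem ι T) : PsiSystem ι (psiOfHecke ι hq hq1 T) where
  comm r := CommRule.of_generators
    (commRule_x
      (by simpa [act_x] using h.psi_comm hq hq1 r (psiTail_mul_x_succ r).symm)
      (by
        have := h.psi_comm hq hq1 r (psiTail_mul_x_castSucc r).symm
        rw [this, act_x, Equiv.swap_apply_left, map_neg, neg_add_cancel_right])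
      (fun j hj hj' => by
        have := h.psi_comm hq hq1 r (F := x k i j) (F₂ := 0) (by
          rw [← toFun_act, act_x, Equiv.swap_apply_of_ne_of_ne hj hj', sub_self, mul_zero,
            map_zero])
        rw [this, act_x, Equiv.swap_apply_of_ne_of_ne hj hj', map_zero, add_zero]))
    (commRule_idem fun u => by
      have := h.psi_comm hq hq1 r (F := idem k u) (F₂ := 0) (by rw [psiTail_mul_idem, map_zero])
      rw [this, act_swap_idem, map_zero, add_zero])
  sq := h.psi_sq hq hq1
  braid := h.psi_braid hq hq1
  far := h.psi_far hq hq1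

section Relations

variable {k : Type*} [Field k] {m e : ℕ} {i : Fin (m + 1) → ZMod e} {B : Type*} [Ring B]
    [Algebra k B] {ι : OrbitCoef k i →ₐ[k] B}

/-- The product formula `psiSq` treats all cases of `ψ²` at once; both of its linear factors occur
together only for `e = 2`. The exclusion of `e = 1` is the assumption `q ≠ 1`. -/
theorem ZMod.eq_two_of_add_one_add_one {e : ℕ} (he : e ≠ 1) {p s : ZMod e} (h : p = s + 1)
    (h' : s = p + 1) : e = 2 := by
  have h2 : ((2 : ℕ) : ZMod e) = 0 := by
    push_cast
    have : s = s + 2 := by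
      nth_rw 1 [h', h]; ring
    exact left_eq_add.1 this
  rw [ZMod.natCast_eq_zero_iff] at h2
  exact ((Nat.dvd_prime Nat.prime_two).1 h2).resolve_left he

theorem ZMod.ne_add_one_of_ne_one {e : ℕ} (he : e ≠ 1) (p : ZMod e) : p ≠ p + 1 := by
  intro h
  have : ((1 : ℕ) : ZMod e) = 0 := by
    push_cast
    exact left_eq_add.1 h
  rw [ZMod.natCast_eq_zero_iff] at this
  exact he (Nat.dvd_one.1 this)

theorem ZMod.eq_add_one_of_two {e : ℕ} (he : e = 2) {p s : ZMod e} (h : p ≠ s) : p = s + 1 := by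
  subst he
  revert p s
  decide

namespace OrbitCoef

theorem psiSq_mul_idem_eq (r : Fin m) {u : SymOrbit i} (h : u.1 r.castSucc = u.1 r.succ) :
    psiSq k i r.castSucc r.succ * idem k u = 0 := by
  rw [← zero_mul (idem k u)]
  refine mul_idem_congr ?_
  rw [toFun_psiSq, OrbitFun.two_apply, OrbitFun.psiSq, if_pos h, map_zero]
  rfl

theorem psiSq_mul_idem_far (r : Fin m) {u : SymOrbit i} (h : u.1 r.succ ≠ u.1 r.castSucc)
    (h₁ : u.1 r.succ ≠ u.1 r.castSucc + 1) (h₂ : u.1 r.succ ≠ u.1 r.castSucc - 1) :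
    psiSq k i r.castSucc r.succ * idem k u = idem k u := by
  nth_rw 2 [← one_mul (idem k u)]
  refine mul_idem_congr ?_
  rw [toFun_psiSq, OrbitFun.two_apply, OrbitFun.psiSq, if_neg h.symm, if_neg h₁,
    if_neg (fun h => h₂ (eq_sub_of_add_eq h.symm)), map_one, one_mul]
  rfl

theorem psiSq_mul_idem_up (he1 : e ≠ 1) (r : Fin m) {u : SymOrbit i} (he : e ≠ 2)
    (h : u.1 r.succ = u.1 r.castSucc + 1) :
    psiSq k i r.castSucc r.succ * idem k u =
      (x k i r.succ - x k i r.castSucc) * idem k u := by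
  refine mul_idem_congr ?_
  rw [toFun_psiSq, OrbitFun.two_apply, OrbitFun.psiSq, if_neg, if_pos h, if_neg, one_mul]
  · rfl
  · exact fun h' => he (ZMod.eq_two_of_add_one_add_one he1 h h')
  · rw [h]; exact ZMod.ne_add_one_of_ne_one he1 _

theorem psiSq_mul_idem_down (he1 : e ≠ 1) (r : Fin m) {u : SymOrbit i} (he : e ≠ 2)
    (h : u.1 r.succ = u.1 r.castSucc - 1) :
    psiSq k i r.castSucc r.succ * idem k u =
      (x k i r.castSucc - x k i r.succ) * idem k u := by
  have h : u.1 r.castSucc = u.1 r.succ + 1 := by rw [h, sub_add_cancel]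
  refine mul_idem_congr ?_
  rw [toFun_psiSq, OrbitFun.two_apply, OrbitFun.psiSq, if_neg, if_pos h, if_neg, mul_one]
  · rfl
  · exact fun h' => he (ZMod.eq_two_of_add_one_add_one he1 h h')
  · rw [h]; exact (ZMod.ne_add_one_of_ne_one he1 _).symm

theorem psiSq_mul_idem_two (r : Fin m) {u : SymOrbit i} (he : e = 2)
    (h : u.1 r.succ ≠ u.1 r.castSucc) :
    psiSq k i r.castSucc r.succ * idem k u =
      (x k i r.succ - x k i r.castSucc) * (x k i r.castSucc - x k i r.succ) * idem k u := by
  refine mul_idem_congr ?_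
  rw [toFun_psiSq, OrbitFun.two_apply, OrbitFun.psiSq, if_neg h.symm,
    if_pos (ZMod.eq_add_one_of_two he h.symm), if_pos (ZMod.eq_add_one_of_two he h), mul_comm]
  rfl

theorem err_mul_idem_up (he1 : e ≠ 1) {a b c : Fin (m + 1)} {u : SymOrbit i} (he : e ≠ 2)
    (h : u.1 c = u.1 a) (h' : u.1 a = u.1 b - 1) :
    err k i a b c * idem k u = idem k u := by
  have h' : u.1 b = u.1 a + 1 := by rw [h', sub_add_cancel]
  nth_rw 2 [← one_mul (idem k u)]
  refine mul_idem_congr ?_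
  have h1 : u.1 a ≠ u.1 b := h' ▸ ZMod.ne_add_one_of_ne_one he1 _
  rw [toFun_err, OrbitFun.err, OrbitFun.psiErr, if_pos ⟨h.symm, h1⟩, if_pos h', if_neg, map_one]
  · rfl
  · exact fun h'' => he (ZMod.eq_two_of_add_one_add_one he1 h' h'')

theorem err_mul_idem_down (he1 : e ≠ 1) {a b c : Fin (m + 1)} {u : SymOrbit i} (he : e ≠ 2)
    (h : u.1 c = u.1 a) (h' : u.1 a = u.1 b + 1) :
    err k i a b c * idem k u = -idem k u := by
  rw [← neg_one_mul]
  refine mul_idem_congr ?_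
  have h1 : u.1 a ≠ u.1 b := h' ▸ (ZMod.ne_add_one_of_ne_one he1 _).symm
  rw [toFun_err, OrbitFun.err, OrbitFun.psiErr, if_pos ⟨h.symm, h1⟩, if_neg, if_pos h', map_neg,
    map_one]
  · rfl
  · exact fun h'' => he (ZMod.eq_two_of_add_one_add_one he1 h' h'')

theorem err_mul_idem_two {a b c : Fin (m + 1)} {u : SymOrbit i} (he : e = 2)
    (h : u.1 c = u.1 a) (h' : u.1 a ≠ u.1 b) :
    err k i a b c * idem k u = (x k i a + x k i c - 2 * x k i b) * idem k u := by
  refine mul_idem_congr ?_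
  rw [toFun_err, OrbitFun.err, OrbitFun.psiErr, if_pos ⟨h.symm, h'⟩,
    if_pos (ZMod.eq_add_one_of_two he h'.symm), if_pos (ZMod.eq_add_one_of_two he h'), map_sub,
    map_add, map_mul, map_ofNat]
  rfl

theorem err_mul_idem_zero {a b c : Fin (m + 1)} {u : SymOrbit i}
    (h : ¬ (u.1 c = u.1 a ∧ (u.1 a = u.1 b - 1 ∨ u.1 a = u.1 b + 1))) :
    err k i a b c * idem k u = 0 := by
  rw [← zero_mul (idem k u)]
  refine mul_idem_congr ?_
  rw [toFun_err, OrbitFun.err, OrbitFun.psiErr, map_zero, OrbitFun.zero_apply]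
  split_ifs with h1 h2 h3 h3
  · exact absurd ⟨h1.1.symm, Or.inr h3⟩ h
  · exact absurd ⟨h1.1.symm, Or.inl (eq_sub_of_add_eq h2.symm)⟩ h
  · exact absurd ⟨h1.1.symm, Or.inr h3⟩ h
  · rfl
  · rfl

end OrbitCoef

theorem PsiSystem.psi_idem {ψ : Fin m → B} (h : PsiSystem ι ψ) (r : Fin m) (u : SymOrbit i) :
    ψ r * ι (idem k u) = ι (idem k (u.s r)) * ψ r := by
  obtain ⟨F₂, h1, h2⟩ := h.comm r (idem k u)
  rw [psiTail_mul_idem] at h1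
  rw [h2, act_swap_idem, toFun_injective (h1.trans (map_zero _).symm), map_zero, add_zero]

theorem PsiSystem.psi_x_succ {ψ : Fin m → B} (h : PsiSystem ι ψ) (r : Fin m) :
    ψ r * ι (x k i r.succ) = ι (x k i r.castSucc) * ψ r + ι (same k i r.castSucc r.succ) := by
  obtain ⟨F₂, h1, h2⟩ := h.comm r (x k i r.succ)
  rw [psiTail_mul_x_succ] at h1
  rw [h2, act_x, Equiv.swap_apply_right, toFun_injective h1]

theorem PsiSystem.x_succ_psi {ψ : Fin m → B} (h : PsiSystem ι ψ) (r : Fin m) :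
    ι (x k i r.succ) * ψ r = ψ r * ι (x k i r.castSucc) + ι (same k i r.castSucc r.succ) := by
  obtain ⟨F₂, h1, h2⟩ := h.comm r (x k i r.castSucc)
  rw [psiTail_mul_x_castSucc] at h1
  rw [h2, act_x, Equiv.swap_apply_left, toFun_injective h1, map_neg, neg_add_cancel_right]

theorem PsiSystem.psi_x_of_ne {ψ : Fin m → B} (h : PsiSystem ι ψ) (r : Fin m) {j : Fin (m + 1)}
    (hj : j ≠ r.castSucc) (hj' : j ≠ r.succ) : ψ r * ι (x k i j) = ι (x k i j) * ψ r :=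
  (h.comm r _).commute (by rw [act_x, Equiv.swap_apply_of_ne_of_ne hj hj'])

/-- A system of elements which satisfies the relations defines a homomorphism from the quiver
Hecke algebra. -/
theorem PsiSystem.exists_hom (he1 : e ≠ 1) {ψ : Fin m → B} (h : PsiSystem ι ψ) :
    ∃ χ : KLR k i →ₐ[k] B, (∀ u, χ (KLR.E k i u) = ι (idem k u)) ∧
      (∀ j, χ (KLR.x k i j) = ι (x k i j)) ∧ ∀ r, χ (KLR.psi k i r) = ψ r := by
  let g : KLRGen i → B := fun t => match t with
    | .E u => ι (idem k u)
    | .psi r => ψ r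
    | .x j => ι (x k i j)
  have gE : ∀ u, FreeAlgebra.lift k g (KLR.fE k u) = ι (idem k u) := fun u =>
    FreeAlgebra.lift_ι_apply g _
  have gpsi : ∀ r, FreeAlgebra.lift k g (KLR.fpsi k i r) = ψ r := fun r =>
    FreeAlgebra.lift_ι_apply g _
  have gx : ∀ j, FreeAlgebra.lift k g (KLR.fx k i j) = ι (x k i j) := fun j =>
    FreeAlgebra.lift_ι_apply g _
  have hrel : ∀ ⦃y z⦄, KLR.Rel k i y z → FreeAlgebra.lift k g y = FreeAlgebra.lift k g z := by
    intro y z hyz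
    induction hyz with
    | E_mul u v =>
      rw [apply_ite (FreeAlgebra.lift k g), map_mul, map_zero, gE, gE, ← map_mul, idem_mul_idem]
      split_ifs
      · rfl
      · exact map_zero _
    | E_sum =>
      simp only [map_sum, gE, map_one]
      rw [← map_sum, sum_idem, map_one]
    | x_E j u => rw [map_mul, map_mul, gE, gx, ← map_mul, ← map_mul, mul_comm]
    | psi_E r u => rw [map_mul, map_mul, gE, gE, gpsi, h.psi_idem]
    | x_comm j l => rw [map_mul, map_mul, gx, gx, ← map_mul, ← map_mul, mul_comm]
    | psi_comm r s hrs => rw [map_mul, map_mul, gpsi, gpsi, h.far r s hrs]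
    | psi_x_comm r j h1 h2 => rw [map_mul, map_mul, gpsi, gx, h.psi_x_of_ne r h1 h2]
    | psi_x r u =>
      rw [map_mul, map_mul, map_mul, map_add, map_mul, apply_ite (FreeAlgebra.lift k g), map_one,
        map_zero, gE, gpsi, gx, gx, h.psi_x_succ, add_mul, add_mul, ← map_mul, same_mul_idem]
      split_ifs <;> simp
    | x_psi r u =>
      rw [map_mul, map_mul, map_mul, map_add, map_mul, apply_ite (FreeAlgebra.lift k g), map_one,
        map_zero, gE, gpsi, gx, gx, h.x_succ_psi, add_mul, add_mul, ← map_mul, same_mul_idem]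
      split_ifs <;> simp
    | psi_sq_eq r u h1 =>
      rw [map_mul, map_pow, gE, gpsi, pow_two, h.sq, ← map_mul, psiSq_mul_idem_eq r h1, map_zero,
        map_zero]
    | psi_sq_far r u h1 h2 h3 =>
      rw [map_mul, map_pow, gE, gpsi, pow_two, h.sq, ← map_mul, psiSq_mul_idem_far r h1 h2 h3]
    | psi_sq_up r u he h1 =>
      rw [map_mul, map_pow, map_mul, map_sub, gE, gpsi, gx, gx, pow_two, h.sq, ← map_mul,
        psiSq_mul_idem_up he1 r he h1, map_mul, map_sub]
    | psi_sq_down r u he h1 =>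
      rw [map_mul, map_pow, map_mul, map_sub, gE, gpsi, gx, gx, pow_two, h.sq, ← map_mul,
        psiSq_mul_idem_down he1 r he h1, map_mul, map_sub]
    | psi_sq_two r u he h1 =>
      rw [map_mul, map_pow, map_mul, map_mul, map_sub, map_sub, gE, gpsi, gx, gx, pow_two, h.sq,
        ← map_mul, psiSq_mul_idem_two r he h1, map_mul, map_mul, map_sub, map_sub]
    | braid_up r s hs u he h1 h2 =>
      simp only [map_mul, map_add, map_one, gE, gpsi]
      rw [h.braid r s hs, add_mul, add_mul, ← map_mul, err_mul_idem_up he1 he h1 h2, one_mul]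
    | braid_down r s hs u he h1 h2 =>
      simp only [map_mul, map_sub, map_one, gE, gpsi]
      rw [h.braid r s hs, add_mul, sub_mul, ← map_mul, err_mul_idem_down he1 he h1 h2, one_mul,
        map_neg, sub_eq_add_neg]
    | braid_two r s hs u he h1 h2 =>
      simp only [map_mul, map_sub, map_add, map_ofNat, gE, gpsi, gx]
      rw [h.braid r s hs, add_mul, ← map_mul, err_mul_idem_two he h1 h2, map_mul, map_sub,
        map_add, map_mul, map_ofNat]
      noncomm_ring
    | braid r s hs u h1 =>
      simp only [map_mul, gE, gpsi]
      rw [h.braid r s hs, add_mul, ← map_mul, err_mul_idem_zero h1, map_zero, add_zero]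
  refine ⟨RingQuot.liftAlgHom k ⟨FreeAlgebra.lift k g, hrel⟩, fun u => ?_, fun j => ?_, fun r => ?_⟩
  · exact (RingQuot.liftAlgHom_mkAlgHom_apply k _ _ _).trans (gE u)
  · exact (RingQuot.liftAlgHom_mkAlgHom_apply k _ _ _).trans (gx j)
  · exact (RingQuot.liftAlgHom_mkAlgHom_apply k _ _ _).trans (gpsi r)

end Relations

end

noncomputable section

open OrbitCoef RatField

/-! ### The completed quiver Hecke algebra -/

/-- In the presence of a homomorphism from the quiver Hecke algebra, the images of the `ψ_r`
satisfy the relations with all coefficients. -/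
theorem PsiSystem.of_hom {k : Type*} [Field k] {m e : ℕ} {i : Fin (m + 1) → ZMod e} {B : Type*}
    [Ring B] [Algebra k B] {ι : OrbitCoef k i →ₐ[k] B} (he1 : e ≠ 1) (χ : KLR k i →ₐ[k] B)
    (hE : ∀ u, χ (KLR.E k i u) = ι (idem k u)) (hx : ∀ j, χ (KLR.x k i j) = ι (x k i j)) :
    PsiSystem ι fun r => χ (KLR.psi k i r) := by
  set P := χ.comp (RingQuot.mkAlgHom k (KLR.Rel k i)) with hP
  have rel : ∀ {y z}, KLR.Rel k i y z → P y = P z := fun h =>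
    congrArg χ (RingQuot.mkAlgHom_rel k h)
  have gE : ∀ u, P (KLR.fE k u) = ι (idem k u) := hE
  have gx : ∀ j, P (KLR.fx k i j) = ι (x k i j) := hx
  have gpsi : ∀ r, P (KLR.fpsi k i r) = χ (KLR.psi k i r) := fun r => rfl
  have hpE : ∀ (r : Fin m) (u : SymOrbit i),
      χ (KLR.psi k i r) * ι (idem k u) = ι (idem k (u.s r)) * χ (KLR.psi k i r) := fun r u => by
    simpa only [map_mul, gE, gpsi] using rel (.psi_E r u)
  have hite : ∀ (r : Fin m) (u : SymOrbit i), ι (same k i r.castSucc r.succ) * ι (idem k u) =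
      (if u.1 r.castSucc = u.1 r.succ then 1 else 0) * ι (idem k u) := fun r u => by
    rw [← map_mul, same_mul_idem]
    split_ifs <;> simp
  refine ⟨fun r => CommRule.of_generators (commRule_x ?_ ?_ ?_) (commRule_idem (hpE r)),
    fun r => ?_, fun r s hs => ?_, fun r s hrs => ?_⟩
  · refine eq_of_mul_idem (ι := ι) fun u => ?_
    have := rel (.psi_x r u)
    rw [map_mul, map_mul, map_mul, map_add, map_mul, apply_ite P, map_one, map_zero, gE, gpsi, gx,
      gx] at this
    rw [this, add_mul, add_mul, hite]
  · refine eq_of_mul_idem (ι := ι) fun u => ?_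
    have := rel (.x_psi r u)
    rw [map_mul, map_mul, map_mul, map_add, map_mul, apply_ite P, map_one, map_zero, gE, gpsi, gx,
      gx] at this
    rw [this, add_mul, add_mul, hite]
  · intro j hj hj'
    simpa only [map_mul, gx, gpsi] using rel (.psi_x_comm r j hj hj')
  · refine eq_of_mul_idem (ι := ι) fun u => ?_
    rw [← map_mul ι]
    by_cases h1 : u.1 r.castSucc = u.1 r.succ
    · have := rel (.psi_sq_eq r u h1)
      rw [map_mul, map_pow, map_zero, gE, gpsi, pow_two] at this
      rw [this, psiSq_mul_idem_eq r h1, map_zero]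
    by_cases he : e = 2
    · have := rel (.psi_sq_two r u he (Ne.symm h1))
      simp only [map_mul, map_sub, gE, gpsi, gx, pow_two] at this
      rw [this, psiSq_mul_idem_two r he (Ne.symm h1)]
      simp only [map_mul, map_sub]
    by_cases h2 : u.1 r.succ = u.1 r.castSucc + 1
    · have := rel (.psi_sq_up r u he h2)
      simp only [map_mul, map_sub, gE, gpsi, gx, pow_two] at this
      rw [this, psiSq_mul_idem_up he1 r he h2]
      simp only [map_mul, map_sub]
    by_cases h3 : u.1 r.succ = u.1 r.castSucc - 1
    · have := rel (.psi_sq_down r u he h3)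
      simp only [map_mul, map_sub, gE, gpsi, gx, pow_two] at this
      rw [this, psiSq_mul_idem_down he1 r he h3]
      simp only [map_mul, map_sub]
    have := rel (.psi_sq_far r u (Ne.symm h1) h2 h3)
    rw [map_mul, map_pow, gE, gpsi, pow_two] at this
    rw [this, psiSq_mul_idem_far r (Ne.symm h1) h2 h3]
  · refine eq_of_mul_idem (ι := ι) fun u => ?_
    rw [add_mul, ← map_mul ι]
    by_cases h0 : u.1 s.succ = u.1 r.castSucc ∧
        (u.1 r.castSucc = u.1 r.succ - 1 ∨ u.1 r.castSucc = u.1 r.succ + 1)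
    · by_cases he : e = 2
      · have h1 : u.1 r.castSucc ≠ u.1 r.succ := by
          rcases h0.2 with h | h
          · intro h'
            rw [h', eq_sub_iff_add_eq] at h
            exact ZMod.ne_add_one_of_ne_one he1 _ h.symm
          · rw [h]; exact (ZMod.ne_add_one_of_ne_one he1 _).symm
        have := rel (.braid_two r s hs u he h0.1 h1)
        simp only [map_mul, map_add, map_sub, map_ofNat, gE, gpsi, gx] at this
        rw [this, err_mul_idem_two he h0.1 h1]
        simp only [map_mul, map_add, map_sub, map_ofNat]
        noncomm_ring
      rcases h0 with ⟨h0, h1 | h1⟩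
      · have := rel (.braid_up r s hs u he h0 h1)
        simp only [map_mul, map_add, map_one, gE, gpsi] at this
        rw [this, err_mul_idem_up he1 he h0 h1, add_mul, one_mul]
      · have := rel (.braid_down r s hs u he h0 h1)
        simp only [map_mul, map_sub, map_one, gE, gpsi] at this
        rw [this, err_mul_idem_down he1 he h0 h1, sub_mul, one_mul, map_neg, sub_eq_add_neg]
    · have := rel (.braid r s hs u h0)
      simp only [map_mul, gE, gpsi] at this
      rw [this, err_mul_idem_zero h0, map_zero, add_zero]
  · simpa only [map_mul, gpsi] using rel (.psi_comm r s hrs)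

theorem KLR.exists_poly_eq {k : Type*} [Field k] {m e : ℕ} (i : Fin (m + 1) → ZMod e) :
    ∃ μ : MvPolynomial (Fin (m + 1)) k →ₐ[k] KLR k i, (∀ p, KLR.poly k i p = μ p) ∧
      ∀ j, μ (MvPolynomial.X j) = KLR.x k i j := by
  obtain ⟨μ, hμ⟩ := MvPolynomial.exists_algHom_of_commute (k := k) (KLR.x k i) (fun a b => by
    have := RingQuot.mkAlgHom_rel k (KLR.Rel.x_comm (k := k) (i := i) a b)
    rwa [map_mul, map_mul] at this)
  refine ⟨μ, fun p => ?_, hμ⟩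
  rw [MvPolynomial.algHom_eq_sum]
  simp only [hμ]
  rfl

/-- The ideal of the variables is finitely generated, so containment in a radical gives one exponent
for the whole ideal. -/
theorem MvPolynomial.exists_pow_le_ker {k : Type*} [Field k] {n : ℕ} {B : Type*} [Ring B]
    [Algebra k B] (μ : MvPolynomial (Fin n) k →ₐ[k] B)
    (h : ∀ j, IsNilpotent (μ (MvPolynomial.X j))) :
    ∃ N : ℕ, ∀ p ∈ Ideal.span (Set.range (MvPolynomial.X : Fin n → MvPolynomial (Fin n) k)) ^ N,
      μ p = 0 := by
  obtain ⟨N, hN⟩ := Ideal.exists_pow_le_of_le_radical_of_fg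
    (MvPolynomial.span_X_le_radical_ker μ h) (Submodule.fg_span (Set.finite_range _))
  exact ⟨N, fun p hp => hN hp⟩

/-- A homomorphism under which the `x_j` become nilpotent is continuous. -/
theorem KLR.exists_idealJ_le_ker {k : Type*} [Field k] {m e : ℕ} {i : Fin (m + 1) → ZMod e}
    {B : Type*} [Ring B] [Algebra k B] (χ : KLR k i →ₐ[k] B)
    (h : ∀ j, IsNilpotent (χ (KLR.x k i j))) : ∃ N, ∀ a ∈ KLR.idealJ k i N, χ a = 0 := by
  obtain ⟨μ, h1, h2⟩ := KLR.exists_poly_eq (k := k) i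
  obtain ⟨N, hN⟩ := MvPolynomial.exists_pow_le_ker (χ.comp μ) (fun j => by
    rw [AlgHom.comp_apply, h2]; exact h j)
  refine ⟨N, fun a ha => ?_⟩
  have h3 : a ∈ TwoSidedIdeal.ker χ := by
    refine TwoSidedIdeal.span_le.2 ?_ (TwoSidedIdeal.mem_asIdeal.1 ha)
    rintro _ ⟨p, hp, rfl⟩
    rw [SetLike.mem_coe, TwoSidedIdeal.mem_ker, h1]
    exact hN p hp
  exact (TwoSidedIdeal.mem_ker χ).1 h3

namespace KLRHat

variable {k : Type*} [Field k] {m e : ℕ} (i : Fin (m + 1) → ZMod e)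

theorem isNilpotent_proj_x (l : ℕ) (j : Fin (m + 1)) :
    IsNilpotent (IdealCompletion.proj (k := k) (KLR.idealJ k i) (KLR.idealJ_antitone k i) l
      (KLRHat.x k i j)) := by
  obtain ⟨μ, h1, h2⟩ := KLR.exists_poly_eq (k := k) i
  refine ⟨l, ?_⟩
  rw [KLRHat.x, KLRHat.of, IdealCompletion.proj_of, ← map_pow, Ideal.Quotient.eq_zero_iff_mem]
  refine TwoSidedIdeal.mem_asIdeal.2 (TwoSidedIdeal.subset_span ?_)
  refine ⟨MvPolynomial.X j ^ l, ?_, ?_⟩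
  · exact Ideal.pow_mem_pow (Ideal.subset_span (Set.mem_range_self j)) l
  · rw [h1, map_pow, h2]

/-- The coefficients act on the completed quiver Hecke algebra. -/
theorem exists_coef : ∃ ι : OrbitCoef k i →ₐ[k] KLRHat k i,
    (∀ j, ι (OrbitCoef.x k i j) = KLRHat.x k i j) ∧ ∀ u, ι (idem k u) = KLRHat.E k i u := by
  let P := (KLRHat.of k i).comp (RingQuot.mkAlgHom k (KLR.Rel k i))
  have rel : ∀ {y z}, KLR.Rel k i y z → P y = P z := fun h =>
    congrArg (KLRHat.of k i) (RingQuot.mkAlgHom_rel k h)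
  refine OrbitCoef.exists_hom _ _ (fun a b => ?_) (fun a u => ?_) (fun u v => ?_) ?_ ?_
  · have := rel (.x_comm a b)
    rwa [map_mul, map_mul] at this
  · have := rel (.x_E a u)
    rwa [map_mul, map_mul] at this
  · have := rel (.E_mul u v)
    rwa [map_mul, apply_ite P, map_zero] at this
  · have := rel .E_sum
    rwa [map_sum, map_one] at this
  · intro μ hμ p hp
    -- Invertibility is checked at each finite level, where the `x_j` are nilpotent.
    refine IdealCompletion.isUnit_of_proj _ fun l => ?_
    exact MvPolynomial.isUnit_of_constantCoeff ((IdealCompletion.proj _ _ l).comp μ) (fun j => by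
      rw [AlgHom.comp_apply, hμ]; exact isNilpotent_proj_x i l j) hp

end KLRHat

/-! ### Homomorphisms from the affine Hecke algebra -/

/-- A power of a two-sided ideal is not spanned by products of generators alone, as other elements
stand between them. If the images of such products commute with the image of `A`, these elements can
be moved aside. The sets `S n` stand for the products of `n` images. -/
theorem TwoSidedIdeal.map_pow_span_eq_zero {A D : Type*} [Ring A] [Ring D] (φ : A →+* D)
    {Z : Set A} {S : ℕ → Set D} (hS : ∀ n, ∀ s ∈ S n, ∀ a, s * φ a = φ a * s)
    (hZ : ∀ z ∈ Z, ∀ n, ∀ s ∈ S n, φ z * s ∈ S (n + 1)) {N : ℕ} (hN : ∀ s ∈ S N, s = 0)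
    (h1 : 1 ∈ S 0) : ∀ a ∈ (TwoSidedIdeal.span Z).asIdeal ^ N, φ a = 0 := by
  -- The element `s` collects the `n` factors already extracted, and `j` factors of the ideal
  -- remain.
  have key : ∀ j n, n + j = N → ∀ a ∈ (TwoSidedIdeal.span Z).asIdeal ^ j, ∀ s ∈ S n,
      φ a * s = 0 := by
    intro j
    induction j with
    | zero =>
      rintro n rfl a - s hs
      rw [hN s hs, mul_zero]
    | succ j ih =>
      intro n hn a ha s hs
      rw [Submodule.pow_succ] at ha
      refine Submodule.mul_induction_on ha (fun b hb c hc => ?_) (fun b c hb hc => ?_)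
      · have : ∀ c, c ∈ TwoSidedIdeal.span Z →
            ∀ b ∈ (TwoSidedIdeal.span Z).asIdeal ^ j, φ (b * c) * s = 0 := by
          intro c hc
          induction hc using TwoSidedIdeal.span_induction with
          | mem z hz =>
            intro b hb
            rw [map_mul, mul_assoc]
            exact ih (n + 1) (by omega) b hb _ (hZ z hz n s hs)
          | zero => intro b _; rw [mul_zero, map_zero, zero_mul]
          | add y z _ _ hy hz =>
            intro b hb
            rw [mul_add, map_add, add_mul, hy b hb, hz b hb, add_zero]
          | neg y _ hy =>
            intro b hb
            rw [mul_neg, map_neg, neg_mul, hy b hb, neg_zero]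
          | left_absorb y z _ hz =>
            intro b hb
            rw [← mul_assoc]
            exact hz _ (Ideal.mul_mem_right _ _ hb)
          | right_absorb y z _ hz =>
            intro b hb
            -- The one place where the commutation is used: `s` moves past the right-hand factor so
            -- as to stand next to the generator.
            rw [← mul_assoc, map_mul, mul_assoc, ← hS n s hs, ← mul_assoc, hz b hb, zero_mul]
        exact this c (TwoSidedIdeal.mem_asIdeal.1 hc) b hb
      · rw [map_add, add_mul, hb, hc, add_zero]
  intro a ha
  rw [← mul_one (φ a)]
  exact key N 0 (zero_add N) a ha 1 h1


section HeckeHom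

variable {k : Type*} [Field k] {q : k} {m : ℕ} {i : Fin (m + 1) → ZMod (orderOf q)}
    {B : Type*} [Ring B] [Algebra k B] {ι : OrbitCoef k i →ₐ[k] B}

theorem OrbitCoef.isUnit_X (hq : q ≠ 0) (j : Fin (m + 1)) : IsUnit (OrbitCoef.X i j) :=
  OrbitCoef.isUnit_of_reg fun u => ⟨_, qpow_ne_zero hq (u.1 j), OrbitFun.reg_toX _ _⟩

variable (i) in
/-- The variable `X_j` as a unit. -/
def OrbitCoef.XUnit (hq : q ≠ 0) (j : Fin (m + 1)) : (OrbitCoef k i)ˣ :=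
  (OrbitCoef.isUnit_X hq j).unit

/-- The difference `X_r - X_{r+1}` cancels the denominator of `heckeTail`, so the error term is
regular also where the entries agree. -/
theorem OrbitCoef.heckeTail_mul_X (hq : q ≠ 0) (r : Fin m) :
    toFun k i (-(algebraMap k _ (q - 1) * X i r.succ)) =
      OrbitFun.two OrbitFun.heckeTail r.castSucc r.succ * (toFun k i (X i r.castSucc) -
        Equiv.swap r.castSucc r.succ • toFun k i (X i r.castSucc)) := by
  rw [← toFun_act, act_X, Equiv.swap_apply_left]
  refine OrbitFun.ext fun u => ?_
  have h := OrbitFun.toX_sub_toX_ne_zero (k := k) hq (u.1 r.succ) (u.1 r.castSucc)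
    r.castSucc_ne_succ'.symm
  rw [OrbitFun.mul_apply, OrbitFun.sub_apply, map_neg, map_mul, OrbitFun.neg_apply,
    OrbitFun.mul_apply, toFun_algebraMap, toFun_X, toFun_X, OrbitFun.two_apply,
    OrbitFun.heckeTail, map_sub, map_one]
  field_simp
  ring

/-- Elements which satisfy the relations of the quiver Hecke algebra define a homomorphism from
the affine Hecke algebra. -/
theorem PsiSystem.exists_hecke_hom (hq : q ≠ 0) (hq1 : q ≠ 1) {ψ : Fin m → B}
    (h : PsiSystem ι ψ) : ∃ φ : Hecke q m →ₐ[k] B,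
      (∀ j, φ (Hecke.X q j : Hecke q m) = ι (X i j)) ∧
      ∀ r, φ (Hecke.T q r) = heckeOfPsi ι hq hq1 ψ r := by
  let g : HeckeGen m → B := fun t => match t with
    | .T r => heckeOfPsi ι hq hq1 ψ r
    | .X j => ι (X i j)
    | .Xinv j => ι ((XUnit i hq j)⁻¹ : (OrbitCoef k i)ˣ)
  have gT : ∀ r, FreeAlgebra.lift k g (FreeAlgebra.ι k (.T r)) = heckeOfPsi ι hq hq1 ψ r :=
    fun r => FreeAlgebra.lift_ι_apply g _
  have gX : ∀ j, FreeAlgebra.lift k g (FreeAlgebra.ι k (.X j)) = ι (X i j) :=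
    fun j => FreeAlgebra.lift_ι_apply g _
  have gXinv : ∀ j, FreeAlgebra.lift k g (FreeAlgebra.ι k (.Xinv j)) =
      ι ((XUnit i hq j)⁻¹ : (OrbitCoef k i)ˣ) := fun j => FreeAlgebra.lift_ι_apply g _
  have hrel : ∀ ⦃y z⦄, Hecke.Rel q m y z → FreeAlgebra.lift k g y = FreeAlgebra.lift k g z := by
    intro y z hyz
    induction hyz with
    | quadratic r =>
      rw [map_mul, map_sub, map_add, map_one, map_zero, AlgHom.commutes, gT, sub_mul, mul_add,
        h.hecke_sq hq hq1, map_sub, map_one]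
      noncomm_ring
    | T_comm r s hrs => rw [map_mul, map_mul, gT, gT, h.hecke_far hq hq1 r s hrs]
    | braid r s hs => simp only [map_mul, gT]; rw [h.hecke_braid hq hq1 r s hs]
    | X_mul_Xinv j =>
      rw [map_mul, map_one, gX, gXinv, ← map_mul]
      exact (congrArg ι (XUnit i hq j).mul_inv).trans (map_one ι)
    | Xinv_mul_X j =>
      rw [map_mul, map_one, gX, gXinv, ← map_mul]
      exact (congrArg ι (XUnit i hq j).inv_mul).trans (map_one ι)
    | X_comm j l => rw [map_mul, map_mul, gX, gX, ← map_mul, ← map_mul, mul_comm]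
    | T_X_comm r j h1 h2 =>
      have := h.hecke_comm hq hq1 r (F := X i j) (F₂ := 0) (by
        rw [← toFun_act, act_X, Equiv.swap_apply_of_ne_of_ne h1 h2, sub_self, mul_zero, map_zero])
      rw [map_mul, map_mul, gT, gX, this, act_X, Equiv.swap_apply_of_ne_of_ne h1 h2, map_zero,
        add_zero]
    -- Moving `X_r` to the left gives `X_{r+1} T_r² - (q - 1) X_{r+1} T_r`, which is `q X_{r+1}` by
    -- the quadratic relation.
    | T_X_T r =>
      rw [map_mul, map_mul, map_mul, AlgHom.commutes, gT, gX, gX,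
        h.hecke_comm hq hq1 r (heckeTail_mul_X hq r), act_X, Equiv.swap_apply_left, add_mul,
        mul_assoc, h.hecke_sq hq hq1, map_neg, map_mul, AlgHom.commutes, mul_add, ← mul_assoc,
        ← Algebra.commutes (q - 1), Algebra.commutes q]
      noncomm_ring
  refine ⟨RingQuot.liftAlgHom k ⟨FreeAlgebra.lift k g, hrel⟩, fun j => ?_, fun r => ?_⟩
  · exact (RingQuot.liftAlgHom_mkAlgHom_apply k _ _ _).trans (gX j)
  · exact (RingQuot.liftAlgHom_mkAlgHom_apply k _ _ _).trans (gT r)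

end HeckeHom

end

noncomputable section

open OrbitCoef RatField

/-! ### Values at the origin and symmetric Laurent polynomials -/

namespace LocalRing

variable {k : Type*} [Field k] {n : ℕ}

theorem exists_value : ∃ v : LocalRing k n →ₐ[k] k,
    ∀ p, v (poly k n p) = MvPolynomial.constantCoeff p := by
  have h : ∀ p : MvPolynomial (Fin n) k, MvPolynomial.aeval (0 : Fin n → k) p =
      MvPolynomial.constantCoeff p := fun p => MvPolynomial.aeval_zero p
  obtain ⟨v, hv⟩ := exists_lift (MvPolynomial.aeval (0 : Fin n → k)) (fun p hp => by
    rw [h]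
    exact isUnit_iff_ne_zero.2 hp)
  exact ⟨v, fun p => by rw [hv, h]⟩

variable (k n) in
/-- The value at the origin. -/
def value : LocalRing k n →ₐ[k] k := exists_value.choose

theorem value_poly (p : MvPolynomial (Fin n) k) :
    value k n (poly k n p) = MvPolynomial.constantCoeff p := exists_value.choose_spec p

/-- Clearing a unit denominator leaves a polynomial without constant term. -/
theorem mem_map_of_value {f : LocalRing k n} (h : value k n f = 0) :
    f ∈ Ideal.span (Set.range fun j => poly k n (MvPolynomial.X j)) := by
  obtain ⟨a, s, hs, h'⟩ := exists_mul_eq_poly f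
  have ha : MvPolynomial.constantCoeff a = 0 := by
    rw [← value_poly, ← h', map_mul, h, zero_mul]
  rw [← Ideal.mul_unit_mem_iff_mem _ (isUnit_poly hs), h']
  have := Ideal.mem_map_of_mem (poly k n) (MvPolynomial.mem_span_X_of_constantCoeff ha)
  rwa [Ideal.map_span, ← Set.range_comp] at this

end LocalRing

theorem Finsupp.sum_comp_equiv {N R k M : Type*} [Zero k] [AddCommMonoid M] {f : (N → R) →₀ k}
    (σ : Equiv.Perm N) (hf : ∀ a, f (a ∘ σ) = f a) (h : (N → R) → k → M) :
    (f.sum fun a c => h (a ∘ σ) c) = f.sum h := by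
  have h1 : ∀ a : N → R, (a ∘ σ) ∘ σ.symm = a := fun a => by ext; simp
  have h2 : ∀ a : N → R, (a ∘ σ.symm) ∘ σ = a := fun a => by ext; simp
  refine Finset.sum_nbij' (fun a => a ∘ σ) (fun a => a ∘ σ.symm) ?_ ?_ (fun a _ => h1 a)
    (fun a _ => h2 a) (fun a _ => by rw [hf])
  · intro a ha
    rw [Finsupp.mem_support_iff] at ha ⊢
    rwa [hf]
  · intro a ha
    rw [Finsupp.mem_support_iff] at ha ⊢
    rwa [← hf, h2]

namespace OrbitCoef

section

variable {k : Type*} [Field k] {m e : ℕ} {i : Fin (m + 1) → ZMod e}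

variable (k i) in
/-- The value at the origin at an element of the orbit. -/
def value (u : SymOrbit i) : OrbitCoef k i →ₐ[k] k := (LocalRing.value k _).comp (eval k i u)

theorem value_x (u : SymOrbit i) (j : Fin (m + 1)) : value k i u (x k i j) = 0 :=
  (LocalRing.value_poly _).trans (by simp)

theorem value_idem (u v : SymOrbit i) : value k i v (idem k u) = if v = u then 1 else 0 := by
  rw [value, AlgHom.comp_apply, eval_idem]
  split_ifs <;> simp

theorem mem_span_x {F : OrbitCoef k i} (h : ∀ u, value k i u F = 0) :
    F ∈ Ideal.span (Set.range (x k i)) := by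
  rw [eq_sum F]
  refine Ideal.sum_mem _ fun u _ => Ideal.mul_mem_right _ _ ?_
  have := Ideal.mem_map_of_mem (const k i) (LocalRing.mem_map_of_value (h u))
  rwa [Ideal.map_span, ← Set.range_comp] at this

/-- The action of a permutation as a homomorphism. -/
def actHom (σ : Equiv.Perm (Fin (m + 1))) : OrbitCoef k i →ₐ[k] OrbitCoef k i where
  toFun := act σ
  map_one' := act_one σ
  map_mul' := act_mul σ
  map_zero' := by simpa using act_algebraMap (i := i) σ (0 : k)
  map_add' := act_add σ
  commutes' := act_algebraMap σ

theorem exists_span_pow_le_ker {B : Type*} [Ring B] [Algebra k B] (g : OrbitCoef k i →ₐ[k] B)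
    (h : ∀ j, IsNilpotent (g (x k i j))) :
    ∃ N : ℕ, ∀ F ∈ Ideal.span (Set.range (x k i)) ^ N, g F = 0 := by
  have h1 : Ideal.span (Set.range (x k i)) ≤ (RingHom.ker g).radical := by
    rw [Ideal.span_le]
    rintro _ ⟨j, rfl⟩
    obtain ⟨N, hN⟩ := h j
    exact ⟨N, by rw [RingHom.mem_ker, map_pow, hN]⟩
  obtain ⟨N, hN⟩ := Ideal.exists_pow_le_of_le_radical_of_fg h1
    (Submodule.fg_span (Set.finite_range _))
  exact ⟨N, fun p hp => hN hp⟩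

end

variable {k : Type*} [Field k] {q : k} {m : ℕ} {i : Fin (m + 1) → ZMod (orderOf q)}

theorem eval_X (u : SymOrbit i) (j : Fin (m + 1)) : eval k i u (X i j) =
    algebraMap k _ (qpow q (u.1 j)) * (1 - LocalRing.poly k _ (MvPolynomial.X j)) := by
  refine LocalRing.val_injective ?_
  rw [← toFun_apply, toFun_X, map_mul, map_sub, map_one, LocalRing.val_algebraMap,
    LocalRing.val_poly]
  rfl

theorem value_X (u : SymOrbit i) (j : Fin (m + 1)) :
    value k i u (X i j) = qpow q (u.1 j) := by
  rw [value, AlgHom.comp_apply, eval_X, map_mul, map_sub, map_one, AlgHom.commutes,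
    LocalRing.value_poly, MvPolynomial.constantCoeff_X]
  simp

variable (i) in
/-- The Laurent polynomial in the `X_j` with coefficient function `f`. -/
def laurent (hq : q ≠ 0) (f : (Fin (m + 1) → ℤ) →₀ k) : OrbitCoef k i :=
  f.sum fun a c => c • ((∏ j, XUnit i hq j ^ a j : (OrbitCoef k i)ˣ) : OrbitCoef k i)

theorem value_laurent (hq : q ≠ 0) (f : (Fin (m + 1) → ℤ) →₀ k) (u : SymOrbit i) :
    value k i u (laurent i hq f) = Hecke.laurentEval q u.1 f := by
  rw [laurent, Hecke.laurentEval, map_finsuppSum]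
  refine Finsupp.sum_congr fun a _ => ?_
  rw [map_smul, smul_eq_mul]
  congr 1
  have : ((Units.map (value k i u : OrbitCoef k i →* k) (∏ j, XUnit i hq j ^ a j) : kˣ) : k) =
      ∏ j, qpow q (u.1 j) ^ a j := by
    rw [map_prod, Units.coe_prod]
    refine Finset.prod_congr rfl fun j _ => ?_
    rw [map_zpow, Units.val_zpow_eq_zpow_val, ← value_X u j]
    rfl
  exact this

/-- A permutation moves `X_j` to `X_{σ j}`, and the symmetry of the coefficient function undoes this
by reindexing the exponents. -/
theorem act_laurent (hq : q ≠ 0) {f : (Fin (m + 1) → ℤ) →₀ k}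
    (hf : ∀ (σ : Equiv.Perm (Fin (m + 1))) (a : Fin (m + 1) → ℤ), f (a ∘ σ) = f a)
    (σ : Equiv.Perm (Fin (m + 1))) : act σ (laurent i hq f) = laurent i hq f := by
  set α : OrbitCoef k i →ₐ[k] OrbitCoef k i := actHom σ
  change α _ = _
  have h : ∀ j, Units.map (α : OrbitCoef k i →* OrbitCoef k i) (XUnit i hq j) =
      XUnit i hq (σ j) := fun j => Units.ext (act_X σ j)
  rw [laurent, map_finsuppSum, ← Finsupp.sum_comp_equiv σ.symm (hf σ.symm)
    fun a c => c • ((∏ j, XUnit i hq j ^ a j : (OrbitCoef k i)ˣ) : OrbitCoef k i)]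
  refine Finsupp.sum_congr fun a _ => ?_
  rw [map_smul]
  congr 1
  have : Units.map (α : OrbitCoef k i →* OrbitCoef k i) (∏ j, XUnit i hq j ^ a j) =
      ∏ j, XUnit i hq j ^ (a ∘ σ.symm) j := by
    rw [map_prod, ← Equiv.prod_comp σ fun j => XUnit i hq j ^ (a ∘ σ.symm) j]
    refine Finset.prod_congr rfl fun j _ => ?_
    rw [map_zpow, h, Function.comp_apply, Equiv.symm_apply_apply]
  exact congrArg Units.val this

theorem map_laurent {B : Type*} [Ring B] [Algebra k B] {ι : OrbitCoef k i →ₐ[k] B} (hq : q ≠ 0)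
    {φ : Hecke q m →ₐ[k] B} (hφ : ∀ j, φ (Hecke.X q j : Hecke q m) = ι (X i j))
    (f : (Fin (m + 1) → ℤ) →₀ k) : φ (Hecke.laurent q f) = ι (laurent i hq f) := by
  rw [laurent, Hecke.laurent, map_finsuppSum, map_finsuppSum]
  refine Finsupp.sum_congr fun a _ => ?_
  rw [map_smul, map_smul]
  congr 1
  have h : ∀ j, Units.map (φ : Hecke q m →* B) (Hecke.X q j) =
      Units.map (ι : OrbitCoef k i →* B) (XUnit i hq j) := fun j => Units.ext (hφ j)
  have : Units.map (φ : Hecke q m →* B) (List.ofFn fun j => Hecke.X q j ^ a j).prod =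
      Units.map (ι : OrbitCoef k i →* B) (∏ j, XUnit i hq j ^ a j) := by
    rw [map_list_prod, ← List.prod_ofFn, map_list_prod, List.map_ofFn, List.map_ofFn]
    congr 2
    ext1 j
    rw [Function.comp_apply, Function.comp_apply, map_zpow, map_zpow, h]
  exact congrArg Units.val this

end OrbitCoef

namespace Hecke

variable {k : Type*} [Field k] {q : k} {m : ℕ} {i : Fin (m + 1) → ZMod (orderOf q)}

/-- A symmetric Laurent polynomial vanishing at `i` thus vanishes on the whole orbit, which puts its
coefficient version into the ideal generated by the `x_j`. -/
theorem laurentEval_comp {f : (Fin (m + 1) → ℤ) →₀ k}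
    (hf : ∀ (σ : Equiv.Perm (Fin (m + 1))) (a : Fin (m + 1) → ℤ), f (a ∘ σ) = f a)
    (u : SymOrbit i) : laurentEval q u.1 f = laurentEval q i f := by
  obtain ⟨_, σ, rfl⟩ := u
  rw [laurentEval, laurentEval, ← Finsupp.sum_comp_equiv σ.symm (hf σ.symm)
    fun a c => c * ∏ j, qpow q (i j) ^ a j]
  refine Finsupp.sum_congr fun a _ => ?_
  rw [← Equiv.prod_comp σ fun j => qpow q (i j) ^ (a ∘ σ.symm) j]
  simp

theorem mem_of_generators {S : Subalgebra k (Hecke q m)} (hT : ∀ r, T q r ∈ S)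
    (hX : ∀ j, ((X q j : (Hecke q m)ˣ) : Hecke q m) ∈ S)
    (hXinv : ∀ j, (((X q j)⁻¹ : (Hecke q m)ˣ) : Hecke q m) ∈ S) (a : Hecke q m) : a ∈ S := by
  obtain ⟨b, rfl⟩ := RingQuot.mkAlgHom_surjective k (Rel q m) a
  induction b using FreeAlgebra.induction with
  | grade0 c => rw [AlgHom.commutes]; exact S.algebraMap_mem c
  | grade1 g =>
    cases g with
    | T r => exact hT r
    | X j => exact hX j
    | Xinv j => exact hXinv j
  | mul a b ha hb => rw [map_mul]; exact mul_mem ha hb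
  | add a b ha hb => rw [map_add]; exact add_mem ha hb

theorem map_Xinv {B : Type*} [Ring B] [Algebra k B] {ι : OrbitCoef k i →ₐ[k] B} (hq : q ≠ 0)
    {φ : Hecke q m →ₐ[k] B} (hφ : ∀ j, φ (Hecke.X q j : Hecke q m) = ι (OrbitCoef.X i j))
    (j : Fin (m + 1)) : φ (((X q j)⁻¹ : (Hecke q m)ˣ) : Hecke q m) =
      ι ((XUnit i hq j)⁻¹ : (OrbitCoef k i)ˣ) := by
  have h : Units.map (φ : Hecke q m →* B) (Hecke.X q j) =
      Units.map (ι : OrbitCoef k i →* B) (XUnit i hq j) := Units.ext (hφ j)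
  have := congrArg (fun u : Bˣ => (u⁻¹ : Bˣ)) h
  simp only [← map_inv] at this
  exact congrArg Units.val this

/-- A homomorphism which is given on the `X_j` by coefficients, and under which the `x_j` become
nilpotent, is continuous. -/
theorem exists_idealM_pow_le_ker {B D : Type*} [Ring B] [Algebra k B] [Ring D] [Algebra k D]
    {ι : OrbitCoef k i →ₐ[k] B} (hq : q ≠ 0) (φ : Hecke q m →ₐ[k] B)
    (hX : ∀ j, φ (X q j : Hecke q m) = ι (OrbitCoef.X i j))
    (hT : ∀ r F, act (Equiv.swap r.castSucc r.succ) F = F → φ (T q r) * ι F = ι F * φ (T q r))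
    (g : B →ₐ[k] D) (hx : ∀ j, IsNilpotent (g (ι (x k i j)))) :
    ∃ N, ∀ a ∈ idealM q i ^ N, g (φ a) = 0 := by
  obtain ⟨N, hN⟩ := exists_span_pow_le_ker (g.comp ι) hx
  -- `S n` consists of the images of the invariant elements of `(x_1, …, x_n)^n`: invariance makes
  -- them commute with the image of the Hecke algebra, and each generator of the ideal raises the
  -- exponent by one.
  refine ⟨N, TwoSidedIdeal.map_pow_span_eq_zero (g.comp φ).toRingHom
    (S := fun n => {s | ∃ F ∈ Ideal.span (Set.range (x k i)) ^ n,
      (∀ σ, act σ F = F) ∧ s = g (ι F)}) ?_ ?_ ?_ ?_⟩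
  · rintro n _ ⟨F, -, hF, rfl⟩ a
    have : a ∈ (Subalgebra.centralizer k {g (ι F)}).comap (g.comp φ) := by
      refine mem_of_generators (fun r => ?_) (fun j => ?_) (fun j => ?_) a
      all_goals
        rw [Subalgebra.mem_comap, Subalgebra.mem_centralizer_iff]
        rintro _ rfl
        rw [AlgHom.comp_apply]
      · rw [← map_mul, ← map_mul, hT r F (hF _)]
      · rw [hX, ← map_mul, ← map_mul, ← map_mul, ← map_mul, mul_comm]
      · rw [map_Xinv hq hX, ← map_mul, ← map_mul, ← map_mul, ← map_mul, mul_comm]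
    rw [Subalgebra.mem_comap, Subalgebra.mem_centralizer_iff] at this
    exact this _ rfl
  · rintro _ ⟨f, hf, hf0, rfl⟩ n _ ⟨F, hF, hF', rfl⟩
    refine ⟨OrbitCoef.laurent i hq f * F, ?_, fun σ => ?_, ?_⟩
    · rw [pow_succ']
      refine Ideal.mul_mem_mul (mem_span_x fun u => ?_) hF
      rw [value_laurent, laurentEval_comp hf, hf0]
    · rw [act_mul, act_laurent hq hf, hF']
    · rw [map_mul, map_mul]
      congr 1
      exact congrArg g (map_laurent hq hX f)
  · rintro _ ⟨F, hF, -, rfl⟩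
    exact hN F hF
  · exact ⟨1, by simp, act_one, by rw [map_one, map_one]⟩

end Hecke

end

noncomputable section

open OrbitCoef

/-! ### Polynomials in the affine Hecke algebra -/

namespace Hecke

variable {k : Type*} [Field k] {q : k} {m : ℕ} {i : Fin (m + 1) → ZMod (orderOf q)}

variable (q m) in
theorem exists_polyHom : ∃ μ : MvPolynomial (Fin (m + 1)) k →ₐ[k] Hecke q m,
    ∀ j, μ (MvPolynomial.X j) = X q j :=
  MvPolynomial.exists_algHom_of_commute _ fun a b => by
    have := RingQuot.mkAlgHom_rel k (Rel.X_comm (q := q) a b)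
    rwa [map_mul, map_mul] at this

variable (q m) in
/-- Polynomials in the `X_j`. -/
def polyHom : MvPolynomial (Fin (m + 1)) k →ₐ[k] Hecke q m := (exists_polyHom q m).choose

theorem polyHom_X (j : Fin (m + 1)) : polyHom q m (MvPolynomial.X j) = X q j :=
  (exists_polyHom q m).choose_spec j

/-- The point `(q^{u_1}, …, q^{u_n})`. -/
def point (u : Fin (m + 1) → ZMod (orderOf q)) (j : Fin (m + 1)) : k := qpow q (u j)

theorem polyHom_mem_kerChi {p : MvPolynomial (Fin (m + 1)) k}
    (hp : ∀ σ : Equiv.Perm (Fin (m + 1)), MvPolynomial.rename σ p = p)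
    (h0 : MvPolynomial.eval (point i) p = 0) : polyHom q m p ∈ kerChi q i := by
  let ε : (Fin (m + 1) →₀ ℕ) ↪ (Fin (m + 1) → ℤ) :=
    ⟨fun a j => a j, fun a b hab => Finsupp.ext fun j => by simpa using congrFun hab j⟩
  have hε : ∀ a j, ε a j = (a j : ℤ) := fun _ _ => rfl
  let g : (Fin (m + 1) →₀ ℕ) →₀ k := Finsupp.onFinset p.support (fun a => p.coeff a) (by simp)
  have hg : g.support = p.support := by
    ext a
    rw [Finsupp.mem_support_iff, MvPolynomial.mem_support_iff]
    rfl
  refine ⟨Finsupp.embDomain ε g, fun σ a => ?_, ?_, ?_⟩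
  · by_cases ha : a ∈ Set.range ε
    · obtain ⟨b, rfl⟩ := ha
      have h1 : ε b ∘ σ = ε (b.mapDomain σ.symm) := by
        ext j
        obtain ⟨j, rfl⟩ := σ.symm.surjective j
        rw [Function.comp_apply, Equiv.apply_symm_apply, hε, hε,
          Finsupp.mapDomain_apply σ.symm.injective]
      rw [h1, Finsupp.embDomain_apply_self, Finsupp.embDomain_apply_self]
      change p.coeff _ = p.coeff _
      conv_lhs => rw [← hp σ.symm]
      exact MvPolynomial.coeff_rename_mapDomain _ σ.symm.injective _ _
    · have ha' : a ∘ σ ∉ Set.range ε := by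
        rintro ⟨b, hb⟩
        refine ha ⟨b.mapDomain σ, ?_⟩
        ext j
        obtain ⟨j, rfl⟩ := σ.surjective j
        rw [hε, Finsupp.mapDomain_apply σ.injective, ← hε, hb, Function.comp_apply]
      rw [Finsupp.embDomain_of_notMem_range _ _ _ ha, Finsupp.embDomain_of_notMem_range _ _ _ ha']
  · rw [laurentEval, Finsupp.sum_embDomain, Finsupp.sum, hg, ← h0, MvPolynomial.eval_eq']
    refine Finset.sum_congr rfl fun a _ => ?_
    congr 1
    exact Finset.prod_congr rfl fun j _ => zpow_natCast _ _
  · rw [laurent, Finsupp.sum_embDomain, Finsupp.sum, hg, MvPolynomial.algHom_eq_sum]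
    refine Finset.sum_congr rfl fun a _ => ?_
    change p.coeff a • _ = p.coeff a • _
    congr 1
    rw [← Units.coeHom_apply, map_list_prod, List.map_ofFn]
    congr 2
    ext1 j
    rw [polyHom_X, Function.comp_apply, Units.coeHom_apply]
    change _ = ((X q j ^ (a j : ℤ) : (Hecke q m)ˣ) : Hecke q m)
    rw [zpow_natCast, Units.val_pow_eq_pow_val]

/-- A polynomial which vanishes on the orbit is nilpotent modulo the ideal. -/
theorem polyHom_pow_mem {p : MvPolynomial (Fin (m + 1)) k}
    (hp : ∀ u : SymOrbit i, MvPolynomial.eval (point u.1) p = 0) :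
    polyHom q m p ^ Fintype.card (Equiv.Perm (Fin (m + 1))) ∈ idealM q i := by
  -- The coefficients of `∏_σ (t - σ p)` are symmetric, and at the point `i` the product becomes a
  -- power of `t`. So the lower coefficients lie in the kernel of the central character, and `P(p) =
  -- 0` expresses the top power of `p` through them.
  let P : Polynomial (MvPolynomial (Fin (m + 1)) k) :=
    ∏ σ : Equiv.Perm (Fin (m + 1)), (Polynomial.X - Polynomial.C (MvPolynomial.rename σ p))
  have hdeg : P.natDegree = Fintype.card (Equiv.Perm (Fin (m + 1))) :=
    Polynomial.natDegree_finsetProd_X_sub_C_eq_card _ _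
  have hmonic : P.Monic := Polynomial.monic_prod_X_sub_C _ _
  have hsymm : ∀ (τ : Equiv.Perm (Fin (m + 1))) (j : ℕ),
      MvPolynomial.rename τ (P.coeff j) = P.coeff j := by
    intro τ j
    have : P.map (MvPolynomial.rename (R := k) τ).toRingHom = P := by
      rw [Polynomial.map_prod]
      refine Eq.trans ?_ (Equiv.prod_comp (Equiv.mulLeft τ) fun σ : Equiv.Perm (Fin (m + 1)) =>
        (Polynomial.X - Polynomial.C (MvPolynomial.rename σ p)))
      refine Finset.prod_congr rfl fun σ _ => ?_
      have h : (MvPolynomial.rename (R := k) τ).toRingHom (MvPolynomial.rename σ p) =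
        MvPolynomial.rename (τ * σ) p := MvPolynomial.rename_rename σ τ p
      rw [Polynomial.map_sub, Polynomial.map_X, Polynomial.map_C, h]
      rfl
    conv_rhs => rw [← this, Polynomial.coeff_map]
    rfl
  have hval : P.map (MvPolynomial.eval (point i)) =
      Polynomial.X ^ Fintype.card (Equiv.Perm (Fin (m + 1))) := by
    rw [Polynomial.map_prod, Finset.prod_congr rfl (g := fun _ => Polynomial.X),
      Finset.prod_const, Finset.card_univ]
    intro σ _
    rw [Polynomial.map_sub, Polynomial.map_X, Polynomial.map_C, MvPolynomial.eval_rename,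
      show MvPolynomial.eval (point i ∘ σ) p = 0 from hp ⟨i ∘ σ, σ, rfl⟩, map_zero, sub_zero]
  have heval : P.eval p = 0 := by
    rw [Polynomial.eval_prod]
    refine Finset.prod_eq_zero (Finset.mem_univ 1) ?_
    simp
  rw [Polynomial.eval_eq_sum_range, Finset.sum_range_succ, hmonic.coeff_natDegree, one_mul,
    hdeg] at heval
  rw [← map_pow, eq_neg_of_add_eq_zero_right heval, map_neg, map_sum]
  refine neg_mem (sum_mem fun j hj => ?_)
  rw [map_mul]
  refine Ideal.mul_mem_right _ _ (TwoSidedIdeal.mem_asIdeal.2 (TwoSidedIdeal.subset_span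
    (polyHom_mem_kerChi (fun σ => hsymm σ j) ?_)))
  have := congrArg (fun Q => Polynomial.coeff Q j) hval
  simp only [Polynomial.coeff_map, Polynomial.coeff_X_pow] at this
  rw [this, if_neg (Finset.mem_range.1 hj).ne]

end Hecke

/-! ### Idempotents by approximation -/

section Approx

variable {R : Type*} [CommRing R]

/-- A polynomial expression which is close to an idempotent if `L` is. -/
def idemApprox (M : ℕ) (L : R) : R := 1 - (1 - L ^ M) ^ M

/-- With the companion divisibility by `(1 - L)^M`, this shows that `idemApprox M L` is idempotent
modulo `(L (1 - L))^M`. -/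
theorem pow_dvd_idemApprox (M : ℕ) (L : R) : L ^ M ∣ idemApprox M L := by
  have := sub_dvd_pow_sub_pow 1 (1 - L ^ M) M
  rwa [sub_sub_cancel, one_pow] at this

theorem pow_dvd_one_sub_idemApprox (M : ℕ) (L : R) : (1 - L) ^ M ∣ 1 - idemApprox M L := by
  rw [idemApprox, sub_sub_cancel]
  refine pow_dvd_pow_of_dvd ?_ M
  simpa using sub_dvd_pow_sub_pow 1 L M

end Approx


/-! ### The weight idempotents -/

namespace HeckeHat

open Hecke

variable {k : Type*} [Field k] {q : k} {m : ℕ} {i : Fin (m + 1) → ZMod (orderOf q)}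

variable (i) in
/-- Polynomials in the `X_j`. -/
def ofPoly : MvPolynomial (Fin (m + 1)) k →ₐ[k] HeckeHat q i := (of q i).comp (polyHom q m)

theorem ofPoly_X (j : Fin (m + 1)) : ofPoly i (MvPolynomial.X j) = X q i j :=
  congrArg (of q i) (polyHom_X j)

variable (m) in
/-- An exponent for level `l`. -/
def exponent (l : ℕ) : ℕ := Fintype.card (Equiv.Perm (Fin (m + 1))) * l

theorem exponent_mono {l l' : ℕ} (h : l ≤ l') : exponent m l ≤ exponent m l' :=
  Nat.mul_le_mul_left _ h

variable (i) in
/-- The polynomials which vanish on the orbit. -/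
def Vanishes (p : MvPolynomial (Fin (m + 1)) k) : Prop :=
  ∀ u : SymOrbit i, MvPolynomial.eval (point u.1) p = 0

/-- The power of `p` with exponent the number of permutations is in the ideal, whence the factor `l`
in `exponent`. -/
theorem Vanishes.polyHom_mem {p p' : MvPolynomial (Fin (m + 1)) k} (hp : Vanishes i p) {l M : ℕ}
    (hM : exponent m l ≤ M) (h : p ^ M ∣ p') : polyHom q m p' ∈ idealM q i ^ l := by
  obtain ⟨c, rfl⟩ := (pow_dvd_pow p hM).trans h
  rw [map_mul, map_pow, exponent, pow_mul]
  exact Ideal.mul_mem_right _ _ (Ideal.pow_mem_pow (polyHom_pow_mem hp) l)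

theorem Vanishes.proj_eq_zero {p p' : MvPolynomial (Fin (m + 1)) k} (hp : Vanishes i p) {l M : ℕ}
    (hM : exponent m l ≤ M) (h : p ^ M ∣ p') : proj q i l (ofPoly i p') = 0 :=
  Ideal.Quotient.eq_zero_iff_mem.2 (hp.polyHom_mem hM h)

/-- Lagrange interpolation: for each `v ≠ u`, a linear factor in a coordinate where the two differ,
normalized to `1` at `u`. -/
theorem exists_separate (hq : q ≠ 0) (u : SymOrbit i) : ∃ L : MvPolynomial (Fin (m + 1)) k,
    ∀ v : SymOrbit i, MvPolynomial.eval (point v.1) L = if v = u then 1 else 0 := by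
  have h : ∀ v : SymOrbit i, ∃ L : MvPolynomial (Fin (m + 1)) k,
      MvPolynomial.eval (point u.1) L = 1 ∧ (v ≠ u → MvPolynomial.eval (point v.1) L = 0) := by
    intro v
    by_cases hv : v = u
    · exact ⟨1, map_one _, fun h => absurd hv h⟩
    have : ∃ j, v.1 j ≠ u.1 j := by
      by_contra! h
      exact hv (Subtype.ext (funext h))
    obtain ⟨j, hj⟩ := this
    have hne : qpow q (u.1 j) - qpow q (v.1 j) ≠ 0 :=
      sub_ne_zero.2 fun h => hj (qpow_injective hq h).symm
    refine ⟨MvPolynomial.C (qpow q (u.1 j) - qpow q (v.1 j))⁻¹ *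
      (MvPolynomial.X j - MvPolynomial.C (qpow q (v.1 j))), ?_, fun _ => ?_⟩
    · simp only [map_mul, map_sub, MvPolynomial.eval_X, MvPolynomial.eval_C]
      exact inv_mul_cancel₀ hne
    · simp only [map_mul, map_sub, MvPolynomial.eval_X, MvPolynomial.eval_C]
      rw [point, sub_self, mul_zero]
  choose L h1 h2 using h
  refine ⟨∏ v, L v, fun w => ?_⟩
  rw [map_prod]
  split_ifs with hw
  · subst hw
    exact Finset.prod_eq_one fun v _ => h1 v
  · exact Finset.prod_eq_zero (Finset.mem_univ w) (h2 w hw)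

/-- A polynomial with value `1` at `u` which vanishes at the other elements of the orbit. -/
def separate (hq : q ≠ 0) (u : SymOrbit i) : MvPolynomial (Fin (m + 1)) k :=
  (exists_separate hq u).choose

theorem eval_separate (hq : q ≠ 0) (u v : SymOrbit i) :
    MvPolynomial.eval (point v.1) (separate hq u) = if v = u then 1 else 0 :=
  (exists_separate hq u).choose_spec v

theorem vanishes_separate_mul (hq : q ≠ 0) (u : SymOrbit i) :
    Vanishes i (separate hq u * (1 - separate hq u)) := fun v => by
  rw [map_mul, map_sub, map_one, eval_separate]
  split_ifs <;> simp

/-- The difference of two approximants `a`, `b` is `a (1 - b) - b (1 - a)`, and both products are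
divisible by a high power of `L (1 - L)`, which vanishes on the orbit. Hence the approximants
converge. -/
theorem proj_ofPoly_idemApprox (hq : q ≠ 0) (u : SymOrbit i) {l M M' : ℕ}
    (hM : exponent m l ≤ M) (hM' : exponent m l ≤ M') :
    polyHom q m (idemApprox M (separate hq u)) - polyHom q m (idemApprox M' (separate hq u)) ∈
      idealM q i ^ l := by
  have key : ∀ {M M'}, exponent m l ≤ M → exponent m l ≤ M' → polyHom q m
      (idemApprox M (separate hq u) * (1 - idemApprox M' (separate hq u))) ∈ idealM q i ^ l := by
    intro M M' hM hM'
    refine (vanishes_separate_mul hq u).polyHom_mem le_rfl ?_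
    rw [mul_pow]
    exact mul_dvd_mul ((pow_dvd_pow _ hM).trans (pow_dvd_idemApprox M _))
      ((pow_dvd_pow _ hM').trans (pow_dvd_one_sub_idemApprox M' _))
  rw [← map_sub]
  have h : idemApprox M (separate hq u) - idemApprox M' (separate hq u) =
      idemApprox M (separate hq u) * (1 - idemApprox M' (separate hq u)) -
      idemApprox M' (separate hq u) * (1 - idemApprox M (separate hq u)) := by ring
  rw [h, map_sub]
  exact sub_mem (key hM hM') (key hM' hM)

theorem exists_weight (hq : q ≠ 0) (u : SymOrbit i) : ∃ e : HeckeHat q i, ∀ l M,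
    exponent m l ≤ M → proj q i l e = proj q i l (ofPoly i (idemApprox M (separate hq u))) := by
  obtain ⟨e, he⟩ := IdealCompletion.exists_proj_eq_mk (k := k)
    (hJ := Hecke.idealM_pow_antitone q i)
    (fun l => polyHom q m (idemApprox (exponent m l) (separate hq u)))
    (fun l l' h => proj_ofPoly_idemApprox hq u (exponent_mono h) le_rfl)
  exact ⟨e, fun l M hM => (he l).trans
    (Ideal.Quotient.eq.2 (proj_ofPoly_idemApprox hq u le_rfl hM))⟩

/-- The weight idempotent of an element of the orbit. -/
def weight (hq : q ≠ 0) (u : SymOrbit i) : HeckeHat q i := (exists_weight hq u).choose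

theorem proj_weight (hq : q ≠ 0) (u : SymOrbit i) {l M : ℕ} (hM : exponent m l ≤ M) :
    proj q i l (weight hq u) = proj q i l (ofPoly i (idemApprox M (separate hq u))) :=
  (exists_weight hq u).choose_spec l M hM

theorem ext_proj {y z : HeckeHat q i} (h : ∀ l, proj q i l y = proj q i l z) : y = z :=
  IdealCompletion.ext_proj h

theorem weight_mul (hq : q ≠ 0) (u v : SymOrbit i) :
    weight hq u * weight hq v = if u = v then weight hq u else 0 := by
  refine ext_proj fun l => ?_
  rw [map_mul, proj_weight hq u le_rfl, proj_weight hq v le_rfl, ← map_mul, ← map_mul]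
  split_ifs with h
  · subst h
    rw [proj_weight hq u le_rfl, ← sub_eq_zero, ← map_sub, ← map_sub]
    refine (vanishes_separate_mul hq u).proj_eq_zero le_rfl ?_
    rw [← dvd_neg, neg_sub, ← mul_one_sub, mul_pow]
    exact mul_dvd_mul (pow_dvd_idemApprox _ _) (pow_dvd_one_sub_idemApprox _ _)
  · rw [map_zero]
    refine Vanishes.proj_eq_zero (p := separate hq u * separate hq v) (fun w => ?_) le_rfl ?_
    · rw [map_mul, eval_separate, eval_separate]
      split_ifs with h1 h2
      · exact absurd (h1.symm.trans h2) h
      all_goals simp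
    · rw [mul_pow]
      exact mul_dvd_mul (pow_dvd_idemApprox _ _) (pow_dvd_idemApprox _ _)

theorem ofPoly_mul_weight (hq : q ≠ 0) (u : SymOrbit i) (p : MvPolynomial (Fin (m + 1)) k) :
    ofPoly i p * weight hq u = weight hq u * ofPoly i p := by
  refine ext_proj fun l => ?_
  rw [map_mul, map_mul, proj_weight hq u le_rfl, ← map_mul, ← map_mul, ← map_mul, ← map_mul,
    mul_comm]

/-- At each level the approximants live in a commutative quotient of the polynomial ring, where
orthogonal idempotents with `∏ (1 - e_u) = 0` sum to one. That product is divisible by a power of `∏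
(1 - L_u)`, which vanishes on the orbit. -/
theorem weight_sum (hq : q ≠ 0) : ∑ u : SymOrbit i, weight hq u = 1 := by
  refine ext_proj fun l => ?_
  set A : SymOrbit i → MvPolynomial (Fin (m + 1)) k := fun u =>
    idemApprox (exponent m l) (separate hq u) with hA
  set f : MvPolynomial (Fin (m + 1)) k →ₐ[k] _ := (proj q i l).comp (ofPoly i) with hf
  have hw : ∀ u, proj q i l (weight hq u) = f (A u) := fun u => proj_weight hq u le_rfl
  have hπ : ∀ a b, Ideal.Quotient.mk (RingHom.ker f) a = Ideal.Quotient.mk (RingHom.ker f) b ↔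
      f a = f b := fun a b => by
    rw [Ideal.Quotient.eq, RingHom.mem_ker, map_sub, sub_eq_zero]
  have hmul : ∀ u v, f (A u * A v) = f (if u = v then A u else 0) := fun u v => by
    rw [map_mul, ← hw, ← hw, ← map_mul, weight_mul]
    split_ifs
    · exact hw u
    · rw [map_zero, map_zero]
  have horth : OrthogonalIdempotents fun u => Ideal.Quotient.mk (RingHom.ker f) (A u) := by
    refine ⟨fun u => ?_, fun u v huv => ?_⟩
    · have := hmul u u
      rwa [if_pos rfl, ← hπ, map_mul] at this
    · have := hmul u v
      rwa [if_neg huv, ← hπ, map_mul, map_zero] at this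
  have hprod : ∏ u, (1 - Ideal.Quotient.mk (RingHom.ker f) (A u)) = 0 := by
    have h : f (∏ u, (1 - A u)) = f 0 := by
      rw [map_zero]
      refine Vanishes.proj_eq_zero (p := ∏ u : SymOrbit i, (1 - separate hq u)) (fun v => ?_)
        (M := exponent m l) le_rfl ?_
      · rw [map_prod]
        refine Finset.prod_eq_zero (Finset.mem_univ v) ?_
        rw [map_sub, map_one, eval_separate, if_pos rfl, sub_self]
      · rw [← Finset.prod_pow]
        exact Finset.prod_dvd_prod_of_dvd _ _ fun u _ => pow_dvd_one_sub_idemApprox _ _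
    rw [← hπ, map_prod, map_zero] at h
    simpa only [map_sub, map_one] using h
  have hsum := (CompleteOrthogonalIdempotents.of_prod_one_sub horth hprod).complete
  rw [← map_sum, ← map_one (Ideal.Quotient.mk (RingHom.ker f)), hπ, map_sum, map_one] at hsum
  rw [map_sum, map_one, ← hsum]
  exact Finset.sum_congr rfl fun u _ => hw u

theorem proj_pow_mul_weight (hq : q ≠ 0) (u : SymOrbit i) {p : MvPolynomial (Fin (m + 1)) k}
    (hp : MvPolynomial.eval (point u.1) p = 0) {l M : ℕ} (hM : exponent m l ≤ M) :
    proj q i l (ofPoly i p ^ M * weight hq u) = 0 := by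
  rw [map_mul, proj_weight hq u hM, ← map_mul, ← map_pow, ← map_mul]
  refine Vanishes.proj_eq_zero (p := p * separate hq u) (fun w => ?_) hM ?_
  · rw [map_mul, eval_separate]
    split_ifs with h
    · rw [h, hp, zero_mul]
    · rw [mul_zero]
  · rw [mul_pow]
    exact mul_dvd_mul dvd_rfl (pow_dvd_idemApprox _ _)

theorem X_sub_eq (u : SymOrbit i) (j : Fin (m + 1)) :
    X q i j - algebraMap k _ (qpow q (u.1 j)) =
      ofPoly i (MvPolynomial.X j - MvPolynomial.C (qpow q (u.1 j))) := by
  rw [map_sub, ofPoly_X]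
  congr 1
  exact ((ofPoly i).commutes _).symm

theorem eval_X_sub (u : SymOrbit i) (j : Fin (m + 1)) : MvPolynomial.eval (point u.1)
    (MvPolynomial.X j - MvPolynomial.C (qpow q (u.1 j))) = 0 := by
  rw [map_sub, MvPolynomial.eval_X, MvPolynomial.eval_C, point, sub_self]

/-- In a coordinate where `u` and `v` differ, a power of `X_j - q^{u_j}` kills `h` from the right
and a power of `X_j - q^{v_j}` kills `e_v` at level `l`. These polynomials are coprime, so a Bézout
relation kills the product. -/
theorem mul_weight_of_mem (hq : q ≠ 0) {u v : SymOrbit i} (huv : v ≠ u) {h : HeckeHat q i}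
    (hh : h ∈ weightSpace q i u) : h * weight hq v = 0 := by
  have : ∃ j, v.1 j ≠ u.1 j := by
    by_contra! h
    exact huv (Subtype.ext (funext h))
  obtain ⟨j, hj⟩ := this
  refine ext_proj fun l => ?_
  obtain ⟨N, hN⟩ := hh l
  have hN := hN j
  have hM := proj_pow_mul_weight hq v (eval_X_sub v j) (le_refl (exponent m l))
  rw [X_sub_eq, ← map_pow] at hN
  rw [← map_pow] at hM
  have hcop : IsCoprime (MvPolynomial.X j - MvPolynomial.C (qpow q (u.1 j)))
      (MvPolynomial.X j - MvPolynomial.C (qpow q (v.1 j)) : MvPolynomial (Fin (m + 1)) k) := by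
    have hne : qpow q (v.1 j) - qpow q (u.1 j) ≠ 0 :=
      sub_ne_zero.2 fun h => hj (qpow_injective hq h)
    refine ⟨MvPolynomial.C (qpow q (v.1 j) - qpow q (u.1 j))⁻¹,
      -MvPolynomial.C (qpow q (v.1 j) - qpow q (u.1 j))⁻¹, ?_⟩
    have : MvPolynomial.C (qpow q (v.1 j) - qpow q (u.1 j))⁻¹ *
      (MvPolynomial.C (qpow q (v.1 j)) - MvPolynomial.C (qpow q (u.1 j))) =
        (1 : MvPolynomial (Fin (m + 1)) k) := by
      rw [← map_sub, ← map_mul, inv_mul_cancel₀ hne, map_one]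
    linear_combination this
  obtain ⟨a, b, hab⟩ := hcop.pow (m := N) (n := exponent m l)
  have h1 : h * weight hq v =
      h * ofPoly i ((MvPolynomial.X j - MvPolynomial.C (qpow q (u.1 j))) ^ N) * ofPoly i a *
        weight hq v + h * ofPoly i b *
      (ofPoly i ((MvPolynomial.X j - MvPolynomial.C (qpow q (v.1 j))) ^ exponent m l) *
        weight hq v) := by
    rw [mul_assoc h (ofPoly i _) (ofPoly i a), ← map_mul, mul_comm _ a, mul_assoc h (ofPoly i b),
      ← mul_assoc (ofPoly i b), ← map_mul, mul_assoc, ← mul_add, ← add_mul, ← map_add, hab, map_one,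
      one_mul]
  rw [h1, map_add, map_mul, map_mul, hN, map_mul, hM, map_zero]
  simp

theorem mul_weight_mem (hq : q ≠ 0) (u : SymOrbit i) (h : HeckeHat q i) :
    h * weight hq u ∈ weightSpace q i u := fun l => ⟨exponent m l, fun j => by
  rw [X_sub_eq, mul_assoc, ← map_pow, ← ofPoly_mul_weight, map_mul, map_pow,
    proj_pow_mul_weight hq u (eval_X_sub u j) le_rfl, mul_zero]⟩

theorem isWeightIdempotents (hq : q ≠ 0) : IsWeightIdempotents q i (weight hq) where
  mul := weight_mul hq
  sum := weight_sum hq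
  range u := by
    refine Set.Subset.antisymm ?_ fun h hh => ⟨h, ?_⟩
    · rintro _ ⟨h, rfl⟩
      exact mul_weight_mem hq u h
    · change h * weight hq u = h
      conv_rhs => rw [← mul_one h, ← weight_sum hq, Finset.mul_sum]
      rw [Finset.sum_eq_single u (fun v _ hv => mul_weight_of_mem hq hv hh)]
      exact fun h => absurd (Finset.mem_univ u) h

/-- Equal left ideals give `e_u e'_u = e_u` and `e'_u e_u = e'_u`. Expanding `e_u` by completeness
of the second family, orthogonality of the first leaves only `e'_u e_u`. -/
theorem IsWeightIdempotents.eq {e e' : SymOrbit i → HeckeHat q i}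
    (h : IsWeightIdempotents q i e) (h' : IsWeightIdempotents q i e') : e = e' := by
  have key : ∀ {e e' : SymOrbit i → HeckeHat q i}, IsWeightIdempotents q i e →
      IsWeightIdempotents q i e' → ∀ u, e u * e' u = e u := by
    intro e e' h h' u
    have h1 : e u ∈ Set.range fun h : HeckeHat q i => h * e' u := by
      rw [h'.range, ← h.range]
      exact ⟨1, one_mul _⟩
    obtain ⟨z, hz⟩ := h1
    have hz : z * e' u = e u := hz
    rw [← hz, mul_assoc, h'.mul, if_pos rfl]
  funext u
  calc e u = ∑ v, e' v * e u := by rw [← Finset.sum_mul, h'.sum, one_mul]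
    _ = e' u * e u := by
      refine Finset.sum_eq_single u (fun v _ hv => ?_) fun h => absurd (Finset.mem_univ u) h
      rw [← key h' h v, mul_assoc, h.mul, if_neg hv, mul_zero]
    _ = e' u := key h' h u

/-- The coefficients act on the completed affine Hecke algebra. -/
theorem exists_coef (hq : q ≠ 0) : ∃ ι : OrbitCoef k i →ₐ[k] HeckeHat q i,
    (∀ j, ι (OrbitCoef.X i j) = X q i j) ∧ (∀ u, ι (idem k u) = weight hq u) ∧
    (∀ l j, IsNilpotent (proj q i l (ι (x k i j)))) ∧
    ∀ j, ι (x k i j) = ∑ u : SymOrbit i,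
      ofPoly i (1 - MvPolynomial.C (qpow q (u.1 j))⁻¹ * MvPolynomial.X j) * weight hq u := by
  -- This is `x_j` at `u`, obtained by solving `X_j = q^{u_j} (1 - x_j)`.
  let y : Fin (m + 1) → SymOrbit i → MvPolynomial (Fin (m + 1)) k := fun j u =>
    1 - MvPolynomial.C (qpow q (u.1 j))⁻¹ * MvPolynomial.X j
  have hy0 : ∀ j u, MvPolynomial.eval (point u.1) (y j u) = 0 := fun j u => by
    simp only [y, map_sub, map_one, map_mul, MvPolynomial.eval_C, MvPolynomial.eval_X, point]
    rw [inv_mul_cancel₀ (qpow_ne_zero hq _), sub_self]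
  have hmul : ∀ p p' : SymOrbit i → MvPolynomial (Fin (m + 1)) k,
      (∑ u, ofPoly i (p u) * weight hq u) * (∑ u, ofPoly i (p' u) * weight hq u) =
        ∑ u, ofPoly i (p u * p' u) * weight hq u := by
    intro p p'
    rw [Finset.sum_mul_sum]
    refine Finset.sum_congr rfl fun u _ => ?_
    rw [Finset.sum_eq_single u]
    · rw [mul_assoc, ← mul_assoc (weight hq u), ← ofPoly_mul_weight, mul_assoc, weight_mul,
        if_pos rfl, ← mul_assoc, map_mul]
    · intro v _ hv
      rw [mul_assoc, ← mul_assoc (weight hq u), ← ofPoly_mul_weight, mul_assoc, weight_mul,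
        if_neg hv.symm, mul_zero, mul_zero]
    · exact fun h => absurd (Finset.mem_univ u) h
  have hpow : ∀ j n, (∑ u, ofPoly i (y j u) * weight hq u) ^ n =
      ∑ u, ofPoly i (y j u ^ n) * weight hq u := by
    intro j n
    induction n with
    | zero => simp [weight_sum]
    | succ n ih => simp only [pow_succ, ih, hmul]
  have hnil : ∀ l j, IsNilpotent (proj q i l (∑ u, ofPoly i (y j u) * weight hq u)) := by
    refine fun l j => ⟨exponent m l, ?_⟩
    rw [← map_pow, hpow, map_sum]
    refine Finset.sum_eq_zero fun u _ => ?_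
    rw [map_pow]
    exact proj_pow_mul_weight hq u (hy0 j u) le_rfl
  have hcomm : ∀ p u, weight hq u * ofPoly i p = ofPoly i p * weight hq u := fun p u =>
    (ofPoly_mul_weight hq u p).symm
  obtain ⟨ι, h1, h2⟩ := OrbitCoef.exists_hom (k := k) (fun j => ∑ u, ofPoly i (y j u) * weight hq u)
    (weight hq)
    (fun a b => by
      rw [hmul, hmul]
      simp only [mul_comm])
    (fun a u => by
      rw [Finset.sum_mul, Finset.mul_sum]
      refine Finset.sum_congr rfl fun v _ => ?_
      rw [mul_assoc, ← mul_assoc (weight hq u), hcomm, mul_assoc, weight_mul, weight_mul]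
      congr 1
      by_cases h : u = v
      · subst h; rfl
      · rw [if_neg h, if_neg (Ne.symm h)])
    (weight_mul hq) (weight_sum hq)
    (fun μ hμ p hp => IdealCompletion.isUnit_of_proj _ fun l =>
      MvPolynomial.isUnit_of_constantCoeff ((IdealCompletion.proj _ _ l).comp μ) (fun j => by
        rw [AlgHom.comp_apply, hμ]
        exact hnil l j) hp)
  refine ⟨ι, fun j => ?_, h2, fun l j => by rw [h1]; exact hnil l j, h1⟩
  refine eq_of_mul_idem (ι := ι) fun u => ?_
  have hX : OrbitCoef.X i j * idem k u =
      algebraMap k _ (qpow q (u.1 j)) * (1 - x k i j) * idem k u := by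
    refine mul_idem_congr ?_
    rw [toFun_X, map_mul, OrbitFun.mul_apply, toFun_algebraMap, map_sub, map_one,
      OrbitFun.sub_apply, toFun_x]
    rfl
  have hxu : ι (x k i j) * weight hq u = ofPoly i (y j u) * weight hq u := by
    rw [h1, Finset.sum_mul, Finset.sum_eq_single u]
    · rw [mul_assoc, weight_mul, if_pos rfl]
    · intro v _ hv
      rw [mul_assoc, weight_mul, if_neg hv, mul_zero]
    · exact fun h => absurd (Finset.mem_univ u) h
  have hyX : qpow q (u.1 j) • ((1 - y j u) : MvPolynomial (Fin (m + 1)) k) = MvPolynomial.X j := by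
    rw [sub_sub_cancel, MvPolynomial.smul_eq_C_mul, ← mul_assoc, ← map_mul,
      mul_inv_cancel₀ (qpow_ne_zero hq _), map_one, one_mul]
  rw [← map_mul, hX, map_mul, map_mul, AlgHom.commutes, h2, map_sub, map_one, mul_assoc, sub_mul,
    hxu, ← sub_mul, ← map_one (ofPoly i), ← map_sub, ← mul_assoc, ← Algebra.smul_def, ← map_smul,
    hyX, ofPoly_X]

end HeckeHat

end

noncomputable section

open OrbitCoef

/-! ### Commutation of the `T_r` with the weight idempotents -/

theorem SymOrbit.s_s {m e : ℕ} {i : Fin (m + 1) → ZMod e} (r : Fin m) (u : SymOrbit i) :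
    (u.s r).s r = u := by
  refine Subtype.ext (funext fun j => ?_)
  change u.1 (Equiv.swap _ _ (Equiv.swap _ _ j)) = u.1 j
  rw [Equiv.swap_apply_self]

theorem SymOrbit.s_castSucc {m e : ℕ} {i : Fin (m + 1) → ZMod e} (r : Fin m) (u : SymOrbit i) :
    (u.s r).1 r.castSucc = u.1 r.succ :=
  congrArg u.1 (Equiv.swap_apply_left _ _)

theorem SymOrbit.s_succ {m e : ℕ} {i : Fin (m + 1) → ZMod e} (r : Fin m) (u : SymOrbit i) :
    (u.s r).1 r.succ = u.1 r.castSucc :=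
  congrArg u.1 (Equiv.swap_apply_right _ _)

theorem SymOrbit.s_of_ne {m e : ℕ} {i : Fin (m + 1) → ZMod e} {r : Fin m} (u : SymOrbit i)
    {j : Fin (m + 1)} (h : j ≠ r.castSucc) (h' : j ≠ r.succ) : (u.s r).1 j = u.1 j :=
  congrArg u.1 (Equiv.swap_apply_of_ne_of_ne h h')

theorem SymOrbit.s_eq_self {m e : ℕ} {i : Fin (m + 1) → ZMod e} {r : Fin m} {u : SymOrbit i}
    (h : u.1 r.castSucc = u.1 r.succ) : u.s r = u := by
  refine Subtype.ext (funext fun j => ?_)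
  by_cases h1 : j = r.castSucc
  · rw [h1, s_castSucc, h]
  by_cases h2 : j = r.succ
  · rw [h2, s_succ, h]
  exact s_of_ne u h1 h2

namespace OrbitCoef

theorem _root_.LocalRing.isUnit_of_value {k : Type*} [Field k] {n : ℕ} {f : LocalRing k n}
    (h : LocalRing.value k n f ≠ 0) : IsUnit f := by
  obtain ⟨a, s, hs, h'⟩ := LocalRing.exists_mul_eq_poly f
  have ha : MvPolynomial.constantCoeff a ≠ 0 := by
    rw [← LocalRing.value_poly, ← h', map_mul, LocalRing.value_poly]
    exact mul_ne_zero h hs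
  exact isUnit_of_mul_isUnit_left (h' ▸ LocalRing.isUnit_poly ha)

theorem isUnit_of_value {k : Type*} [Field k] {m e : ℕ} {i : Fin (m + 1) → ZMod e}
    {F : OrbitCoef k i} (h : ∀ u, value k i u F ≠ 0) : IsUnit F :=
  Pi.isUnit_iff.2 fun u => LocalRing.isUnit_of_value (h u)

variable {k : Type*} [Field k] {q : k} {m : ℕ} {i : Fin (m + 1) → ZMod (orderOf q)}

/-- Functions which are invariant under a simple reflection separate its orbits. -/
theorem exists_value_ne (hq : q ≠ 0) {r : Fin m} {u w : SymOrbit i} (h : w ≠ u)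
    (h' : w ≠ u.s r) : ∃ F : OrbitCoef k i, ((∃ j, j ≠ r.castSucc ∧ j ≠ r.succ ∧ F = X i j) ∨
      F = X i r.castSucc + X i r.succ ∨ F = X i r.castSucc * X i r.succ) ∧
      value k i u F ≠ value k i w F := by
  by_contra! hF
  have h1 : ∀ j, j ≠ r.castSucc → j ≠ r.succ → w.1 j = u.1 j := fun j hj hj' => by
    have := hF _ (Or.inl ⟨j, hj, hj', rfl⟩)
    rw [value_X, value_X] at this
    exact (qpow_injective hq this).symm
  have h2 := hF _ (Or.inr (Or.inl rfl))
  have h3 := hF _ (Or.inr (Or.inr rfl))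
  simp only [map_add, map_mul, value_X] at h2 h3
  -- Equal sums and products mean that the two values at `w` are the roots of the quadratic
  -- polynomial attached to `u`.
  have h4 : (qpow q (w.1 r.castSucc) - qpow q (u.1 r.castSucc)) *
      (qpow q (w.1 r.castSucc) - qpow q (u.1 r.succ)) = 0 := by
    linear_combination h3 - qpow q (w.1 r.castSucc) * h2
  rcases mul_eq_zero.1 h4 with h5 | h5
  · have h5 := sub_eq_zero.1 h5
    have h6 : qpow q (w.1 r.succ) = qpow q (u.1 r.succ) := by linear_combination -h2 - h5
    refine h (Subtype.ext (funext fun j => ?_))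
    by_cases hj : j = r.castSucc
    · rw [hj, qpow_injective hq h5]
    by_cases hj' : j = r.succ
    · rw [hj', qpow_injective hq h6]
    exact h1 j hj hj'
  · have h5 := sub_eq_zero.1 h5
    have h6 : qpow q (w.1 r.succ) = qpow q (u.1 r.castSucc) := by linear_combination -h2 - h5
    refine h' (Subtype.ext (funext fun j => ?_))
    by_cases hj : j = r.castSucc
    · rw [hj, qpow_injective hq h5, SymOrbit.s_castSucc]
    by_cases hj' : j = r.succ
    · rw [hj', qpow_injective hq h6, SymOrbit.s_succ]
    rw [h1 j hj hj', SymOrbit.s_of_ne u hj hj']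

/-- The coefficient of the identity in `T_r` at the elements of the orbit where it is regular. -/
def tail (hq : q ≠ 0) (r : Fin m) : OrbitCoef k i :=
  mk (fun v => if v.1 r.castSucc = v.1 r.succ then 0 else
    OrbitFun.two OrbitFun.heckeTail r.castSucc r.succ v) fun v => by
      split_ifs with h
      · exact ⟨_, RatField.Reg.zero⟩
      · exact OrbitFun.reg_heckeTail hq h _ _

theorem toFun_tail (hq : q ≠ 0) (r : Fin m) (v : SymOrbit i) : toFun k i (tail hq r) v =
    if v.1 r.castSucc = v.1 r.succ then 0 else
      OrbitFun.two OrbitFun.heckeTail r.castSucc r.succ v := rfl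

theorem tail_mul_idem (hq : q ≠ 0) (r : Fin m) {u : SymOrbit i}
    (hu : u.1 r.castSucc ≠ u.1 r.succ) :
    tail hq r * (X i r.succ - X i r.castSucc) * idem k u =
      algebraMap k _ (q - 1) * X i r.succ * idem k u := by
  refine mul_idem_congr ?_
  have h := OrbitFun.toX_sub_toX_ne_zero (k := k) hq (u.1 r.succ) (u.1 r.castSucc)
    r.castSucc_ne_succ'.symm
  rw [map_mul, OrbitFun.mul_apply, map_sub, OrbitFun.sub_apply, map_mul, OrbitFun.mul_apply,
    toFun_algebraMap, toFun_X, toFun_X, toFun_tail, if_neg hu, OrbitFun.two_apply,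
    OrbitFun.heckeTail, map_sub, map_one]
  field_simp

/-- The poles of `heckeTail` at the origin sit where the two entries agree. Both indicator functions
vanish there, so the regular function `tail` can take its place. -/
theorem tail_idem (hq : q ≠ 0) (r : Fin m) {u : SymOrbit i} (hu : u.1 r.castSucc ≠ u.1 r.succ) :
    toFun k i (tail hq r * idem k u - tail hq r * idem k (u.s r)) =
      OrbitFun.two OrbitFun.heckeTail r.castSucc r.succ * (toFun k i (idem k u) -
        Equiv.swap r.castSucc r.succ • toFun k i (idem k u)) := by
  rw [← toFun_act, act_swap_idem, map_sub, map_mul, map_mul, mul_sub]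
  refine OrbitFun.ext fun v => ?_
  rw [OrbitFun.sub_apply, OrbitFun.sub_apply, OrbitFun.mul_apply, OrbitFun.mul_apply,
    OrbitFun.mul_apply, OrbitFun.mul_apply, toFun_tail, toFun_idem, toFun_idem]
  by_cases h : v.1 r.castSucc = v.1 r.succ
  · have h1 : v ≠ u := fun h' => hu (h' ▸ h)
    have h2 : v ≠ u.s r := fun h' => hu (by
      rw [h', SymOrbit.s_castSucc, SymOrbit.s_succ] at h
      exact h.symm)
    rw [if_neg h1, if_neg h2]
    ring
  · rw [if_neg h]

/-- This reduces statements about the coefficients to the `X_j` and the idempotents, on which the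
Hecke relations give information. -/
theorem x_eq_sum (hq : q ≠ 0) (j : Fin (m + 1)) : x k i j = ∑ u : SymOrbit i,
    (1 + algebraMap k _ (-(qpow q (u.1 j))⁻¹) * X i j) * idem k u := by
  have hx : x k i j = x k i j * ∑ u, idem k u := by rw [sum_idem, mul_one]
  rw [hx, Finset.mul_sum]
  refine Finset.sum_congr rfl fun u _ => mul_idem_congr ?_
  have h : algebraMap k (RatField k (m + 1)) (qpow q (u.1 j)) ≠ 0 :=
    (map_ne_zero _).2 (qpow_ne_zero hq _)
  rw [map_add, map_mul, map_one, OrbitFun.add_apply, OrbitFun.mul_apply, toFun_algebraMap, toFun_x,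
    toFun_X, OrbitFun.toX, map_neg, map_inv₀]
  change _ = 1 + _
  field_simp
  ring

end OrbitCoef

namespace HeckeHat

variable {k : Type*} [Field k] {q : k} {m : ℕ} {i : Fin (m + 1) → ZMod (orderOf q)}
  {ι : OrbitCoef k i →ₐ[k] HeckeHat q i}

/-- An element which intertwines coefficients with different values vanishes. -/
theorem eq_zero_of_intertwine (hx : ∀ l j, IsNilpotent (proj q i l (ι (x k i j))))
    {y : HeckeHat q i} {u w : SymOrbit i} {F F' : OrbitCoef k i} (hF : y * ι F = ι F' * y)
    (hw : ι (idem k w) * y = y) (hu : y * ι (idem k u) = y)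
    (hne : value k i u F ≠ value k i w F') : y = 0 := by
  set α := value k i u F with hα
  set G := F - algebraMap k _ α with hG
  set G' := F' - algebraMap k _ α with hG'
  have hyG : y * ι G = ι G' * y := by
    rw [hG, hG', map_sub, map_sub, mul_sub, sub_mul, hF, AlgHom.commutes,
      Algebra.commutes]
  have hyGn : ∀ n, y * ι (G ^ n) = ι (G' ^ n) * y := by
    intro n
    induction n with
    | zero => simp
    | succ n ih => rw [pow_succ, map_mul, ← mul_assoc, ih, mul_assoc, hyG, ← mul_assoc, ← map_mul,
        pow_succ]
  -- `G'` has a nonzero value at `w`, so `U` is a unit that agrees with `G'` there, whereas `G`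
  -- vanishes at `u` and is nilpotent on `e_u` at every level.
  set U := G' * idem k w + (1 - idem k w) with hU
  have hUu : IsUnit U := by
    refine OrbitCoef.isUnit_of_value fun v => ?_
    rw [hU, hG', map_add, map_mul, map_sub, map_sub, map_one, value_idem, AlgHom.commutes]
    split_ifs with h
    · rw [h, mul_one, sub_self, add_zero, Algebra.algebraMap_self_apply]
      exact sub_ne_zero.2 hne.symm
    · simp
  have hidem : ∀ v : SymOrbit i, idem k v * idem k v = idem k v := fun v => by
    rw [idem_mul_idem, if_pos rfl]
  have hUn : ∀ n, U ^ n * idem k w = G' ^ n * idem k w := by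
    intro n
    induction n with
    | zero => simp
    | succ n ih =>
      rw [pow_succ, mul_assoc, mul_comm U, ← mul_assoc, ih, hU]
      linear_combination (G' ^ n * (G' - 1)) * hidem w
  refine ext_proj fun l => ?_
  obtain ⟨N, hN⟩ := exists_span_pow_le_ker ((proj q i l).comp ι) (hx l)
  have h1 : proj q i l (ι (G ^ N * idem k u)) = 0 := by
    have h2 : G ^ N * idem k u = (G * idem k u) ^ N * idem k u := by
      have : idem k u ^ N * idem k u = idem k u := by
        rw [← pow_succ]
        exact IsIdempotentElem.pow_succ_eq N (hidem u)
      rw [mul_pow, mul_assoc, this]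
    rw [h2]
    refine hN _ (Ideal.mul_mem_right _ _ (Ideal.pow_mem_pow (mem_span_x fun v => ?_) N))
    rw [hG, map_mul, map_sub, value_idem, AlgHom.commutes]
    split_ifs with h
    · rw [h, ← hα, Algebra.algebraMap_self_apply, sub_self, zero_mul]
    · rw [mul_zero]
  -- A unit times `y` equals `y` times an element that is zero at level `l`.
  have h2 : ι (U ^ N) * y = y * ι (G ^ N * idem k u) := by
    rw [mul_comm (G ^ N), map_mul, ← mul_assoc, hu, hyGn, ← hw, ← mul_assoc, ← mul_assoc,
      ← map_mul, ← map_mul, hUn]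
  have h3 : IsUnit (proj q i l (ι (U ^ N))) := ((hUu.pow N).map ι).map (proj q i l)
  refine h3.mul_left_cancel ?_
  rw [← map_mul, h2, map_mul, h1, mul_zero, map_zero, mul_zero]

section Generators

variable (q i)

theorem relation {y z : FreeAlgebra k (HeckeGen m)} (h : Hecke.Rel q m y z) :
    ((of q i).comp (RingQuot.mkAlgHom k (Hecke.Rel q m))) y =
      ((of q i).comp (RingQuot.mkAlgHom k (Hecke.Rel q m))) z :=
  congrArg (of q i) (RingQuot.mkAlgHom_rel k h)

theorem T_mul_T (r : Fin m) :
    T q i r * T q i r = algebraMap k _ (q - 1) * T q i r + algebraMap k _ q := by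
  have h := relation q i (.quadratic r)
  rw [map_mul, map_sub, map_add, map_one, map_zero, AlgHom.commutes] at h
  have h : (T q i r - algebraMap k _ q) * (T q i r + 1) = 0 := h
  rw [sub_mul, mul_add, mul_add, mul_one, mul_one, sub_eq_zero] at h
  rw [eq_sub_of_add_eq h, map_sub, map_one]
  noncomm_ring

theorem T_X_T (r : Fin m) : T q i r * X q i r.castSucc * T q i r =
    algebraMap k _ q * X q i r.succ := by
  have h := relation q i (.T_X_T r)
  rwa [map_mul, map_mul, map_mul, AlgHom.commutes] at h

theorem T_mul_X_of_ne (r : Fin m) {j : Fin (m + 1)} (h : j ≠ r.castSucc) (h' : j ≠ r.succ) :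
    T q i r * X q i j = X q i j * T q i r := by
  have h := relation q i (.T_X_comm r j h h')
  rwa [map_mul, map_mul] at h

variable {q}

/-- Multiply `T X_r T = q X_{r+1}` by `T` on the left, expand `T²` and cancel `q`. -/
theorem T_mul_X_succ (hq : q ≠ 0) (r : Fin m) : T q i r * X q i r.succ =
    X q i r.castSucc * T q i r + algebraMap k _ (q - 1) * X q i r.succ := by
  have hu : IsUnit (algebraMap k (HeckeHat q i) q) := (isUnit_iff_ne_zero.2 hq).map _
  refine hu.mul_left_cancel ?_
  rw [← mul_assoc, Algebra.commutes q, mul_assoc, ← T_X_T, ← mul_assoc, ← mul_assoc, T_mul_T,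
    add_mul, add_mul, mul_assoc, mul_assoc, ← mul_assoc (T q i r), T_X_T, mul_add, ← mul_assoc,
    ← mul_assoc, ← mul_assoc, ← map_mul, ← map_mul, mul_comm q, add_comm]

theorem T_mul_X_castSucc (hq : q ≠ 0) (r : Fin m) : T q i r * X q i r.castSucc =
    X q i r.succ * T q i r + -(algebraMap k _ (q - 1) * X q i r.succ) := by
  have hu : IsUnit (algebraMap k (HeckeHat q i) q) := (isUnit_iff_ne_zero.2 hq).map _
  refine hu.mul_left_cancel ?_
  have h : T q i r * X q i r.castSucc * T q i r * T q i r =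
      algebraMap k _ (q - 1) * (algebraMap k _ q * X q i r.succ) +
        algebraMap k _ q * (T q i r * X q i r.castSucc) := by
    rw [mul_assoc (T q i r * _), T_mul_T, mul_add, ← Algebra.commutes q, ← mul_assoc,
      ← Algebra.commutes (q - 1), mul_assoc, T_X_T]
  rw [T_X_T] at h
  rw [mul_add, ← mul_assoc _ (X q i r.succ), h, mul_neg, ← mul_assoc (algebraMap _ _ (q - 1)),
    ← mul_assoc _ (algebraMap _ _ (q - 1)), ← map_mul, ← map_mul, mul_comm q]
  abel

end Generators

theorem commRule_X (hq : q ≠ 0) (hX : ∀ j, ι (OrbitCoef.X i j) = X q i j) (r : Fin m) (j : Fin (m + 1)) :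
    CommRule ι OrbitFun.heckeTail r.castSucc r.succ (T q i r) (OrbitCoef.X i j) := by
  by_cases hj : j = r.castSucc
  · subst hj
    refine ⟨_, heckeTail_mul_X hq r, ?_⟩
    rw [act_X, Equiv.swap_apply_left, map_neg, map_mul, AlgHom.commutes, hX, hX,
      T_mul_X_castSucc i hq]
  by_cases hj' : j = r.succ
  · subst hj'
    refine ⟨algebraMap k _ (q - 1) * OrbitCoef.X i r.succ, ?_, ?_⟩
    · have := heckeTail_mul_X (i := i) hq r
      rw [map_neg, ← toFun_act, act_X, Equiv.swap_apply_left] at this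
      rw [← toFun_act, act_X, Equiv.swap_apply_right, ← neg_sub (toFun k i (OrbitCoef.X i r.castSucc)),
        mul_neg, ← this, neg_neg]
    · rw [act_X, Equiv.swap_apply_right, map_mul, AlgHom.commutes, hX, hX, T_mul_X_succ i hq]
  · refine ⟨0, ?_, ?_⟩
    · rw [← toFun_act, act_X, Equiv.swap_apply_of_ne_of_ne hj hj', sub_self, mul_zero, map_zero]
    · rw [act_X, Equiv.swap_apply_of_ne_of_ne hj hj', map_zero, add_zero, hX,
        T_mul_X_of_ne q i r hj hj']

/-- Some `s_r`-invariant polynomial in the `X_j` takes different values at `u` and `w`, and it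
commutes with `T_r`; so this corner of `T_r` intertwines different values. -/
theorem idem_T_idem (hq : q ≠ 0) (hX : ∀ j, ι (OrbitCoef.X i j) = X q i j)
    (hx : ∀ l j, IsNilpotent (proj q i l (ι (x k i j)))) (r : Fin m) {u w : SymOrbit i} (h : w ≠ u) (h' : w ≠ u.s r) :
    ι (idem k w) * T q i r * ι (idem k u) = 0 := by
  have hidem : ∀ v : SymOrbit i, ι (idem k v) * ι (idem k v) = ι (idem k v) := fun v => by
    rw [← map_mul, idem_mul_idem, if_pos rfl]
  obtain ⟨F, hF, hne⟩ := exists_value_ne hq h h'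
  have hTF : T q i r * ι F = ι F * T q i r := by
    rcases hF with ⟨j, hj, hj', rfl⟩ | rfl | rfl
    · exact (commRule_X hq hX r j).commute (by
        rw [act_X, Equiv.swap_apply_of_ne_of_ne hj hj'])
    · exact ((commRule_X hq hX r _).add (commRule_X hq hX r _)).commute (by
        rw [act_add, act_X, act_X, Equiv.swap_apply_left, Equiv.swap_apply_right, add_comm])
    · exact ((commRule_X hq hX r _).mul (commRule_X hq hX r _)).commute (by
        rw [act_mul, act_X, act_X, Equiv.swap_apply_left, Equiv.swap_apply_right, mul_comm])
  refine eq_zero_of_intertwine hx (u := u) (w := w) (F := F) (F' := F) ?_ ?_ ?_ hne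
  · rw [mul_assoc, ← map_mul, mul_comm (idem k u), map_mul, mul_assoc, ← mul_assoc (T q i r), hTF,
      ← mul_assoc, ← mul_assoc, ← map_mul, mul_comm (idem k w), map_mul, mul_assoc, mul_assoc,
      mul_assoc]
  · rw [← mul_assoc, ← mul_assoc, hidem]
  · rw [mul_assoc, hidem]

/-- On `e_u` the element `T_r - tail` intertwines `X_{r+1}` on the right with `X_r` on the left.
Their values at `u` differ, so this corner of the difference is zero. -/
theorem idem_T_idem_self (hq : q ≠ 0) (hX : ∀ j, ι (OrbitCoef.X i j) = X q i j)
    (hx : ∀ l j, IsNilpotent (proj q i l (ι (x k i j)))) (r : Fin m) {u : SymOrbit i} (h : u.1 r.castSucc ≠ u.1 r.succ) :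
    ι (idem k u) * T q i r * ι (idem k u) = ι (tail hq r * idem k u) := by
  have hidem : ∀ v : SymOrbit i, ι (idem k v) * ι (idem k v) = ι (idem k v) := fun v => by
    rw [← map_mul, idem_mul_idem, if_pos rfl]
  rw [← sub_eq_zero]
  have htail : ι (tail hq r * idem k u) = ι (idem k u) * ι (tail hq r) * ι (idem k u) := by
    rw [← map_mul, ← map_mul, mul_comm (idem k u), mul_assoc, idem_mul_idem, if_pos rfl]
  rw [htail, ← sub_mul, ← mul_sub]
  refine eq_zero_of_intertwine hx (u := u) (w := u) (F := OrbitCoef.X i r.succ)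
    (F' := OrbitCoef.X i r.castSucc) ?_ ?_ ?_ ?_
  · have h1 : (T q i r - ι (tail hq r)) * ι (OrbitCoef.X i r.succ) =
        ι (OrbitCoef.X i r.castSucc) * (T q i r - ι (tail hq r)) +
          ι (algebraMap k _ (q - 1) * OrbitCoef.X i r.succ -
            tail hq r * (OrbitCoef.X i r.succ - OrbitCoef.X i r.castSucc)) := by
      rw [sub_mul, hX, T_mul_X_succ i hq, ← hX, ← hX, map_sub ι, map_mul ι, map_mul ι, map_sub ι,
        AlgHom.commutes, mul_sub, mul_sub, ← map_mul ι (OrbitCoef.X i r.castSucc),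
        mul_comm (OrbitCoef.X i r.castSucc), map_mul]
      abel
    have h2 : ι (algebraMap k _ (q - 1) * OrbitCoef.X i r.succ -
        tail hq r * (OrbitCoef.X i r.succ - OrbitCoef.X i r.castSucc)) * ι (idem k u) = 0 := by
      rw [← map_mul, sub_mul, tail_mul_idem hq r h, sub_self, map_zero]
    rw [mul_assoc, ← map_mul, mul_comm (idem k u), map_mul, mul_assoc, ← mul_assoc (T q i r - _),
      h1, add_mul, h2, add_zero, ← mul_assoc, ← mul_assoc, ← map_mul, mul_comm (idem k u), map_mul,
      mul_assoc, mul_assoc, mul_assoc]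
  · rw [← mul_assoc, ← mul_assoc, hidem]
  · rw [mul_assoc, hidem]
  · rw [value_X, value_X]
    exact fun h' => h (qpow_injective hq h').symm

/-- Decompose `T_r` by idempotents on both sides. If `s_r` fixes `u`, only the corner at `u` meets
`e_u` and `T_r` commutes with it. Otherwise `T_r e_u` and `e_{s_r u} T_r` share the off-diagonal
corner, and their diagonal corners are given by `tail`. -/
theorem commRule_idem (hq : q ≠ 0) (hX : ∀ j, ι (OrbitCoef.X i j) = X q i j)
    (hx : ∀ l j, IsNilpotent (proj q i l (ι (x k i j)))) (r : Fin m) (u : SymOrbit i) :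
    CommRule ι OrbitFun.heckeTail r.castSucc r.succ (T q i r) (idem k u) := by
  have hsum : ∀ y : HeckeHat q i, y = ∑ w, ι (idem k w) * y := fun y => by
    rw [← Finset.sum_mul, ← map_sum, sum_idem, map_one, one_mul]
  have hsum' : ∀ y : HeckeHat q i, y = ∑ w, y * ι (idem k w) := fun y => by
    rw [← Finset.mul_sum, ← map_sum, sum_idem, map_one, mul_one]
  by_cases h : u.1 r.castSucc = u.1 r.succ
  · have hs := SymOrbit.s_eq_self h
    refine ⟨0, ?_, ?_⟩
    · rw [← toFun_act, act_swap_idem, hs, sub_self, mul_zero, map_zero]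
    · rw [act_swap_idem, hs, map_zero, add_zero, hsum (T q i r * _),
        hsum' (ι (idem k u) * T q i r), Finset.sum_eq_single u, Finset.sum_eq_single u, mul_assoc]
      · intro w _ hw
        exact idem_T_idem hq hX hx r hw.symm fun h' => hw (by rw [← hs, h', SymOrbit.s_s])
      · exact fun h => absurd (Finset.mem_univ u) h
      · intro w _ hw
        rw [← mul_assoc]
        exact idem_T_idem hq hX hx r hw (by rwa [hs])
      · exact fun h => absurd (Finset.mem_univ u) h
  · have hs : u ≠ u.s r := fun h' => h (by
      conv_lhs => rw [h', SymOrbit.s_castSucc])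
    refine ⟨_, tail_idem hq r h, ?_⟩
    have h1 : T q i r * ι (idem k u) =
        ι (idem k u) * T q i r * ι (idem k u) + ι (idem k (u.s r)) * T q i r * ι (idem k u) := by
      rw [hsum (T q i r * _), Finset.sum_eq_add u (u.s r) hs, mul_assoc, mul_assoc]
      · rintro w - ⟨hw, hw'⟩
        rw [← mul_assoc]
        exact idem_T_idem hq hX hx r hw hw'
      · exact fun h => absurd (Finset.mem_univ _) h
      · exact fun h => absurd (Finset.mem_univ _) h
    have h2 : ι (idem k (u.s r)) * T q i r = ι (idem k (u.s r)) * T q i r * ι (idem k u) +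
        ι (idem k (u.s r)) * T q i r * ι (idem k (u.s r)) := by
      refine (hsum' _).trans (Finset.sum_eq_add u (u.s r) hs ?_ ?_ ?_)
      · rintro w - ⟨hw, hw'⟩
        exact idem_T_idem hq hX hx r hw'.symm fun h' => hw (by
          rw [← SymOrbit.s_s r w, ← h', SymOrbit.s_s])
      · exact fun h => absurd (Finset.mem_univ _) h
      · exact fun h => absurd (Finset.mem_univ _) h
    have h3 : (u.s r).1 r.castSucc ≠ (u.s r).1 r.succ := by
      rw [SymOrbit.s_castSucc, SymOrbit.s_succ]
      exact Ne.symm h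
    rw [idem_T_idem_self hq hX hx r h3] at h2
    rw [act_swap_idem, h1, eq_sub_of_add_eq h2.symm, idem_T_idem_self hq hX hx r h, map_sub]
    abel

theorem heckeSystem (hq : q ≠ 0) (hX : ∀ j, ι (OrbitCoef.X i j) = X q i j)
    (hx : ∀ l j, IsNilpotent (proj q i l (ι (x k i j)))) : HeckeSystem ι (T q i) where
  comm r := CommRule.of_generators (fun j => by
    have : ∀ s : Finset (SymOrbit i), CommRule ι OrbitFun.heckeTail r.castSucc r.succ (T q i r)
        (∑ u ∈ s, (1 + algebraMap k _ (-(qpow q (u.1 j))⁻¹) * OrbitCoef.X i j) * idem k u) := by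
      intro s
      induction s using Finset.cons_induction with
      | empty =>
        rw [Finset.sum_empty, ← map_zero (algebraMap k (OrbitCoef k i))]
        exact CommRule.scalar 0
      | cons u s hu ih =>
        rw [Finset.sum_cons]
        refine CommRule.add (CommRule.mul (CommRule.add ?_
          ((CommRule.scalar _).mul (commRule_X hq hX r j))) (commRule_idem hq hX hx r u)) ih
        rw [← map_one (algebraMap k (OrbitCoef k i))]
        exact CommRule.scalar 1
    rw [x_eq_sum hq]
    exact this Finset.univ) (commRule_idem hq hX hx r)
  sq := T_mul_T q i
  braid r s hs := by
    have h := relation q i (.braid r s hs)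
    rwa [map_mul, map_mul, map_mul, map_mul] at h
  far r s hs := by
    have h := relation q i (.T_comm r s hs)
    rwa [map_mul, map_mul] at h

end HeckeHat

end

noncomputable section

open OrbitCoef

/-! ### Approximation of coefficients by polynomials -/

namespace OrbitCoef

section

variable {k : Type*} [Field k] {m e : ℕ} {i : Fin (m + 1) → ZMod e}

theorem pow_mul_idem_mem {F : OrbitCoef k i} {u : SymOrbit i} (h : value k i u F = 0) (N : ℕ) :
    F ^ N * idem k u ∈ Ideal.span (Set.range (x k i)) ^ N := by
  have h1 : idem k u ^ N * idem k u = idem k u := by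
    rw [← pow_succ]
    exact IsIdempotentElem.pow_succ_eq N (by rw [IsIdempotentElem, idem_mul_idem, if_pos rfl])
  have h2 : F ^ N * idem k u = (F * idem k u) ^ N * idem k u := by rw [mul_pow, mul_assoc, h1]
  rw [h2]
  refine Ideal.mul_mem_right _ _ (Ideal.pow_mem_pow (mem_span_x fun v => ?_) N)
  rw [map_mul, value_idem]
  split_ifs with hv
  · rw [hv, h, zero_mul]
  · rw [mul_zero]

variable (k i) in
/-- The subalgebra generated by the variables and idempotents. -/
def polySubalgebra : Subalgebra k (OrbitCoef k i) :=
  Algebra.adjoin k (Set.range (idem k) ∪ Set.range (x k i))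

/-- Taylor expansion: subtract the values at the points of the orbit, write the rest as a
combination of the `x_j`, and approximate its coefficients to one order less. -/
theorem exists_polySubalgebra (N : ℕ) : ∀ F : OrbitCoef k i, ∃ P ∈ polySubalgebra k i,
    F - P ∈ Ideal.span (Set.range (x k i)) ^ N := by
  induction N with
  | zero => exact fun F => ⟨0, zero_mem _, by simp⟩
  | succ N ih =>
    intro F
    have h0 : ∀ u, idem k u ∈ polySubalgebra k i := fun u =>
      Algebra.subset_adjoin (Or.inl ⟨u, rfl⟩)
    set P₀ : OrbitCoef k i := ∑ u, value k i u F • idem k u with hP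
    have hP₀ : P₀ ∈ polySubalgebra k i := sum_mem fun u _ => Subalgebra.smul_mem _ (h0 u) _
    have h1 : F - P₀ ∈ Ideal.span (Set.range (x k i)) := by
      refine mem_span_x fun v => ?_
      rw [map_sub, hP, map_sum, Finset.sum_eq_single v]
      · rw [map_smul, value_idem, if_pos rfl, smul_eq_mul, mul_one, sub_self]
      · intro u _ hu
        rw [map_smul, value_idem, if_neg hu.symm, smul_zero]
      · exact fun h => absurd (Finset.mem_univ v) h
    obtain ⟨G, hG⟩ := Ideal.mem_span_range_iff_exists_fun.1 h1
    choose P hP hGP using fun j => ih (G j)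
    refine ⟨P₀ + ∑ j, P j * x k i j, add_mem hP₀ (sum_mem fun j _ => mul_mem (hP j)
      (Algebra.subset_adjoin (Or.inr ⟨j, rfl⟩))), ?_⟩
    rw [← sub_sub, ← hG, ← Finset.sum_sub_distrib]
    refine sum_mem fun j _ => ?_
    rw [← sub_mul, pow_succ]
    exact Ideal.mul_mem_mul (hGP j) (Ideal.subset_span ⟨j, rfl⟩)

end

variable {k : Type*} [Field k] {q : k} {m : ℕ} {i : Fin (m + 1) → ZMod (orderOf q)}

variable (i) in
/-- Polynomials in the `X_j`. -/
def polyX : MvPolynomial (Fin (m + 1)) k →ₐ[k] OrbitCoef k i := MvPolynomial.aeval (X i)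

theorem value_polyX (u : SymOrbit i) (p : MvPolynomial (Fin (m + 1)) k) :
    value k i u (polyX i p) = MvPolynomial.eval (Hecke.point u.1) p := by
  have : (value k i u).comp (polyX i) = MvPolynomial.aeval (Hecke.point u.1) :=
    MvPolynomial.algHom_ext fun j => by
      rw [AlgHom.comp_apply, polyX, MvPolynomial.aeval_X, value_X, MvPolynomial.aeval_X]
      rfl
  rw [← AlgHom.comp_apply, this, MvPolynomial.aeval_eq_eval]

/-- At `u` the approximant is `1` modulo `(1 - L)^M`, and at the other points it is `0` modulo
`L^M`; the bases of these powers vanish at the respective points. This identifies the image of the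
weight idempotents and shows that `e(u)` is a limit of polynomials in the `X_j`. -/
theorem polyX_idemApprox (hq : q ≠ 0) (u : SymOrbit i) (M : ℕ) :
    polyX i (idemApprox M (HeckeHat.separate hq u)) - idem k u ∈
      Ideal.span (Set.range (x k i)) ^ M := by
  set L := HeckeHat.separate hq u with hL
  set P := polyX i (idemApprox M L) with hP
  have h1 : P - idem k u = ∑ v, (P - idem k u) * idem k v := by
    rw [← Finset.mul_sum, sum_idem, mul_one]
  rw [h1]
  refine sum_mem fun v _ => ?_
  by_cases hv : u = v
  · subst hv
    obtain ⟨c, hc⟩ := pow_dvd_one_sub_idemApprox M L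
    have h2 : (P - idem k u) * idem k u =
        -polyX i c * (polyX i (1 - L) ^ M * idem k u) := by
      have h3 : P = 1 - polyX i (1 - L) ^ M * polyX i c := by
        rw [← map_pow, ← map_mul, ← hc, map_sub, map_one, sub_sub_cancel]
      rw [sub_mul, idem_mul_idem, if_pos rfl, h3]
      ring
    rw [h2]
    refine Ideal.mul_mem_left _ _ (pow_mul_idem_mem ?_ M)
    rw [value_polyX, map_sub, map_one, hL, HeckeHat.eval_separate, if_pos rfl, sub_self]
  · obtain ⟨c, hc⟩ := pow_dvd_idemApprox M L
    have h2 : (P - idem k u) * idem k v = polyX i c * (polyX i L ^ M * idem k v) := by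
      rw [sub_mul, idem_mul_idem, if_neg hv, hP, hc, map_mul, map_pow]
      ring
    rw [h2]
    refine Ideal.mul_mem_left _ _ (pow_mul_idem_mem ?_ M)
    rw [value_polyX, hL, HeckeHat.eval_separate, if_neg (Ne.symm hv)]

end OrbitCoef

/-! ### The isomorphism of the completions -/

theorem Hecke.algHom_ext {k : Type*} [Field k] {q : k} {m : ℕ} {B : Type*} [Ring B] [Algebra k B]
    {f g : Hecke q m →ₐ[k] B} (hT : ∀ r, f (T q r) = g (T q r))
    (hX : ∀ j, f ((X q j : (Hecke q m)ˣ) : Hecke q m) = g ((X q j : (Hecke q m)ˣ) : Hecke q m)) :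
    f = g := by
  refine AlgHom.ext fun a => ?_
  have : a ∈ AlgHom.equalizer f g := by
    refine mem_of_generators hT hX (fun j => ?_) a
    have h : Units.map (f : Hecke q m →* B) (X q j) = Units.map (g : Hecke q m →* B) (X q j) :=
      Units.ext (hX j)
    have := congrArg (fun u : Bˣ => (u⁻¹ : Bˣ)) h
    simp only [← map_inv] at this
    exact congrArg Units.val this
  exact this

theorem KLR.algHom_ext {k : Type*} [Field k] {m e : ℕ} {i : Fin (m + 1) → ZMod e} {B : Type*}
    [Ring B] [Algebra k B] {f g : KLR k i →ₐ[k] B} (hE : ∀ u, f (KLR.E k i u) = g (KLR.E k i u))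
    (hx : ∀ j, f (KLR.x k i j) = g (KLR.x k i j))
    (hpsi : ∀ r, f (KLR.psi k i r) = g (KLR.psi k i r)) : f = g := by
  refine RingQuot.ringQuot_ext' k f g (FreeAlgebra.hom_ext (funext fun t => ?_))
  cases t with
  | E u => exact hE u
  | psi r => exact hpsi r
  | x j => exact hx j

section Equiv

variable {k : Type*} [Field k] {q : k} {m : ℕ} (i : Fin (m + 1) → ZMod (orderOf q))

/-- The isomorphism of the completions, with its effect on coefficients and on the `T_r`. -/
theorem HeckeHat.exists_equiv (hq : q ≠ 0) (hq1 : q ≠ 1) :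
    ∃ (ιH : OrbitCoef k i →ₐ[k] HeckeHat q i) (ιR : OrbitCoef k i →ₐ[k] KLRHat k i)
      (γ : HeckeHat q i ≃ₐ[k] KLRHat k i),
      (∀ j, ιH (OrbitCoef.X i j) = HeckeHat.X q i j) ∧
      (∀ u, ιH (idem k u) = HeckeHat.weight hq u) ∧
      (∀ j, ιR (OrbitCoef.x k i j) = KLRHat.x k i j) ∧
      (∀ u, ιR (idem k u) = KLRHat.E k i u) ∧
      PsiSystem ιR (KLRHat.psi k i) ∧ Continuous γ ∧ Continuous γ.symm ∧
      (∀ F, γ (ιH F) = ιR F) ∧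
      ∀ r, γ (HeckeHat.T q i r) = heckeOfPsi ιR hq hq1 (KLRHat.psi k i) r := by
  have he1 : orderOf q ≠ 1 := fun h => hq1 (orderOf_eq_one_iff.1 h)
  obtain ⟨ιH, hX, hid, hnil, -⟩ := HeckeHat.exists_coef (i := i) hq
  obtain ⟨ιR, hx, hE⟩ := KLRHat.exists_coef (k := k) i
  have hnilR : ∀ l j, IsNilpotent (IdealCompletion.proj (k := k) (KLR.idealJ k i)
      (KLR.idealJ_antitone k i) l (ιR (OrbitCoef.x k i j))) := fun l j => by
    rw [hx]; exact KLRHat.isNilpotent_proj_x i l j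
  have hpsi : PsiSystem ιR (KLRHat.psi k i) :=
    PsiSystem.of_hom he1 (KLRHat.of k i) (fun u => (hE u).symm) fun j => (hx j).symm
  obtain ⟨φ₀, hφX, hφT⟩ := hpsi.exists_hecke_hom hq hq1
  have hT := HeckeHat.heckeSystem hq hX hnil
  obtain ⟨χ₀, hχE, hχx, hχpsi⟩ := (hT.psiSystem hq hq1).exists_hom he1
  obtain ⟨φ, hφ, hφc⟩ := IdealCompletion.exists_lift (J := fun l : ℕ => Hecke.idealM q i ^ l)
    (hJ := Hecke.idealM_pow_antitone q i) φ₀ (fun l =>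
      Hecke.exists_idealM_pow_le_ker hq φ₀ hφX (fun r F hF => by
        rw [hφT, hpsi.hecke_comm hq hq1 r (F := F) (F₂ := 0) (by
          rw [← toFun_act, hF, sub_self, mul_zero, map_zero]), hF, map_zero, add_zero])
        (IdealCompletion.proj _ _ l) (hnilR l))
  obtain ⟨χ, hχ, hχc⟩ := IdealCompletion.exists_lift (J := KLR.idealJ k i)
    (hJ := KLR.idealJ_antitone k i) χ₀ (fun l =>
      KLR.exists_idealJ_le_ker ((IdealCompletion.proj _ _ l).comp χ₀) (fun j => by
        rw [AlgHom.comp_apply, hχx]; exact hnil l j))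
  have hφXhat : ∀ j, φ (HeckeHat.X q i j) = ιR (OrbitCoef.X i j) := fun j =>
    (hφ _).trans (hφX j)
  have hφThat : ∀ r, φ (HeckeHat.T q i r) = heckeOfPsi ιR hq hq1 (KLRHat.psi k i) r := fun r =>
    (hφ _).trans (hφT r)
  have hφpoly : ∀ p, φ (HeckeHat.ofPoly i p) = ιR (polyX i p) := fun p => by
    have : φ.comp (HeckeHat.ofPoly i) = ιR.comp (polyX i) :=
      MvPolynomial.algHom_ext fun j => by
        rw [AlgHom.comp_apply, AlgHom.comp_apply, HeckeHat.ofPoly_X, hφXhat, polyX,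
          MvPolynomial.aeval_X]
    exact DFunLike.congr_fun this p
  -- The weight idempotent is a limit of polynomials in the `X_j`, so continuity of `φ` determines
  -- its image.
  have hφweight : ∀ u, φ (HeckeHat.weight hq u) = ιR (idem k u) := by
    refine fun u => IdealCompletion.ext_proj fun l => ?_
    obtain ⟨N₀, hN₀⟩ := exists_span_pow_le_ker ((IdealCompletion.proj _ _ l).comp ιR) (hnilR l)
    obtain ⟨N, hN⟩ := hφc l
    rw [hN _ _ (HeckeHat.proj_weight hq u (le_max_left (HeckeHat.exponent m N) N₀)), hφpoly,
      ← sub_eq_zero, ← map_sub, ← map_sub]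
    exact hN₀ _ (Ideal.pow_le_pow_right (le_max_right _ _) (polyX_idemApprox hq u _))
  have hφι : ∀ F, φ (ιH F) = ιR F := by
    have : φ.comp ιH = ιR := OrbitCoef.hom_ext (fun j => by
      rw [AlgHom.comp_apply, x_eq_sum hq]
      simp only [map_sum, map_mul, map_add, map_one, AlgHom.commutes, hX, hφXhat, hid, hφweight])
      (fun u => by rw [AlgHom.comp_apply, hid, hφweight])
    exact fun F => DFunLike.congr_fun this F
  have hχι : ∀ F, χ (ιR F) = ιH F := by
    have : χ.comp ιR = ιH := OrbitCoef.hom_ext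
      (fun j => by
        rw [AlgHom.comp_apply, hx]
        exact (hχ _).trans (hχx j))
      (fun u => by
        rw [AlgHom.comp_apply, hE]
        exact (hχ _).trans (hχE u))
    exact fun F => DFunLike.congr_fun this F
  have hχpsihat : ∀ r, χ (KLRHat.psi k i r) = psiOfHecke ιH hq hq1 (HeckeHat.T q i) r :=
    fun r => (hχ _).trans (hχpsi r)
  -- The composite fixes the generators of the Hecke algebra, and uniform continuity extends this to
  -- the completion.
  have h1 : ∀ z, χ (φ z) = z := by
    have hof : (χ.comp φ).comp (HeckeHat.of q i) = HeckeHat.of q i := by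
      refine Hecke.algHom_ext (fun r => ?_) fun j => ?_
      · change χ (φ (HeckeHat.T q i r)) = HeckeHat.T q i r
        rw [hφThat, heckeOfPsi, map_sub, map_mul, hχι, hχι, hχpsihat]
        exact heckeOfPsi_psiOfHecke hq hq1 r
      · change χ (φ (HeckeHat.X q i j)) = HeckeHat.X q i j
        rw [hφXhat, hχι, hX]
    refine IdealCompletion.eq_id_of_of (χ.comp φ) (fun a => DFunLike.congr_fun hof a) fun l => ?_
    obtain ⟨N, hN⟩ := hχc l
    obtain ⟨N', hN'⟩ := hφc N
    exact ⟨N', fun y z h => hN _ _ (hN' _ _ h)⟩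
  have h2 : ∀ z, φ (χ z) = z := by
    have hof : (φ.comp χ).comp (KLRHat.of k i) = KLRHat.of k i := by
      refine KLR.algHom_ext (fun u => ?_) (fun j => ?_) fun r => ?_
      · change φ (χ (KLRHat.E k i u)) = KLRHat.E k i u
        rw [← hE, hχι, hφι]
      · change φ (χ (KLRHat.x k i j)) = KLRHat.x k i j
        rw [← hx, hχι, hφι]
      · change φ (χ (KLRHat.psi k i r)) = KLRHat.psi k i r
        rw [hχpsihat, psiOfHecke, map_mul, map_add, hφι, hφι, hφThat]
        exact psiOfHecke_heckeOfPsi hq hq1 (KLRHat.psi k i) r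
    refine IdealCompletion.eq_id_of_of (φ.comp χ) (fun a => DFunLike.congr_fun hof a) fun l => ?_
    obtain ⟨N, hN⟩ := hφc l
    obtain ⟨N', hN'⟩ := hχc N
    exact ⟨N', fun y z h => hN _ _ (hN' _ _ h)⟩
  exact ⟨ιH, ιR, AlgEquiv.ofAlgHom φ χ (AlgHom.ext h2) (AlgHom.ext h1), hX, hid, hx, hE, hpsi,
    IdealCompletion.continuous_of_proj _ hφc, IdealCompletion.continuous_of_proj _ hχc, hφι,
    hφThat⟩

end Equiv

end

noncomputable section

open OrbitCoef

/-! ### Denominators, intertwiners and the commutative subalgebras -/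

section Denominators

variable {k : Type*} [Field k] {q : k} {m : ℕ} {i : Fin (m + 1) → ZMod (orderOf q)}

namespace OrbitCoef

/-- The coefficient `1 - X_r X_{r+1}⁻¹` at `u`, extended by `1`. -/
def denom (hq : q ≠ 0) (r : Fin m) (u : SymOrbit i) : OrbitCoef k i :=
  (1 - X i r.castSucc * (((XUnit i hq r.succ)⁻¹ : (OrbitCoef k i)ˣ) : OrbitCoef k i)) * idem k u + (1 - idem k u)

theorem value_XUnit_inv (hq : q ≠ 0) (u : SymOrbit i) (j : Fin (m + 1)) :
    value k i u ((XUnit i hq j)⁻¹ : (OrbitCoef k i)ˣ) = (qpow q (u.1 j))⁻¹ := by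
  refine eq_inv_of_mul_eq_one_left ?_
  rw [← value_X u j, ← map_mul]
  exact (congrArg (value k i u) (XUnit i hq j).inv_mul).trans (map_one _)

theorem isUnit_denom (hq : q ≠ 0) {r : Fin m} {u : SymOrbit i}
    (h : u.1 r.succ ≠ u.1 r.castSucc) : IsUnit (denom hq r u) := by
  refine isUnit_of_value fun v => ?_
  rw [denom, map_add, map_mul, map_sub, map_sub, map_mul, map_one, value_X, value_XUnit_inv,
    value_idem]
  split_ifs with hv
  · rw [hv, mul_one, sub_self, add_zero, sub_ne_zero, ne_comm, ne_eq,
      mul_inv_eq_one₀ (qpow_ne_zero hq _)]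
    exact fun h' => h (qpow_injective hq h').symm
  · simp

/-- This identifies the fraction in `Phi` at `u` with the corresponding component of `shift`, on
which the relations were established. -/
theorem denom_mul_shift (hq : q ≠ 0) {r : Fin m} {u : SymOrbit i}
    (h : u.1 r.succ ≠ u.1 r.castSucc) :
    denom hq r u * (shift hq r.castSucc r.succ * idem k u) = algebraMap k _ (1 - q) * idem k u := by
  have h1 : denom hq r u * (shift hq r.castSucc r.succ * idem k u) =
      (1 - X i r.castSucc * (((XUnit i hq r.succ)⁻¹ : (OrbitCoef k i)ˣ) : OrbitCoef k i)) *
        shift hq r.castSucc r.succ * idem k u := by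
    have h2 : idem k u * idem k u = idem k u := by rw [idem_mul_idem, if_pos rfl]
    rw [denom]
    linear_combination ((1 - X i r.castSucc * (((XUnit i hq r.succ)⁻¹ : (OrbitCoef k i)ˣ) : OrbitCoef k i)) *
        shift hq r.castSucc r.succ - shift hq r.castSucc r.succ) * h2
  have h3 : toFun k i ((XUnit i hq r.succ)⁻¹ : (OrbitCoef k i)ˣ) u =
      (OrbitFun.toX (u.1 r.succ) (RatField.x r.succ))⁻¹ := by
    refine eq_inv_of_mul_eq_one_left ?_
    rw [← toFun_X, ← OrbitFun.mul_apply, ← map_mul]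
    have : (((XUnit i hq r.succ)⁻¹ : (OrbitCoef k i)ˣ) : OrbitCoef k i) * X i r.succ = 1 :=
      (XUnit i hq r.succ).inv_mul
    rw [this, map_one]
    rfl
  rw [h1]
  refine mul_idem_congr ?_
  obtain ⟨c, hc, hreg⟩ := OrbitFun.reg_denom (m := m) hq h.symm r.castSucc r.succ
  rw [map_mul, OrbitFun.mul_apply, map_sub, OrbitFun.sub_apply, map_mul, OrbitFun.mul_apply, h3,
    toFun_X, toFun_algebraMap, map_one]
  change (1 - _) * OrbitFun.shift _ _ _ _ = _
  rw [OrbitFun.shift, if_neg h.symm, mul_left_comm, mul_inv_cancel₀ (hreg.ne_zero hc), mul_one,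
    map_sub, map_one]

theorem shift_mul_idem_of_eq (hq : q ≠ 0) {r : Fin m} {u : SymOrbit i}
    (h : u.1 r.succ = u.1 r.castSucc) : shift hq r.castSucc r.succ * idem k u = idem k u := by
  nth_rw 2 [← one_mul (idem k u)]
  refine mul_idem_congr ?_
  change OrbitFun.shift _ _ _ _ = _
  rw [OrbitFun.shift, if_pos h.symm, map_one]
  rfl

/-- The denominator of the fraction `A_r^u`. -/
def ratioDenom (r : Fin m) (u : SymOrbit i) : OrbitCoef k i :=
  if u.1 r.succ = u.1 r.castSucc then 1
  else if u.1 r.succ = u.1 r.castSucc + 1 then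
    1 - algebraMap k _ q - x k i r.succ + algebraMap k _ q * x k i r.castSucc
  else algebraMap k _ (qpow q (u.1 r.castSucc)) * (1 - x k i r.succ) -
    algebraMap k _ (qpow q (u.1 r.succ)) * (1 - x k i r.castSucc)

/-- The numerator of the fraction `A_r^u`. -/
def ratioNum (r : Fin m) (u : SymOrbit i) : OrbitCoef k i :=
  if u.1 r.succ = u.1 r.castSucc then
    1 - algebraMap k _ q - x k i r.castSucc + algebraMap k _ q * x k i r.succ
  else if u.1 r.succ = u.1 r.castSucc + 1 then -algebraMap k _ q
  else algebraMap k _ (qpow q (u.1 r.succ)) * (1 - x k i r.castSucc) -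
    algebraMap k _ (qpow q (u.1 r.castSucc + 1)) * (1 - x k i r.succ)

theorem isUnit_ratioDenom (hq : q ≠ 0) (hq1 : q ≠ 1) (r : Fin m) (u : SymOrbit i) :
    IsUnit (ratioDenom r u) := by
  refine isUnit_of_value fun v => ?_
  rw [ratioDenom]
  split_ifs with h h'
  · rw [map_one]; exact one_ne_zero
  · simp only [map_add, map_sub, map_mul, map_one, AlgHom.commutes, value_x]
    simpa using sub_ne_zero.2 hq1.symm
  · simp only [map_sub, map_mul, map_one, AlgHom.commutes, value_x]
    simpa using sub_ne_zero.2 fun h' => h (qpow_injective hq h').symm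

/-- Since `ψ_r e(u) = e(s_r u) ψ_r`, the factor to the left of `ψ_r` is evaluated at `s_r u`, whose
entries in positions `r`, `r + 1` are `u_{r+1}`, `u_r`. Hence the interchanged arguments of `ampl`.
-/
theorem ratioNum_mul_idem (hq : q ≠ 0) (hq1 : q ≠ 1) (r : Fin m) (u : SymOrbit i) :
    ratioNum r u * idem k (u.s r) =
      ratioDenom r u * ampl hq hq1 r.castSucc r.succ * idem k (u.s r) := by
  refine mul_idem_congr ?_
  have hampl : toFun k i (ampl hq hq1 r.castSucc r.succ) (u.s r) =
      OrbitFun.ampl (u.1 r.succ) (u.1 r.castSucc) (RatField.x r.castSucc) (RatField.x r.succ) := by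
    rw [← SymOrbit.s_castSucc, ← SymOrbit.s_succ r u]
    rfl
  rw [map_mul, OrbitFun.mul_apply, hampl, ratioNum, ratioDenom, OrbitFun.ampl]
  split_ifs with h h'
  · simp only [map_add, map_sub, map_mul, map_one, OrbitFun.add_apply, OrbitFun.sub_apply,
      OrbitFun.mul_apply, toFun_algebraMap, toFun_x]
    change 1 - _ - _ + _ = 1 * _
    rw [one_mul]
  · have h0 : (1 - algebraMap k (RatField k (m + 1)) q - RatField.x r.succ +
        algebraMap k _ q * RatField.x r.castSucc) ≠ 0 := by
      have := (((RatField.Reg.one.sub (RatField.Reg.const q)).sub (RatField.Reg.x (k := k) r.succ)).add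
        ((RatField.Reg.const (n := m + 1) q).mul (RatField.Reg.x r.castSucc)))
      exact this.ne_zero (by simpa using sub_ne_zero.2 hq1.symm)
    simp only [map_add, map_sub, map_mul, map_one, map_neg, OrbitFun.add_apply, OrbitFun.sub_apply,
      OrbitFun.mul_apply, OrbitFun.neg_apply, toFun_algebraMap, toFun_x]
    change _ = (1 - _ - _ + _) * _
    rw [mul_left_comm, mul_inv_cancel₀ h0, mul_one]
  · have h0 := OrbitFun.toX_sub_toX_ne_zero (k := k) hq (u.1 r.castSucc) (u.1 r.succ)
      r.castSucc_ne_succ'.symm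
    simp only [map_sub, map_mul, map_one, OrbitFun.sub_apply, OrbitFun.mul_apply,
      toFun_algebraMap, toFun_x, qpow_add_one hq]
    change _ * (1 - _) - _ * (1 - _) = (_ * (1 - _) - _ * (1 - _)) * _
    rw [mul_left_comm, OrbitFun.toX, OrbitFun.toX] at *
    rw [mul_inv_cancel₀ h0, mul_one]
    ring

theorem X_sub_mul_idem (u : SymOrbit i) (j : Fin (m + 1)) :
    (X i j - algebraMap k _ (qpow q (u.1 j))) * idem k u =
      -(algebraMap k _ (qpow q (u.1 j)) * x k i j) * idem k u := by
  refine mul_idem_congr ?_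
  rw [map_sub, OrbitFun.sub_apply, toFun_X, toFun_algebraMap, map_neg, OrbitFun.neg_apply, map_mul,
    OrbitFun.mul_apply, toFun_algebraMap, toFun_x, OrbitFun.toX]
  ring

end OrbitCoef

namespace HeckeHat

theorem map_XUnit_inv (hq : q ≠ 0) {ι : OrbitCoef k i →ₐ[k] HeckeHat q i}
    (hX : ∀ j, ι (OrbitCoef.X i j) = X q i j) (j : Fin (m + 1)) :
    ι ((XUnit i hq j)⁻¹ : (OrbitCoef k i)ˣ) = Xinv q i j :=
  (Hecke.map_Xinv hq (φ := of q i) (fun j => (hX j).symm) j).symm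

theorem cornerDenom_weight (hq : q ≠ 0) {ι : OrbitCoef k i →ₐ[k] HeckeHat q i}
    (hX : ∀ j, ι (OrbitCoef.X i j) = X q i j) (hid : ∀ u, ι (idem k u) = weight hq u) (r : Fin m)
    (u : SymOrbit i) : cornerDenom q (weight hq) r u = ι (denom hq r u) := by
  rw [cornerDenom, denom, map_add, map_mul, map_sub, map_sub, map_mul, map_one, hX,
    map_XUnit_inv hq hX, hid]

theorem Phi_weight (hq : q ≠ 0) {ι : OrbitCoef k i →ₐ[k] HeckeHat q i}
    (hX : ∀ j, ι (OrbitCoef.X i j) = X q i j) (hid : ∀ u, ι (idem k u) = weight hq u) (r : Fin m) :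
    Phi q (weight hq) r = T q i r + ι (shift hq r.castSucc r.succ) := by
  rw [Phi, ← mul_one (shift hq r.castSucc r.succ), ← sum_idem, Finset.mul_sum, map_sum]
  congr 1
  refine Finset.sum_congr rfl fun u _ => ?_
  split_ifs with h
  · rw [shift_mul_idem_of_eq hq h, hid]
  · have h1 := congrArg ι (denom_mul_shift (k := k) hq h)
    rw [map_mul, map_mul ι (algebraMap _ _ _), AlgHom.commutes, hid] at h1
    rw [cornerDenom_weight hq hX hid, ← mul_smul_comm, Algebra.smul_def, ← h1, ← mul_assoc,
      Ring.inverse_mul_cancel _ ((isUnit_denom hq h).map ι), one_mul]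

end HeckeHat

namespace KLRHat

theorem Adenom_eq {ι : OrbitCoef k i →ₐ[k] KLRHat k i}
    (hx : ∀ j, ι (OrbitCoef.x k i j) = KLRHat.x k i j) (r : Fin m) (u : SymOrbit i) :
    Adenom q r u = ι (ratioDenom r u) := by
  rw [Adenom, ratioDenom]
  split_ifs
  · rw [map_one]
  all_goals simp only [map_add, map_sub, map_mul, map_one, AlgHom.commutes, hx, Algebra.smul_def]

theorem Anum_eq {ι : OrbitCoef k i →ₐ[k] KLRHat k i}
    (hx : ∀ j, ι (OrbitCoef.x k i j) = KLRHat.x k i j) (r : Fin m) (u : SymOrbit i) :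
    Anum q r u = ι (ratioNum r u) := by
  rw [Anum, ratioNum]
  split_ifs
  all_goals simp only [map_add, map_sub, map_mul, map_one, map_neg, AlgHom.commutes, hx,
    Algebra.smul_def]

theorem A_mul_idem (hq : q ≠ 0) (hq1 : q ≠ 1) {ι : OrbitCoef k i →ₐ[k] KLRHat k i}
    (hx : ∀ j, ι (OrbitCoef.x k i j) = KLRHat.x k i j) (r : Fin m) (u : SymOrbit i) :
    A q r u * ι (idem k (u.s r)) =
      ι (idem k (u.s r)) * ι (ampl hq hq1 r.castSucc r.succ) := by
  obtain ⟨V, hV⟩ := (isUnit_ratioDenom hq hq1 r u).exists_right_inv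
  have hV' : ι (ratioDenom r u) * ι V = 1 := by rw [← map_mul, hV, map_one]
  have hinv : Ring.inverse (ι (ratioDenom r u)) = ι V := by
    rw [← mul_one (Ring.inverse _), ← hV', ← mul_assoc,
      Ring.inverse_mul_cancel _ ((isUnit_ratioDenom hq hq1 r u).map ι), one_mul]
  rw [A, Anum_eq hx, Adenom_eq hx, hinv, ← map_mul, ← map_mul, ← map_mul]
  congr 1
  linear_combination V * ratioNum_mul_idem hq hq1 r u +
    idem k (u.s r) * ampl hq hq1 r.castSucc r.succ * hV

end KLRHat

end Denominators

section Phat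

variable {k : Type*} [Field k] {q : k} {m : ℕ} {i : Fin (m + 1) → ZMod (orderOf q)}

theorem OrbitCoef.polyX_mem (p : MvPolynomial (Fin (m + 1)) k) {S : Subalgebra k (OrbitCoef k i)}
    (hS : ∀ j, X i j ∈ S) : polyX i p ∈ S := by
  have h : (⊤ : Subalgebra k (MvPolynomial (Fin (m + 1)) k)) ≤ S.comap (polyX i) := by
    rw [← MvPolynomial.adjoin_range_X, Algebra.adjoin_le_iff]
    rintro _ ⟨j, rfl⟩
    rw [SetLike.mem_coe, Subalgebra.mem_comap, polyX, MvPolynomial.aeval_X]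
    exact hS j
  exact h (Algebra.mem_top (x := p))

/-- The closures of the Laurent polynomials and of the polynomials and idempotents agree. -/
theorem KLRHat.closure_adjoin_eq (hq : q ≠ 0) {ι : OrbitCoef k i →ₐ[k] KLRHat k i}
    (hx : ∀ j, ι (OrbitCoef.x k i j) = KLRHat.x k i j)
    (hE : ∀ u, ι (idem k u) = KLRHat.E k i u) :
    closure (Algebra.adjoin k (Set.range (fun j => ι (OrbitCoef.X i j)) ∪
      Set.range fun j => ι ((XUnit i hq j)⁻¹ : (OrbitCoef k i)ˣ)) : Set (KLRHat k i)) =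
        KLRHat.Phat k i := by
  have hnil : ∀ l j, IsNilpotent (IdealCompletion.proj (k := k) (KLR.idealJ k i)
      (KLR.idealJ_antitone k i) l (ι (OrbitCoef.x k i j))) := fun l j => by
    rw [hx]; exact KLRHat.isNilpotent_proj_x i l j
  refine Set.Subset.antisymm (closure_minimal ?_ isClosed_closure)
    (closure_minimal ?_ isClosed_closure)
  -- Every coefficient is a limit of polynomials in the `x_j` and the idempotents; this covers the
  -- `X_j` and their inverses.
  · have key : ∀ F, ι F ∈ KLRHat.Phat k i := by
      refine fun F => (IdealCompletion.mem_closure_iff_proj _ _).2 fun l => ?_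
      obtain ⟨N, hN⟩ := exists_span_pow_le_ker ((IdealCompletion.proj _ _ l).comp ι) (hnil l)
      obtain ⟨P, hP, hFP⟩ := exists_polySubalgebra N F
      refine ⟨ι P, ?_, ?_⟩
      · have h : polySubalgebra k i ≤ (Algebra.adjoin k
            (Set.range (KLRHat.E k i) ∪ Set.range (KLRHat.x k i))).comap ι := by
          rw [polySubalgebra, Algebra.adjoin_le_iff]
          rintro _ (⟨u, rfl⟩ | ⟨j, rfl⟩)
          · exact Algebra.subset_adjoin (Or.inl ⟨u, (hE u).symm⟩)
          · exact Algebra.subset_adjoin (Or.inr ⟨j, (hx j).symm⟩)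
        exact h hP
      · refine (sub_eq_zero.1 ?_).symm
        rw [← map_sub, ← map_sub]
        exact hN _ hFP
    have h : Algebra.adjoin k (Set.range (fun j => ι (OrbitCoef.X i j)) ∪
        Set.range fun j => ι ((XUnit i hq j)⁻¹ : (OrbitCoef k i)ˣ)) ≤ ι.range := by
      rw [Algebra.adjoin_le_iff]
      rintro _ (⟨j, rfl⟩ | ⟨j, rfl⟩)
      · exact ⟨_, rfl⟩
      · exact ⟨_, rfl⟩
    intro z hz
    obtain ⟨F, rfl⟩ := h hz
    exact key F
  · intro z hz
    refine (IdealCompletion.mem_closure_iff_proj _ _).2 fun l => ?_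
    set S := Algebra.adjoin k (Set.range (fun j => ι (OrbitCoef.X i j)) ∪
      Set.range fun j => ι ((XUnit i hq j)⁻¹ : (OrbitCoef k i)ˣ)) with hS
    set π := IdealCompletion.proj (k := k) (KLR.idealJ k i) (KLR.idealJ_antitone k i) l with hπ
    have hX : ∀ j, OrbitCoef.X i j ∈ (S.map π).comap (π.comp ι) := fun j =>
      ⟨_, Algebra.subset_adjoin (Or.inl ⟨j, rfl⟩), rfl⟩
    -- At each level `e(u)` is the image of a polynomial in the `X_j`, and then so is `x_j`, by
    -- solving for it on each `e(u)`.
    have hid : ∀ u, idem k u ∈ (S.map π).comap (π.comp ι) := fun u => by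
      obtain ⟨N, hN⟩ := exists_span_pow_le_ker (π.comp ι) (hnil l)
      have h1 := hN _ (polyX_idemApprox hq u N)
      rw [map_sub, sub_eq_zero] at h1
      rw [Subalgebra.mem_comap, ← h1]
      exact OrbitCoef.polyX_mem _ hX
    have hle : (Algebra.adjoin k (Set.range (KLRHat.E k i) ∪ Set.range (KLRHat.x k i))) ≤
        (S.map π).comap π := by
      rw [Algebra.adjoin_le_iff]
      rintro _ (⟨u, rfl⟩ | ⟨j, rfl⟩)
      · rw [← hE]
        exact hid u
      · rw [← hx, x_eq_sum hq]
        exact (show _ ∈ (S.map π).comap (π.comp ι) from sum_mem fun u _ =>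
          mul_mem (add_mem (one_mem _) (mul_mem (Subalgebra.algebraMap_mem _ _) (hX j))) (hid u))
    obtain ⟨s, hs, hs'⟩ := hle hz
    exact ⟨s, hs, hs'⟩

end Phat

/-! ### The theorem -/

theorem mainTheorem4 {k : Type*} [Field k] [IsAlgClosed k] (p f ℓ m : ℕ) (hp : p.Prime)
    (hf : 0 < f) [CharP k ℓ] (hℓ : ℓ ≠ p) (q : k) (hq : q = ((p ^ f : ℕ) : k)) (hq1 : q ≠ 1)
    (i : Fin (m + 1) → ZMod (orderOf q)) :
    (∃! e : SymOrbit i → HeckeHat q i, HeckeHat.IsWeightIdempotents q i e) ∧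
    ∀ e : SymOrbit i → HeckeHat q i, HeckeHat.IsWeightIdempotents q i e →
      (∀ (r : Fin m) (u : SymOrbit i), u.1 r.succ ≠ u.1 r.castSucc →
        IsUnit (HeckeHat.cornerDenom q e r u)) ∧
      (∀ (r : Fin m) (u : SymOrbit i), IsUnit (KLRHat.Adenom q r u)) ∧
      ∃ γ : HeckeHat q i ≃ₐ[k] KLRHat k i,
        Continuous γ ∧ Continuous γ.symm ∧
        γ '' HeckeHat.Phat q i = KLRHat.Phat k i ∧
        (∀ u : SymOrbit i, γ (e u) = KLRHat.E k i u) ∧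
        (∀ (u : SymOrbit i) (j : Fin (m + 1)),
          γ ((HeckeHat.X q i j - algebraMap k _ (qpow q (u.1 j))) * e u) =
            -(qpow q (u.1 j) • (KLRHat.x k i j * KLRHat.E k i u))) ∧
        (∀ (r : Fin m) (u : SymOrbit i),
          γ (e (u.s r) * HeckeHat.Phi q e r) =
            KLRHat.A q r u * KLRHat.psi k i r * KLRHat.E k i u) := by
  -- The characteristic `ℓ` is zero or a prime different from `p`, so it does not divide `p^f`.
  have hq0 : q ≠ 0 := by
    rw [hq, ne_eq, CharP.cast_eq_zero_iff k ℓ]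
    intro h
    rcases CharP.char_is_prime_or_zero k ℓ with hl | rfl
    · exact hℓ ((Nat.prime_dvd_prime_iff_eq hl hp).1 (hl.dvd_of_dvd_pow h))
    · exact (pow_pos hp.pos f).ne' (Nat.eq_zero_of_zero_dvd h)
  refine ⟨⟨HeckeHat.weight hq0, HeckeHat.isWeightIdempotents hq0,
    fun e he => he.eq (HeckeHat.isWeightIdempotents hq0)⟩, fun e he => ?_⟩
  -- By uniqueness it suffices to treat the family that was constructed.
  obtain rfl := he.eq (HeckeHat.isWeightIdempotents hq0)
  obtain ⟨ιH, ιR, γ, hX, hid, hx, hE, hpsi, hγ, hγ', hγι, hγT⟩ :=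
    HeckeHat.exists_equiv i hq0 hq1
  refine ⟨fun r u h => ?_, fun r u => ?_, γ, hγ, hγ', ?_, fun u => ?_, fun u j => ?_,
    fun r u => ?_⟩
  · rw [HeckeHat.cornerDenom_weight hq0 hX hid]
    exact (isUnit_denom hq0 h).map ιH
  · rw [KLRHat.Adenom_eq hx]
    exact (isUnit_ratioDenom hq0 hq1 r u).map ιR
  · let h : HeckeHat q i ≃ₜ KLRHat k i :=
      { γ.toEquiv with continuous_toFun := hγ, continuous_invFun := hγ' }
    have h1 : γ '' HeckeHat.Phat q i = closure (γ '' (Algebra.adjoin k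
        (Set.range (HeckeHat.X q i) ∪ Set.range (HeckeHat.Xinv q i)) : Set (HeckeHat q i))) :=
      h.image_closure _
    have h2 : γ '' (Algebra.adjoin k
        (Set.range (HeckeHat.X q i) ∪ Set.range (HeckeHat.Xinv q i)) : Set (HeckeHat q i)) =
        Algebra.adjoin k (γ '' (Set.range (HeckeHat.X q i) ∪ Set.range (HeckeHat.Xinv q i))) :=
      congrArg SetLike.coe (AlgHom.map_adjoin (γ : HeckeHat q i →ₐ[k] KLRHat k i) _)
    have h3 : (γ ∘ HeckeHat.X q i) = fun j => ιR (OrbitCoef.X i j) := funext fun j => by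
      rw [Function.comp_apply, ← hX, hγι]
    have h4 : (γ ∘ HeckeHat.Xinv q i) = fun j => ιR ((XUnit i hq0 j)⁻¹ : (OrbitCoef k i)ˣ) :=
      funext fun j => by rw [Function.comp_apply, ← HeckeHat.map_XUnit_inv hq0 hX, hγι]
    rw [h1, h2, ← KLRHat.closure_adjoin_eq hq0 hx hE, Set.image_union, ← Set.range_comp,
      ← Set.range_comp, h3, h4]
  · rw [← hid, hγι, hE]
  · rw [← hid, ← hX, ← AlgHom.commutes ιH, ← map_sub, ← map_mul, hγι, X_sub_mul_idem, map_mul,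
      map_neg, map_mul, AlgHom.commutes, hx, hE, Algebra.smul_def, neg_mul, mul_assoc]
  -- `Φ_r` is `T_r + shift`, whose image is `ampl · ψ_r`; the idempotent at `s_r u` then turns
  -- `ampl` into `A_r^u` and passes through `ψ_r` to become `e(u)`.
  · rw [HeckeHat.Phi_weight hq0 hX hid, ← hid, map_mul, map_add, hγι, hγι, hγT, heckeOfPsi,
      sub_add_cancel, ← mul_assoc, ← KLRHat.A_mul_idem hq0 hq1 hx, mul_assoc, mul_assoc,
      ← hpsi.psi_idem, hE]

end
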